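/- Let $\hbar>0$ and $v_0>0$. For real $k,\lambda$ consider the formally symmetric differential expressions $$\hat C_1=\hbar^2\partial_v^2+\tfrac{\hbar^2}{v}\partial_v-\tfrac{\hbar^2}{v^2}\partial_\varphi^2-i\hbar\partial_t,\quad \hat H=\hbar^2\bigl(-\partial_v^2-\tfrac1v\partial_v+\tfrac1{v^2}\partial_\varphi^2\bigr),\quad \hat D_1(k)=\hbar^2\Bigl(-\partial_v^2-\frac{\frac14+k^2}{v^2}\Bigr)$$ in $L^2(\mathbb R^2\times\mathbb R_+,v\,dt\,d\varphi\,dv)$, $L^2(\mathbb R\times\mathbb R_+,v\,d\varphi\,dv)$ and $L^2(\mathbb R_+,dv)$ respectively ($\hat C_1$ is the Hamiltonian constraint, $\hat H$ the Hamiltonian of the theory with $t$ as clock), and $$\hat C_2=\hbar^2\partial_\varphi^2-\hbar^2\partial_u^2+i\hbar v_0^2e^{2u}\partial_t,\quad \hat G=-\hbar^2\partial_u^2+i\hbar v_0^2e^{2u}\partial_t,\quad \hat D_2(\lambda)=-\hbar^2\partial_u^2-\lambda v_0^2e^{2u}$$ in $L^2(\mathbb R^3,du\,d\varphi\,dt)$,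 $L^2(\mathbb R^2,dt\,du)$ and $L^2(\mathbb R,du)$ ($\hat G$ is the operator of the theory with $\varphi$ as clock, with $\lambda=-i\hbar\partial_t$). For each of them, the minimal operator has domain $C_c^\infty$ (supported in $v>0$ for the first three), and the maximal operator is its adjoint, i.e. the weak differential operator. "Self-adjoint on a domain" refers to the restriction of the maximal operator to the intersection of its domain with that subspace. A family of closed operators $T(\xi)$ is called measurable if, for some countable family of measurable sections, the graph of $T(\xi)$ is the closure of the values of the sections at $\xi$, for almost every $\xi$. Unitarity of the $t$-clock theory means self-adjointness of $\hat H$; unitarity of the $\varphi$-clock theory means self-adjointness of $\hat G$. (0) Multiplying by $v^2$ and substituting $v=v_0e^u$ turns $\hat C_1$ into $\hat C_2$ up to the sign: $\hat C_2\zeta=-v^2\,\hat C_1\eta$ for test functions related by $\zeta(\varphi,t,u)=\eta(\varphi,t,v_0e^u)$. (1) Rescaling and Fourier transform, $$\widehat\Psi(k,\lambda,v)=\frac1{2\pi\sqrt\hbar}\int_{\mathbb R^2}e^{-i(k\varphi+\lambda t/\hbar)}\,v^{1/2}\Psi(v,\varphi,t)\,d\varphi\,dt ,$$ extends from $C_c^\infty$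 to a unitary map $L^2(v\,dt\,d\varphi\,dv)\to L^2(dk\,d\lambda\,dv)$. The maximal operators satisfy: $\hat C_1\Psi=\chi$ if and only if for almost every $(k,\lambda)$ the fibre $\widehat\Psi(k,\lambda,\cdot)$ is in the maximal domain of $\hat D_1(k)$ and $\widehat\chi(k,\lambda,\cdot)=(\lambda-\hat D_1(k))\widehat\Psi(k,\lambda,\cdot)$. For every family of subspaces $S(k,\lambda)\subset L^2(\mathbb R_+)$ such that the restrictions of $\hat D_1(k)$ to $S(k,\lambda)$ form a measurable family of closed operators, $\hat C_1$ on $\{\Psi:\widehat\Psi(k,\lambda,\cdot)\in S(k,\lambda)\text{ for a.e. }(k,\lambda)\}$ is self-adjoint if and only if $\hat D_1(k)$ on $S(k,\lambda)$ is self-adjoint for almost every $(k,\lambda)$. In the same way, by rescaling with $v^{1/2}$ and the unitary Fourier transform in $\varphi$ (kernel $(2\pi)^{-1/2}e^{-ik\varphi}$), the maximal operator $\hat H$ acts fibrewise as the maximal operators $\hat D_1(k)$, and for a family $S(k)$ of this kind $\hat H$ on the corresponding domain is self-adjoint if and only if $\hat D_1(k)$ on $S(k)$ is for almost every $k$; moreover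 $\hat C_1$ on the domain defined by $S(k)$ is self-adjoint if and only if $\hat H$ on the domain defined by $S(k)$ is. Finally, on $C_c^\infty$, the following are equivalent: $\hat C_1$ is essentially self-adjoint; $\hat D_1(k)$ is for almost every $k$; $\hat D_1(k)$ is for every $k$; $\hat H$ is. (2) Fourier transform, $$\widehat\Psi(k,\lambda,u)=\frac1{2\pi\sqrt\hbar}\int_{\mathbb R^2}e^{-i(k\varphi+\lambda t/\hbar)}\,\Psi(u,\varphi,t)\,d\varphi\,dt ,$$ extends from $C_c^\infty$ to a unitary map of $L^2(\mathbb R^3)$. The maximal operators satisfy: $\hat C_2\Psi=\chi$ if and only if for almost every $(k,\lambda)$ the fibre $\widehat\Psi(k,\lambda,\cdot)$ is in the maximal domain of $\hat D_2(\lambda)$ and $\widehat\chi(k,\lambda,\cdot)=(\hat D_2(\lambda)-\hbar^2k^2)\widehat\Psi(k,\lambda,\cdot)$. For every family $S(k,\lambda)\subset L^2(\mathbb R)$ such that the restrictions of $\hat D_2(\lambda)$ to $S(k,\lambda)$ form a measurable family of closed operators, $\hat C_2$ on $\{\Psi:\widehat\Psi(k,\lambda,\cdot)\in S(k,\lambda)\text{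 a.e.}\}$ is self-adjoint if and only if $\hat D_2(\lambda)$ on $S(k,\lambda)$ is self-adjoint for almost every $(k,\lambda)$. In the same way, by the unitary Fourier transform in $t$ (kernel $(2\pi\hbar)^{-1/2}e^{-i\lambda t/\hbar}$), the maximal operator $\hat G$ acts fibrewise as the maximal operators $\hat D_2(\lambda)$, and for a family $S(\lambda)$ of this kind $\hat G$ on the corresponding domain is self-adjoint if and only if $\hat D_2(\lambda)$ on $S(\lambda)$ is for almost every $\lambda$; moreover $\hat C_2$ on the domain defined by $S(\lambda)$ is self-adjoint if and only if $\hat G$ on the domain defined by $S(\lambda)$ is. Finally, on $C_c^\infty$, the following are equivalent: $\hat C_2$ is essentially self-adjoint; $\hat D_2(\lambda)$ is for almost every $\lambda$; $\hat D_2(\lambda)$ is for every $\lambda$; $\hat G$ is. Hence self-adjointness of $\hat C_1$ (lapse $1$) is the unitarity condition of the $t$-clock theory, and self-adjointness of $\hat C_2$ (lapse $v^2$) is that of the $\varphi$-clock theory. -/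

import Mathlib

open MeasureTheory Set TopologicalSpace
open scoped ContDiff Distributions

noncomputable section

namespace DiracQuantisation

/-! ### Differential expressions and their minimal and maximal `L²`-realisations -/

section Realisations

variable {E : Type*} [NormedAddCommGroup E] [NormedSpace ℝ E] {Ω : Opens E}

/-- The partial derivative in the direction `w`, acting on test functions. -/
def pd (Ω : Opens E) (w : E) : Module.End ℂ 𝓓(Ω, ℂ) :=
  (LineDeriv.lineDerivOpCLM ℂ 𝓓(Ω, ℂ) w).toLinearMap

theorem contDiff_mul_test {c : E → ℝ} (hc : ContDiffOn ℝ ∞ c Ω) (η : 𝓓(Ω, ℂ)) :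
    ContDiff ℝ ∞ (fun x => c x • η x) := by
  rw [contDiff_iff_contDiffAt]
  intro x
  by_cases hx : x ∈ (Ω : Set E)
  · exact (hc.contDiffAt (Ω.isOpen.mem_nhds hx)).smul η.contDiff.contDiffAt
  · have hx' : x ∉ tsupport η := fun h => hx (η.tsupport_subset h)
    have h0 : (fun y => c y • η y) =ᶠ[nhds x] fun _ => (0 : ℂ) := by
      filter_upwards [notMem_tsupport_iff_eventuallyEq.mp hx'] with y hy
      simp [hy]
    exact contDiffAt_const.congr_of_eventuallyEq h0

/-- Multiplication of test functions on `Ω` by a real coefficient which is smooth on `Ω`. -/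
def mulBy (c : E → ℝ) (hc : ContDiffOn ℝ ∞ c Ω) : Module.End ℂ 𝓓(Ω, ℂ) where
  toFun η :=
    { toFun := fun x => c x • η x
      contDiff' := contDiff_mul_test hc η
      hasCompactSupport' := η.hasCompactSupport.of_isClosed_subset (isClosed_tsupport _)
        (tsupport_smul_subset_right c η)
      tsupport_subset' := (tsupport_smul_subset_right c η).trans η.tsupport_subset }
  map_add' η ζ := by
    ext x
    change c x • (η x + ζ x) = c x • η x + c x • ζ x
    rw [smul_add]
  map_smul' a η := by
    ext x
    change c x • (a • η x) = a • (c x • η x)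
    rw [smul_comm]

variable [MeasurableSpace E] [BorelSpace E]

/-- The class of a test function in `L²(μ)`. -/
def testToLp (μ : Measure E) [IsFiniteMeasureOnCompacts μ] :
    𝓓(Ω, ℂ) →ₗ[ℂ] Lp ℂ 2 μ where
  toFun η := (η.continuous.memLp_of_hasCompactSupport (p := 2) (μ := μ)
    η.hasCompactSupport).toLp η
  map_add' _ _ := rfl
  map_smul' _ _ := rfl

/-- The minimal realisation in `L²(μ)` of the differential expression `A`: the operator
`η ↦ A η` with domain `C_c^∞(Ω)`. -/
def minimalOp (μ : Measure E) [IsFiniteMeasureOnCompacts μ] (A : Module.End ℂ 𝓓(Ω, ℂ)) :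
    Lp ℂ 2 μ →ₗ.[ℂ] Lp ℂ 2 μ :=
  (LinearMap.range ((testToLp μ).prod (testToLp μ ∘ₗ A))).toLinearPMap

/-- The maximal realisation in `L²(μ)` of a differential expression `A` that is formally symmetric
with respect to `μ`: it sends `Ψ` to `χ` when `AΨ = χ` weakly, that is, when
`⟪A η, Ψ⟫ = ⟪η, χ⟫` for all test functions `η`. -/
def maximalOp (μ : Measure E) [IsFiniteMeasureOnCompacts μ] (A : Module.End ℂ 𝓓(Ω, ℂ)) :
    Lp ℂ 2 μ →ₗ.[ℂ] Lp ℂ 2 μ :=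
  (minimalOp μ A).adjoint

/-- Essential self-adjointness: the closure is self-adjoint. -/
def IsEssentiallySelfAdjoint {H : Type*} [NormedAddCommGroup H] [InnerProductSpace ℂ H]
    [CompleteSpace H] (T : H →ₗ.[ℂ] H) : Prop :=
  IsSelfAdjoint T.closure

end Realisations

/-! ### Fibres of elements of `L²(X × ℝ)` over `X`, and operators acting fibrewise -/

section Fibres

variable {X : Type*} [MeasureSpace X]

/-- `f` is the fibre `F(x, ·)` of `F` at `x`. -/
def IsFibre {ν : Measure ℝ} (F : Lp ℂ 2 ((volume : Measure X).prod ν)) (x : X)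
    (f : Lp ℂ 2 ν) : Prop :=
  (fun y => F (x, y)) =ᵐ[ν] f

/-- The elements of `L²(X × ℝ)` whose fibre at `x` lies in `S x` for almost every `x`. -/
def fibredSubmodule {ν : Measure ℝ} [SFinite ν] (S : X → Submodule ℂ (Lp ℂ 2 ν)) :
    Submodule ℂ (Lp ℂ 2 ((volume : Measure X).prod ν)) where
  carrier := {F | ∀ᵐ x, ∃ f ∈ S x, IsFibre F x f}
  zero_mem' := by
    change ∀ᵐ x, ∃ f ∈ S x, IsFibre 0 x f
    have h := Measure.ae_ae_of_ae_prod (Lp.coeFn_zero ℂ 2 ((volume : Measure X).prod ν))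
    filter_upwards [h] with x hx
    refine ⟨0, (S x).zero_mem, ?_⟩
    filter_upwards [hx, Lp.coeFn_zero ℂ 2 ν] with y h1 h2
    simp_all
  add_mem' := by
    intro F G hF hG
    change ∀ᵐ x, ∃ f ∈ S x, IsFibre F x f at hF
    change ∀ᵐ x, ∃ f ∈ S x, IsFibre G x f at hG
    change ∀ᵐ x, ∃ f ∈ S x, IsFibre (F + G) x f
    have h := Measure.ae_ae_of_ae_prod (Lp.coeFn_add F G)
    filter_upwards [h, hF, hG] with x hx h1 h2
    obtain ⟨f, hf, hf'⟩ := h1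
    obtain ⟨g, hg, hg'⟩ := h2
    refine ⟨f + g, (S x).add_mem hf hg, ?_⟩
    filter_upwards [hx, hf', hg', Lp.coeFn_add f g] with y h1 h2 h3 h4
    simp_all
  smul_mem' := by
    intro c F hF
    change ∀ᵐ x, ∃ f ∈ S x, IsFibre F x f at hF
    change ∀ᵐ x, ∃ f ∈ S x, IsFibre (c • F) x f
    have h := Measure.ae_ae_of_ae_prod (Lp.coeFn_smul c F)
    filter_upwards [h, hF] with x hx h1
    obtain ⟨f, hf, hf'⟩ := h1
    refine ⟨c • f, (S x).smul_mem c hf, ?_⟩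
    filter_upwards [hx, hf', Lp.coeFn_smul c f] with y h1 h2 h3
    simp_all

/-- A measurable field of closed operators over `X`: for almost every `x` the graph of `T x` is
the closure of the values at `x` of a fixed sequence of measurable sections. -/
def IsMeasurableClosedField {H : Type*} [NormedAddCommGroup H] [InnerProductSpace ℂ H]
    (T : X → H →ₗ.[ℂ] H) : Prop :=
  ∃ s : ℕ → X → H × H, (∀ n, StronglyMeasurable (s n)) ∧
    ∀ᵐ x, ((T x).graph : Set (H × H)) = closure (range fun n => s n x)

/-- `U` is the unitary map "multiply by `w` in the second variable, then take the Fourier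
transform `N ∫ e^{-i θ(ξ, x)} (·) dx` in the first variable". The formula is required on
test functions, which are dense and hence determine `U`. -/
def IsRescaledFourier {X : Type*} [NormedAddCommGroup X] [NormedSpace ℝ X] [MeasureSpace X]
    [BorelSpace X] [SecondCountableTopology X] (Ω : Opens (X × ℝ)) {ρ ν : Measure ℝ}
    [IsFiniteMeasureOnCompacts ((volume : Measure X).prod ρ)]
    (w : ℝ → ℝ) (N : ℝ) (θ : X → X → ℝ)
    (U : Lp ℂ 2 ((volume : Measure X).prod ρ) ≃ₗᵢ[ℂ] Lp ℂ 2 ((volume : Measure X).prod ν)) :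
    Prop :=
  ∀ η : 𝓓(Ω, ℂ), U (testToLp _ η) =ᵐ[(volume : Measure X).prod ν] fun p =>
    (N : ℂ) * ∫ x : X, Complex.exp (-(Complex.I * (θ p.1 x : ℂ))) * ((w p.2 : ℂ) * η (x, p.2))

end Fibres

/-! ### The Hilbert spaces -/

/-- The measure `dv` on `(0, ∞)`. -/
def halfLine : Measure ℝ := volume.restrict (Ioi 0)

/-- The measure `v dv` on `(0, ∞)`. -/
def halfLineV : Measure ℝ := halfLine.withDensity fun v => ENNReal.ofReal v

instance : IsLocallyFiniteMeasure halfLine := by unfold halfLine; infer_instance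

instance : SFinite halfLine := by unfold halfLine; infer_instance

instance : SFinite halfLineV := by unfold halfLineV; infer_instance

instance : IsLocallyFiniteMeasure halfLineV :=
  IsLocallyFiniteMeasure.withDensity_ofReal continuous_id

/-- The half-line `v > 0`. -/
def posLine : Opens ℝ := ⟨Ioi 0, isOpen_Ioi⟩

/-- The region `v > 0` in `X × ℝ`. -/
def posPart (X : Type*) [TopologicalSpace X] : Opens (X × ℝ) :=
  ⟨{p | 0 < p.2}, isOpen_lt continuous_const continuous_snd⟩

/-! ### The differential expressions -/

theorem contDiffOn_inv (n : ℕ) : ContDiffOn ℝ ∞ (fun v : ℝ => (v ^ n)⁻¹) posLine :=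
  (contDiff_id.pow n).contDiffOn.inv fun _ hv => (pow_pos (show (0 : ℝ) < _ from hv) n).ne'

theorem contDiffOn_inv' (X : Type*) [NormedAddCommGroup X] [NormedSpace ℝ X] (n : ℕ) :
    ContDiffOn ℝ ∞ (fun p : X × ℝ => (p.2 ^ n)⁻¹) (posPart X) :=
  (contDiff_snd.pow n).contDiffOn.inv fun _ hv => (pow_pos (show (0 : ℝ) < _ from hv) n).ne'

/-- Multiplication by `v⁻ⁿ` on `(0, ∞)`. -/
def invPow (n : ℕ) : Module.End ℂ 𝓓(posLine, ℂ) := mulBy _ (contDiffOn_inv n)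

/-- Multiplication by `v⁻ⁿ` on `X × (0, ∞)`. -/
def invPow' (X : Type*) [NormedAddCommGroup X] [NormedSpace ℝ X] (n : ℕ) :
    Module.End ℂ 𝓓(posPart X, ℂ) := mulBy _ (contDiffOn_inv' X n)

/-- Multiplication by `v₀² e^{2u}` on `ℝ`. -/
def expMul (v₀ : ℝ) : Module.End ℂ 𝓓((⊤ : Opens ℝ), ℂ) :=
  mulBy (fun u => v₀ ^ 2 * Real.exp (2 * u)) (by fun_prop)

/-- Multiplication by `v₀² e^{2u}` on `X × ℝ`. -/
def expMul' (X : Type*) [NormedAddCommGroup X] [NormedSpace ℝ X] (v₀ : ℝ) :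
    Module.End ℂ 𝓓((⊤ : Opens (X × ℝ)), ℂ) :=
  mulBy (fun p => v₀ ^ 2 * Real.exp (2 * p.2)) (by fun_prop)

/-- `Ĉ₁ = ħ² ∂_v² + (ħ²/v) ∂_v - (ħ²/v²) ∂_φ² - iħ ∂_t` in the coordinates `((φ, t), v)`,
`v > 0`. -/
def C₁ (ħ : ℝ) : Module.End ℂ 𝓓(posPart (ℝ × ℝ), ℂ) :=
  let dφ := pd (posPart (ℝ × ℝ)) ((1, 0), 0)
  let dt := pd (posPart (ℝ × ℝ)) ((0, 1), 0)
  let dv := pd (posPart (ℝ × ℝ)) ((0, 0), 1)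
  (ħ : ℂ) ^ 2 • (dv * dv) + (ħ : ℂ) ^ 2 • (invPow' (ℝ × ℝ) 1 * dv)
    - (ħ : ℂ) ^ 2 • (invPow' (ℝ × ℝ) 2 * (dφ * dφ)) - (Complex.I * ħ) • dt

/-- `Ĥ = ħ² (-∂_v² - (1/v) ∂_v + (1/v²) ∂_φ²)` in the coordinates `(φ, v)`, `v > 0`: the
Hamiltonian of the `t`-clock theory. -/
def Ham (ħ : ℝ) : Module.End ℂ 𝓓(posPart ℝ, ℂ) :=
  let dφ := pd (posPart ℝ) (1, 0)
  let dv := pd (posPart ℝ) (0, 1)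
  (ħ : ℂ) ^ 2 • (-(dv * dv) - invPow' ℝ 1 * dv + invPow' ℝ 2 * (dφ * dφ))

/-- `D̂₁ = ħ² (-∂_v² - (1/4 + k²)/v²)` on `v > 0`. -/
def D₁ (ħ k : ℝ) : Module.End ℂ 𝓓(posLine, ℂ) :=
  (ħ : ℂ) ^ 2 • (-(pd posLine 1 * pd posLine 1) - (1 / 4 + (k : ℂ) ^ 2) • invPow 2)

/-- `Ĉ₂ = ħ² ∂_φ² - ħ² ∂_u² + iħ v₀² e^{2u} ∂_t` in the coordinates `((φ, t), u)`. -/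
def C₂ (ħ v₀ : ℝ) : Module.End ℂ 𝓓((⊤ : Opens ((ℝ × ℝ) × ℝ)), ℂ) :=
  let dφ := pd (⊤ : Opens ((ℝ × ℝ) × ℝ)) ((1, 0), 0)
  let dt := pd (⊤ : Opens ((ℝ × ℝ) × ℝ)) ((0, 1), 0)
  let du := pd (⊤ : Opens ((ℝ × ℝ) × ℝ)) ((0, 0), 1)
  (ħ : ℂ) ^ 2 • (dφ * dφ) - (ħ : ℂ) ^ 2 • (du * du)
    + (Complex.I * ħ) • (expMul' (ℝ × ℝ) v₀ * dt)

/-- `Ĝ = -ħ² ∂_u² - λ v₀² e^{2u}` with `λ = -iħ ∂_t`, in the coordinates `(t, u)`: the operator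
of the `φ`-clock theory. -/
def Gop (ħ v₀ : ℝ) : Module.End ℂ 𝓓((⊤ : Opens (ℝ × ℝ)), ℂ) :=
  let dt := pd (⊤ : Opens (ℝ × ℝ)) (1, 0)
  let du := pd (⊤ : Opens (ℝ × ℝ)) (0, 1)
  (ħ : ℂ) ^ 2 • -(du * du) - expMul' ℝ v₀ * ((-(Complex.I * ħ)) • dt)

/-- `D̂₂ = -ħ² ∂_u² - l v₀² e^{2u}` on `ℝ`, for a real number `l`. -/
def D₂ (ħ v₀ l : ℝ) : Module.End ℂ 𝓓((⊤ : Opens ℝ), ℂ) :=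
  (ħ : ℂ) ^ 2 • -(pd ⊤ 1 * pd ⊤ 1) - (l : ℂ) • expMul v₀

/-! ### The realisations in the respective `L²`-spaces -/

/-- The measure `v dφ dt dv` of the first kinematical Hilbert space. -/
abbrev kin₁ : Measure ((ℝ × ℝ) × ℝ) := volume.prod halfLineV

/-- The measure `v dφ dv` of the `t`-clock Hilbert space. -/
abbrev tClock : Measure (ℝ × ℝ) := volume.prod halfLineV

/-- The measure `dφ dt du` of the second kinematical Hilbert space. -/
abbrev kin₂ : Measure ((ℝ × ℝ) × ℝ) := volume.prod volume

/-- The measure `dt du`. -/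
abbrev phiClock : Measure (ℝ × ℝ) := volume.prod volume

/-- `Ĉ₁` as a weak differential operator in `L²(v dφ dt dv)`, on the submodule `S` of its
maximal domain. -/
def C₁On (ħ : ℝ) (S : Submodule ℂ (Lp ℂ 2 kin₁)) : Lp ℂ 2 kin₁ →ₗ.[ℂ] Lp ℂ 2 kin₁ :=
  (maximalOp kin₁ (C₁ ħ)).domRestrict S

/-- `Ĥ` as a weak differential operator in `L²(v dφ dv)`, on the submodule `S` of its
maximal domain. -/
def HamOn (ħ : ℝ) (S : Submodule ℂ (Lp ℂ 2 tClock)) : Lp ℂ 2 tClock →ₗ.[ℂ] Lp ℂ 2 tClock :=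
  (maximalOp tClock (Ham ħ)).domRestrict S

/-- `D̂₁` as a weak differential operator in `L²((0, ∞), dv)`, on the submodule `S` of its
maximal domain. -/
def D₁On (ħ k : ℝ) (S : Submodule ℂ (Lp ℂ 2 halfLine)) :
    Lp ℂ 2 halfLine →ₗ.[ℂ] Lp ℂ 2 halfLine :=
  (maximalOp halfLine (D₁ ħ k)).domRestrict S

/-- `Ĉ₂` as a weak differential operator in `L²(dφ dt du)`, on the submodule `S` of its
maximal domain. -/
def C₂On (ħ v₀ : ℝ) (S : Submodule ℂ (Lp ℂ 2 kin₂)) : Lp ℂ 2 kin₂ →ₗ.[ℂ] Lp ℂ 2 kin₂ :=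
  (maximalOp kin₂ (C₂ ħ v₀)).domRestrict S

/-- `Ĝ` as a weak differential operator in `L²(dt du)`, on the submodule `S` of its
maximal domain. -/
def GopOn (ħ v₀ : ℝ) (S : Submodule ℂ (Lp ℂ 2 phiClock)) :
    Lp ℂ 2 phiClock →ₗ.[ℂ] Lp ℂ 2 phiClock :=
  (maximalOp phiClock (Gop ħ v₀)).domRestrict S

/-- `D̂₂` as a weak differential operator in `L²(ℝ, du)`, on the submodule `S` of its
maximal domain. -/
def D₂On (ħ v₀ l : ℝ) (S : Submodule ℂ (Lp ℂ 2 (volume : Measure ℝ))) :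
    Lp ℂ 2 (volume : Measure ℝ) →ₗ.[ℂ] Lp ℂ 2 (volume : Measure ℝ) :=
  (maximalOp volume (D₂ ħ v₀ l)).domRestrict S

/-- The subspace of `L²` which `U` carries onto the elements whose fibre at almost every `x` lies
in `S x`. -/
def pullback {X : Type*} [MeasureSpace X] {ρ ν : Measure ℝ} [SFinite ν]
    (U : Lp ℂ 2 ((volume : Measure X).prod ρ) ≃ₗᵢ[ℂ] Lp ℂ 2 ((volume : Measure X).prod ν))
    (S : X → Submodule ℂ (Lp ℂ 2 ν)) : Submodule ℂ (Lp ℂ 2 ((volume : Measure X).prod ρ)) :=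
  (fibredSubmodule S).comap U.toLinearEquiv.toLinearMap

end DiracQuantisation

end

namespace DiracQuantisation

/-! ### Graphs, adjoints and self-adjointness -/

section Graphs

variable {H : Type*} [NormedAddCommGroup H] [InnerProductSpace ℂ H]

/-! Operators are handled through their graphs, as relations in `H × H`: adjoints of relations need
no density, and `IsSelfAdjoint T` becomes `T.graph.adjoint = T.graph` (`isSelfAdjoint_iff_graph`).

The abstract engine is the direct integral of a measurable field of closed relations. Its adjoint
may be taken fibrewise (`adjoint_directIntegral`): pairing with the generating sections, truncated
to arbitrary sets of finite measure, localises the defining identity to almost every fibre. It is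
self-adjoint exactly when almost every fibre is (`directIntegral_selfAdjoint_iff`).

The concrete input is the rescaled Fourier transform, unitary by Plancherel in the first variable.
It turns each of the four expressions on the product into `c(ξ) ± B(ξ)` with `c` real and `B(ξ)` one
of the `D₁`, `D₂`. A weak identity passes to the fibres because translating a test function
multiplies its transform by a character: the discrepancy on the fibres is an integrable function of
`ξ` whose Fourier transform vanishes (`ae_inner_rescaledFourier`). Since `B(ξ)` is affine in one
scalar, countably many test functions form a common core for all `ξ`, so the exceptional null sets
can be united (`exists_core`, `isFibred_fourierUnitary`).

A real shift and a sign change neither self-adjointness nor essential self-adjointness. So a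
constraint and the Hamiltonian with the same fibre operators obey the same almost-everywhere
condition; a condition on one coordinate of the plane holds almost everywhere exactly when it does
so on the line.

"Almost every" and "every" agree for essential self-adjointness because both are false: `D₁` fails
for `k ≠ 0` and `D₂` for `λ > 0`. The functions `v^{1/2+ik}` and `exp(-u/2 + i c eᵘ)` are explicit
solutions, square integrable at the singular end, with nonzero Wronskian against their conjugates;
once cut off, they contradict symmetry of the maximal operator. -/

theorem mem_adjoint {Γ : Submodule ℂ (H × H)} {x : H × H} :
    x ∈ Γ.adjoint ↔ ∀ p ∈ Γ, inner ℂ p.2 x.1 = inner ℂ p.1 x.2 := by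
  rw [Submodule.mem_adjoint_iff]
  exact ⟨fun h p hp => sub_eq_zero.1 (h p.1 p.2 hp), fun h a b hab => sub_eq_zero.2 (h _ hab)⟩

theorem isClosed_adjoint (Γ : Submodule ℂ (H × H)) : IsClosed (Γ.adjoint : Set (H × H)) := by
  have : (Γ.adjoint : Set (H × H)) =
      ⋂ p ∈ Γ, {x : H × H | inner ℂ p.2 x.1 = inner ℂ p.1 x.2} := by
    ext x
    simp only [SetLike.mem_coe, mem_adjoint, mem_iInter, mem_ofPred_eq]
  rw [this]
  refine isClosed_biInter fun p _ => isClosed_eq ?_ ?_ <;> fun_prop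

/-- The defining identity is a closed condition on the tested pair. The set `s` need not be a
subspace, so a countable family can test a whole relation. -/
theorem mem_adjoint_of_closure {Γ : Submodule ℂ (H × H)} {s : Set (H × H)}
    (hΓ : (Γ : Set (H × H)) ⊆ closure s) {x : H × H}
    (h : ∀ p ∈ s, inner ℂ p.2 x.1 = inner ℂ p.1 x.2) : x ∈ Γ.adjoint := by
  rw [mem_adjoint]
  intro p hp
  have hcl : IsClosed {p : H × H | inner ℂ p.2 x.1 = inner ℂ p.1 x.2} := by
    refine isClosed_eq ?_ ?_ <;> fun_prop
  exact closure_minimal h hcl (hΓ hp)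

theorem adjoint_topologicalClosure (Γ : Submodule ℂ (H × H)) :
    Γ.topologicalClosure.adjoint = Γ.adjoint := by
  refine le_antisymm (fun x hx => ?_) fun x hx => ?_
  · exact mem_adjoint.2 fun p hp => mem_adjoint.1 hx p (Γ.le_topologicalClosure hp)
  · exact mem_adjoint_of_closure (s := Γ) (by simp) (mem_adjoint.1 hx)

theorem le_adjoint_adjoint (Γ : Submodule ℂ (H × H)) : Γ ≤ Γ.adjoint.adjoint := by
  intro x hx
  rw [mem_adjoint]
  intro p hp
  have h := mem_adjoint.1 hp x hx
  rw [← inner_conj_symm, ← h, inner_conj_symm]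

/-- A closed symmetric relation is self-adjoint if the sums of its elements and its rotated
elements are dense. -/
theorem adjoint_le_of_dense_decomposition {Γ : Submodule ℂ (H × H)}
    (hΓ : IsClosed (Γ : Set (H × H))) (hs : Γ ≤ Γ.adjoint) {D : Set (H × H)} (hD : Dense D)
    (h : ∀ e ∈ D, ∃ p ∈ Γ, ∃ q ∈ Γ, e.1 = p.1 - q.2 ∧ e.2 = p.2 + q.1) : Γ.adjoint ≤ Γ := by
  intro r hr
  have : r ∈ closure (Γ : Set (H × H)) := by
    rw [Metric.mem_closure_iff]
    intro ε hε
    -- Write `e = p + J q` with `J q = (-q.2, q.1)`. As `r - p` lies in the adjoint, it is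
    -- orthogonal to `J q`, so by Pythagoras it is no longer than `r - e` in the `ℓ²` norm. The
    -- product carries the maximum norm; the radius `ε / 2` absorbs the factor `√2`.
    obtain ⟨e, hb, he⟩ := Metric.dense_iff.1 hD r (ε / 2) (half_pos hε)
    obtain ⟨p, hp, q, hq, h1, h2⟩ := h e he
    refine ⟨p, hp, ?_⟩
    have hrp : r - p ∈ Γ.adjoint := sub_mem hr (hs hp)
    have ho := mem_adjoint.1 hrp q hq
    rw [Metric.mem_ball, dist_eq_norm, Prod.norm_def, max_lt_iff] at hb
    have e1 : (e - r).1 = -((r - p).1 + q.2) := by simp [h1]; abel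
    have e2 : (e - r).2 = -((r - p).2 - q.1) := by simp [h2]; abel
    rw [e1, e2, norm_neg, norm_neg] at hb
    have n1 := norm_add_sq (𝕜 := ℂ) (r - p).1 q.2
    have n2 := norm_sub_sq (𝕜 := ℂ) (r - p).2 q.1
    have hre : RCLike.re (inner ℂ (r - p).1 q.2) = RCLike.re (inner ℂ (r - p).2 q.1) := by
      rw [inner_re_symm, ho, inner_re_symm]
    rw [dist_eq_norm, Prod.norm_def, max_lt_iff]
    have s1 := norm_nonneg (r - p).1
    have s2 := norm_nonneg (r - p).2
    have t1 := norm_nonneg ((r - p).1 + q.2)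
    have t2 := norm_nonneg ((r - p).2 - q.1)
    constructor <;> refine lt_of_pow_lt_pow_left₀ 2 hε.le ?_ <;>
      nlinarith [sq_nonneg ‖q.1‖, sq_nonneg ‖q.2‖, sq_nonneg ‖(r - p).1‖, sq_nonneg ‖(r - p).2‖]
  rwa [hΓ.closure_eq] at this

variable [CompleteSpace H]

/-- Von Neumann's decomposition: the orthogonal complement of `Γ` is the image of its adjoint under
the rotation `(x, y) ↦ (-y, x)`. The passage to `WithLp 2` supplies the Hilbert structure, since `H
× H` carries the maximum norm. -/
theorem exists_graph_decomposition {Γ : Submodule ℂ (H × H)} (hΓ : IsClosed (Γ : Set (H × H)))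
    (a b : H) : ∃ p ∈ Γ, ∃ q ∈ Γ.adjoint, a = p.1 - q.2 ∧ b = p.2 + q.1 := by
  let e := WithLp.linearEquiv 2 ℂ (H × H)
  let Γ' : Submodule ℂ (WithLp 2 (H × H)) := Γ.comap e.toLinearMap
  have hcl : IsClosed (Γ' : Set (WithLp 2 (H × H))) :=
    hΓ.preimage (WithLp.prod_continuous_ofLp 2 H H)
  have : CompleteSpace Γ' := hcl.completeSpace_coe
  obtain ⟨y, hy, z, hz, hyz⟩ := Γ'.exists_add_mem_mem_orthogonal (WithLp.toLp 2 (a, b))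
  refine ⟨(y.fst, y.snd), hy, (z.snd, -z.fst), ?_, ?_, ?_⟩
  · rw [mem_adjoint]
    intro p hp
    have := (Submodule.mem_orthogonal _ _).1 hz (WithLp.toLp 2 p) hp
    rw [WithLp.prod_inner_apply] at this
    rw [inner_neg_right]
    exact eq_neg_of_add_eq_zero_right this
  · have := congrArg WithLp.fst hyz
    simpa using this
  · have := congrArg WithLp.snd hyz
    simpa using this

/-- Decompose `x = p + J q` with `p ∈ Γ` and `q ∈ Γ.adjoint`. Then `J q = x - p` lies in the double
adjoint, and pairing it with `q` gives `‖q.1‖² + ‖q.2‖² = 0`. -/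
theorem adjoint_adjoint_of_isClosed {Γ : Submodule ℂ (H × H)} (hΓ : IsClosed (Γ : Set (H × H))) :
    Γ.adjoint.adjoint = Γ := by
  refine le_antisymm (fun x hx => ?_) (le_adjoint_adjoint Γ)
  obtain ⟨p, hp, q, hq, h1, h2⟩ := exists_graph_decomposition hΓ x.1 x.2
  have hxp : x - p ∈ Γ.adjoint.adjoint := sub_mem hx (le_adjoint_adjoint Γ hp)
  have h := mem_adjoint.1 hxp q hq
  have e1 : (x - p).1 = -q.2 := by rw [Prod.fst_sub, h1]; abel
  have e2 : (x - p).2 = q.1 := by rw [Prod.snd_sub, h2]; abel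
  rw [e1, e2, inner_neg_right] at h
  have h' : (‖q.1‖ ^ 2 + ‖q.2‖ ^ 2 : ℂ) = 0 := by
    have i1 := inner_self_eq_norm_sq_to_K (𝕜 := ℂ) q.1
    have i2 := inner_self_eq_norm_sq_to_K (𝕜 := ℂ) q.2
    simp only [Complex.coe_algebraMap] at i1 i2
    linear_combination -h - i1 - i2
  have h'' : ‖q.1‖ ^ 2 + ‖q.2‖ ^ 2 = 0 := by exact_mod_cast h'
  have z1 : q.1 = 0 := by
    rw [← norm_eq_zero]; nlinarith [sq_nonneg ‖q.1‖, sq_nonneg ‖q.2‖]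
  have z2 : q.2 = 0 := by
    rw [← norm_eq_zero]; nlinarith [sq_nonneg ‖q.1‖, sq_nonneg ‖q.2‖]
  have : x = p := Prod.ext (by rw [h1, z2, sub_zero]) (by rw [h2, z1, add_zero])
  exact this ▸ hp

-- Density of the domain comes for free: if `y` is orthogonal to the domain, then `(0, y)` lies in
-- the adjoint of the graph, hence in the graph, and so `y = 0`.
open LinearPMap in
theorem isSelfAdjoint_iff_graph {T : H →ₗ.[ℂ] H} :
    IsSelfAdjoint T ↔ T.graph.adjoint = T.graph := by
  constructor
  · intro h
    rw [← adjoint_graph_eq_graph_adjoint h.dense_domain, isSelfAdjoint_def.1 h]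
  · intro h
    have hd : Dense (T.domain : Set H) := by
      rw [Submodule.dense_iff_topologicalClosure_eq_top,
        Submodule.topologicalClosure_eq_top_iff, Submodule.eq_bot_iff]
      intro y hy
      have hy' : ((0 : H), y) ∈ T.graph := by
        rw [← h, mem_adjoint]
        intro p hp
        obtain ⟨x, hx1, hx2⟩ := (mem_graph_iff T).1 hp
        rw [inner_zero_right, ← hx1]
        exact ((Submodule.mem_orthogonal _ _).1 hy _ x.2).symm
      exact T.graph_fst_eq_zero_snd hy' rfl
    rw [isSelfAdjoint_def]
    apply eq_of_eq_graph
    rw [adjoint_graph_eq_graph_adjoint hd, h]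

open LinearPMap in
theorem isEssentiallySelfAdjoint_iff_graph {T : H →ₗ.[ℂ] H} (hd : Dense (T.domain : Set H))
    (hs : T.graph ≤ T.graph.adjoint) :
    IsEssentiallySelfAdjoint T ↔ T.graph.adjoint = T.graph.topologicalClosure := by
  have hle : T ≤ T† := by
    apply le_of_le_graph
    rwa [adjoint_graph_eq_graph_adjoint hd]
  have hc : T.IsClosable := (adjoint_isClosed hd).isClosable.leIsClosable hle
  rw [IsEssentiallySelfAdjoint, isSelfAdjoint_iff_graph, ← hc.graph_closure_eq_closure_graph,
    adjoint_topologicalClosure]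

end Graphs

/-! ### Measurable fields of closed relations and their direct integrals -/

section DirectIntegral

open Filter Topology ENNReal

/-- By monotone convergence the sum of the `f n` is finite almost everywhere. With approximations of
geometric rate this gives pointwise convergence without passing to a subsequence. -/
theorem ae_tendsto_zero_of_tsum_lintegral {α : Type*} [MeasurableSpace α] {μ : Measure α}
    {f : ℕ → α → ℝ≥0∞} (hf : ∀ n, AEMeasurable (f n) μ) (h : ∑' n, ∫⁻ a, f n a ∂μ ≠ ⊤) :
    ∀ᵐ a ∂μ, Tendsto (fun n => f n a) atTop (𝓝 0) := by
  rw [← lintegral_tsum hf] at h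
  filter_upwards [ae_lt_top' (AEMeasurable.tsum hf) h] with a ha
  exact ENNReal.tendsto_atTop_zero_of_tsum_ne_top ha.ne

theorem lintegral_enorm_sq {α : Type*} [MeasurableSpace α] {μ : Measure α} (f : Lp ℂ 2 μ) :
    ∫⁻ a, ‖f a‖ₑ ^ 2 ∂μ = ‖f‖ₑ ^ 2 := by
  have := eLpNorm_nnreal_pow_eq_lintegral (f := (f : α → ℂ)) (μ := μ) (p := 2) two_ne_zero
  simp only [NNReal.coe_ofNat, ENNReal.rpow_ofNat, ENNReal.coe_ofNat] at this
  rw [Lp.enorm_def, this]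

theorem memLp_two_of_lintegral {α : Type*} [MeasurableSpace α] {μ : Measure α} {f : α → ℂ}
    (hf : AEStronglyMeasurable f μ) (h : ∫⁻ a, ‖f a‖ₑ ^ 2 ∂μ ≠ ⊤) : MemLp f 2 μ := by
  refine ⟨hf, ?_⟩
  have := eLpNorm_nnreal_pow_eq_lintegral (f := f) (μ := μ) (p := 2) two_ne_zero
  simp only [NNReal.coe_ofNat, ENNReal.rpow_ofNat, ENNReal.coe_ofNat] at this
  rw [← this] at h
  by_contra hc
  rw [not_lt, top_le_iff] at hc
  simp [hc] at h

theorem enorm_sq_le_of_norm_le {E : Type*} [SeminormedAddCommGroup E] {a : E} {j : ℕ}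
    (h : ‖a‖ ≤ (2⁻¹ : ℝ) ^ j) : ‖a‖ₑ ^ 2 ≤ (2⁻¹ : ℝ≥0∞) ^ j := by
  have h2 : ‖a‖ₑ ≤ (2⁻¹ : ℝ≥0∞) ^ j := by
    rw [← ofReal_norm]
    refine (ENNReal.ofReal_le_ofReal h).trans_eq ?_
    rw [ENNReal.ofReal_pow (by positivity), ENNReal.ofReal_inv_of_pos two_pos]
    simp
  have h3 : ‖a‖ₑ ≤ 1 := h2.trans (pow_le_one₀ (by simp) (by simp))
  rw [pow_two]
  exact (mul_le_mul' h2 h3).trans_eq (mul_one _)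

theorem tsum_geometric_inv_two_lt_top : ∑' j : ℕ, (2⁻¹ : ℝ≥0∞) ^ j < ⊤ := by
  rw [ENNReal.tsum_geometric]
  simp

theorem tendsto_norm_zero_of_enorm_sq {E : Type*} [SeminormedAddCommGroup E] {f : ℕ → E}
    (h : Tendsto (fun j => ‖f j‖ₑ ^ 2) atTop (𝓝 0)) : Tendsto (fun j => ‖f j‖) atTop (𝓝 0) := by
  have h1 := (ENNReal.tendsto_toReal ENNReal.zero_ne_top).comp h
  have h2 := (Real.continuous_sqrt.tendsto _).comp h1
  simp only [ENNReal.toReal_zero, Real.sqrt_zero] at h2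
  refine h2.congr fun j => ?_
  simp [toReal_enorm]

variable {X : Type*} [MeasureSpace X] {ν : Measure ℝ}

/-- A section is only a family of classes, so a jointly measurable representative has to be built.
The first member of a dense sequence within `2⁻ʲ` of `s x` is jointly measurable in `(x, y)`, as
only countably many functions occur; the geometric rate gives convergence at almost every `y`, for
every `x`. -/
theorem exists_measurable_uncurry [SFinite ν] {s : X → Lp ℂ 2 ν} (hs : StronglyMeasurable s) :
    ∃ S : X × ℝ → ℂ, StronglyMeasurable S ∧ ∀ x, (fun y => S (x, y)) =ᵐ[ν] s x := by
  classical
  have : Fact ((2 : ℝ≥0∞) ≠ ⊤) := ⟨ENNReal.ofNat_ne_top⟩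
  have : SecondCountableTopology (Lp ℂ 2 ν) := Lp.SecondCountableTopology
  let e := denseSeq (Lp ℂ 2 ν)
  have hex (j : ℕ) (x : X) : ∃ n, dist (s x) (e n) < (2⁻¹ : ℝ) ^ j := by
    obtain ⟨_, hb, ⟨n, rfl⟩⟩ := Metric.dense_iff.1 (denseRange_denseSeq (Lp ℂ 2 ν)) (s x)
      ((2⁻¹ : ℝ) ^ j) (by positivity)
    exact ⟨n, by rw [dist_comm]; exact hb⟩
  let N (j : ℕ) (x : X) : ℕ := Nat.find (hex j x)
  have hN (j : ℕ) : Measurable (N j) := by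
    refine measurable_find _ fun k => ?_
    exact (hs.dist stronglyMeasurable_const).measurable measurableSet_Iio
  let S (j : ℕ) (p : X × ℝ) : ℂ := e (N j p.1) p.2
  have hS (j : ℕ) : StronglyMeasurable (S j) := by
    have h1 : Measurable fun q : ℕ × ℝ => (e q.1 : ℝ → ℂ) q.2 :=
      measurable_from_prod_countable_right fun n => (Lp.stronglyMeasurable (e n)).measurable
    have h2 : Measurable fun p : X × ℝ => (N j p.1, p.2) :=
      ((hN j).comp measurable_fst).prodMk measurable_snd
    exact (h1.comp h2).stronglyMeasurable
  refine ⟨fun p => limUnder atTop fun j => S j p, StronglyMeasurable.limUnder hS, fun x => ?_⟩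
  have key : ∀ᵐ y ∂ν, Tendsto (fun j => ‖(e (N j x) - s x : Lp ℂ 2 ν) y‖ₑ ^ 2) atTop (𝓝 0) := by
    refine ae_tendsto_zero_of_tsum_lintegral (fun j => ?_) ?_
    · exact (Lp.stronglyMeasurable _).aestronglyMeasurable.enorm.pow_const 2
    · simp_rw [lintegral_enorm_sq]
      refine ((ENNReal.tsum_le_tsum fun j => enorm_sq_le_of_norm_le ?_).trans_lt
        tsum_geometric_inv_two_lt_top).ne
      rw [← dist_eq_norm, dist_comm]
      exact (Nat.find_spec (hex j x)).le
  have hsub : ∀ᵐ y ∂ν, ∀ j, (e (N j x) - s x : Lp ℂ 2 ν) y = e (N j x) y - s x y :=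
    ae_all_iff.2 fun j => Lp.coeFn_sub _ _
  filter_upwards [key, hsub] with y hy hy'
  refine Tendsto.limUnder_eq ?_
  simp_rw [hy'] at hy
  exact tendsto_iff_norm_sub_tendsto_zero.2 (tendsto_norm_zero_of_enorm_sq hy)

theorem IsFibre.unique {F : Lp ℂ 2 ((volume : Measure X).prod ν)} {x : X} {f g : Lp ℂ 2 ν}
    (hf : IsFibre F x f) (hg : IsFibre F x g) : f = g :=
  Lp.ext (hf.symm.trans hg)

theorem IsFibre.inner_eq {F G : Lp ℂ 2 ((volume : Measure X).prod ν)} {x : X} {f g : Lp ℂ 2 ν}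
    (hf : IsFibre F x f) (hg : IsFibre G x g) :
    ∫ y, inner ℂ (F (x, y)) (G (x, y)) ∂ν = inner ℂ f g := by
  rw [L2.inner_def]
  refine integral_congr_ae ?_
  filter_upwards [hf, hg] with y h1 h2
  rw [h1, h2]

variable [SFinite ν]

theorem ae_isFibre_add (F G : Lp ℂ 2 ((volume : Measure X).prod ν)) :
    ∀ᵐ x, ∀ f g : Lp ℂ 2 ν, IsFibre F x f → IsFibre G x g → IsFibre (F + G) x (f + g) := by
  filter_upwards [Measure.ae_ae_of_ae_prod (Lp.coeFn_add F G)] with x hx f g hf hg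
  filter_upwards [hx, hf, hg, Lp.coeFn_add f g] with y h1 h2 h3 h4
  simp only [Pi.add_apply] at h1 h4
  rw [h1, h2, h3, h4]

theorem ae_isFibre_sub (F G : Lp ℂ 2 ((volume : Measure X).prod ν)) :
    ∀ᵐ x, ∀ f g : Lp ℂ 2 ν, IsFibre F x f → IsFibre G x g → IsFibre (F - G) x (f - g) := by
  filter_upwards [Measure.ae_ae_of_ae_prod (Lp.coeFn_sub F G)] with x hx f g hf hg
  filter_upwards [hx, hf, hg, Lp.coeFn_sub f g] with y h1 h2 h3 h4
  simp only [Pi.sub_apply] at h1 h4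
  rw [h1, h2, h3, h4]

theorem ae_isFibre_smul (c : ℂ) (F : Lp ℂ 2 ((volume : Measure X).prod ν)) :
    ∀ᵐ x, ∀ f : Lp ℂ 2 ν, IsFibre F x f → IsFibre (c • F) x (c • f) := by
  filter_upwards [Measure.ae_ae_of_ae_prod (Lp.coeFn_smul c F)] with x hx f hf
  filter_upwards [hx, hf, Lp.coeFn_smul c f] with y h1 h2 h3
  simp only [Pi.smul_apply] at h1 h3
  rw [h1, h2, h3]

theorem ae_isFibre_zero :
    ∀ᵐ x : X, IsFibre (0 : Lp ℂ 2 ((volume : Measure X).prod ν)) x 0 := by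
  filter_upwards [Measure.ae_ae_of_ae_prod (Lp.coeFn_zero ℂ 2 ((volume : Measure X).prod ν))]
    with x hx
  filter_upwards [hx, Lp.coeFn_zero ℂ 2 ν] with y h1 h2
  simp only [Pi.zero_apply] at h1 h2
  rw [h1, h2]

theorem eq_of_ae_isFibre {F G : Lp ℂ 2 ((volume : Measure X).prod ν)}
    (h : ∀ᵐ x, ∃ f : Lp ℂ 2 ν, IsFibre F x f ∧ IsFibre G x f) : F = G := by
  refine Lp.ext ((Measure.ae_prod_iff_ae_ae ?_).2 ?_)
  · exact measurableSet_eq_fun (Lp.stronglyMeasurable F).measurable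
      (Lp.stronglyMeasurable G).measurable
  · filter_upwards [h] with x hx
    obtain ⟨f, hF, hG⟩ := hx
    exact hF.trans hG.symm

theorem lintegral_lintegral_enorm_sq (F : Lp ℂ 2 ((volume : Measure X).prod ν)) :
    ∫⁻ x, ∫⁻ y, ‖F (x, y)‖ₑ ^ 2 ∂ν = ‖F‖ₑ ^ 2 := by
  rw [← lintegral_enorm_sq, lintegral_prod]
  exact (Lp.stronglyMeasurable _).aestronglyMeasurable.enorm.pow_const 2

theorem ae_exists_isFibre (F : Lp ℂ 2 ((volume : Measure X).prod ν)) :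
    ∀ᵐ x, ∃ f : Lp ℂ 2 ν, IsFibre F x f := by
  have h : ∫⁻ x, ∫⁻ y, ‖F (x, y)‖ₑ ^ 2 ∂ν ≠ ⊤ := by
    rw [lintegral_lintegral_enorm_sq]
    simp
  have hm : Measurable fun x => ∫⁻ y, ‖F (x, y)‖ₑ ^ 2 ∂ν :=
    ((Lp.stronglyMeasurable F).measurable.enorm.pow_const 2).lintegral_prod_right'
  filter_upwards [ae_lt_top hm h] with x hx
  have hL : MemLp (fun y => F (x, y)) 2 ν :=
    memLp_two_of_lintegral ((Lp.stronglyMeasurable F).measurable.comp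
      measurable_prodMk_left).aestronglyMeasurable hx.ne
  exact ⟨hL.toLp _, hL.coeFn_toLp.symm⟩

/-- The elements of `L²(X × ℝ) × L²(X × ℝ)` whose fibres lie in `K x` for almost every `x`. -/
def directIntegral (K : X → Submodule ℂ (Lp ℂ 2 ν × Lp ℂ 2 ν)) :
    Submodule ℂ (Lp ℂ 2 ((volume : Measure X).prod ν) × Lp ℂ 2 ((volume : Measure X).prod ν)) where
  carrier := {P | ∀ᵐ x, ∃ p ∈ K x, IsFibre P.1 x p.1 ∧ IsFibre P.2 x p.2}
  zero_mem' := by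
    filter_upwards [ae_isFibre_zero (X := X) (ν := ν)] with x hx
    exact ⟨0, (K x).zero_mem, hx, hx⟩
  add_mem' := by
    intro P Q hP hQ
    filter_upwards [hP, hQ, ae_isFibre_add P.1 Q.1, ae_isFibre_add P.2 Q.2]
      with x ⟨p, hp, p1, p2⟩ ⟨q, hq, q1, q2⟩ h1 h2
    exact ⟨p + q, (K x).add_mem hp hq, h1 _ _ p1 q1, h2 _ _ p2 q2⟩
  smul_mem' := by
    intro c P hP
    filter_upwards [hP, ae_isFibre_smul c P.1, ae_isFibre_smul c P.2] with x ⟨p, hp, p1, p2⟩ h1 h2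
    exact ⟨c • p, (K x).smul_mem c hp, h1 _ p1, h2 _ p2⟩

theorem mem_directIntegral {K : X → Submodule ℂ (Lp ℂ 2 ν × Lp ℂ 2 ν)}
    {P : Lp ℂ 2 ((volume : Measure X).prod ν) × Lp ℂ 2 ((volume : Measure X).prod ν)} :
    P ∈ directIntegral K ↔ ∀ᵐ x, ∃ p ∈ K x, IsFibre P.1 x p.1 ∧ IsFibre P.2 x p.2 :=
  Iff.rfl

theorem inner_eq_integral_fibre [SFinite (volume : Measure X)]
    (F G : Lp ℂ 2 ((volume : Measure X).prod ν)) :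
    inner ℂ F G = ∫ x, ∫ y, inner ℂ (F (x, y)) (G (x, y)) ∂ν := by
  rw [L2.inner_def, integral_prod]
  exact L2.integrable_inner F G

theorem integrable_fibre_inner (F G : Lp ℂ 2 ((volume : Measure X).prod ν)) :
    Integrable fun x => ∫ y, inner ℂ (F (x, y)) (G (x, y)) ∂ν := by
  have h := L2.integrable_inner (𝕜 := ℂ) F G
  exact h.integral_prod_left

theorem exists_of_section {s : X → Lp ℂ 2 ν} (hs : StronglyMeasurable s)
    (h : ∫⁻ x, ‖s x‖ₑ ^ 2 ≠ ⊤) :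
    ∃ F : Lp ℂ 2 ((volume : Measure X).prod ν), ∀ᵐ x, IsFibre F x (s x) := by
  obtain ⟨S, hS, hS'⟩ := exists_measurable_uncurry hs
  have hL : MemLp S 2 ((volume : Measure X).prod ν) := by
    refine memLp_two_of_lintegral hS.aestronglyMeasurable ?_
    rw [lintegral_prod _ (hS.aestronglyMeasurable.enorm.pow_const 2)]
    convert h using 3 with x
    rw [← lintegral_enorm_sq]
    exact lintegral_congr_ae ((hS' x).mono fun y hy => congrArg (‖·‖ₑ ^ 2) hy)
  refine ⟨hL.toLp S, ?_⟩
  filter_upwards [Measure.ae_ae_of_ae_prod hL.coeFn_toLp] with x hx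
  exact EventuallyEq.trans hx (hS' x)

/-- A measurable field of closed relations. -/
def IsMeasurableClosedRelationField (K : X → Submodule ℂ (Lp ℂ 2 ν × Lp ℂ 2 ν)) : Prop :=
  ∃ s : ℕ → X → Lp ℂ 2 ν × Lp ℂ 2 ν, (∀ n, StronglyMeasurable (s n)) ∧
    ∀ᵐ x, (K x : Set (Lp ℂ 2 ν × Lp ℂ 2 ν)) = closure (range fun n => s n x)

/-- Generating sections need not be square integrable. Their restrictions to sets of finite measure
on which they are bounded are, and these are the test elements used below. -/
theorem exists_truncated_section {s : X → Lp ℂ 2 ν × Lp ℂ 2 ν} (hs : StronglyMeasurable s)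
    {A : Set X} (hA : MeasurableSet A) (hAf : volume A ≠ ⊤) {M : ℝ}
    (hM : ∀ x ∈ A, ‖s x‖ ≤ M) :
    ∃ P : Lp ℂ 2 ((volume : Measure X).prod ν) × Lp ℂ 2 ((volume : Measure X).prod ν),
      ∀ᵐ x, IsFibre P.1 x (A.indicator s x).1 ∧ IsFibre P.2 x (A.indicator s x).2 := by
  have hs' : StronglyMeasurable (A.indicator s) := hs.indicator hA
  have hb : ∫⁻ x, ‖A.indicator s x‖ₑ ^ 2 ≠ ⊤ := by
    have hle : ∀ x, ‖A.indicator s x‖ₑ ^ 2 ≤ A.indicator (fun _ => ENNReal.ofReal M ^ 2) x := by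
      intro x
      by_cases hx : x ∈ A
      · rw [indicator_of_mem hx, indicator_of_mem hx, ← ofReal_norm]
        gcongr
        exact hM x hx
      · simp [hx]
    refine ((lintegral_mono hle).trans_lt ?_).ne
    rw [lintegral_indicator hA, lintegral_const, Measure.restrict_apply_univ]
    exact ENNReal.mul_lt_top (by simp) hAf.lt_top
  have h1 : ∫⁻ x, ‖(A.indicator s x).1‖ₑ ^ 2 ≠ ⊤ :=
    ne_top_of_le_ne_top hb <| lintegral_mono fun x => by
      simp only [← ofReal_norm]
      gcongr
      exact norm_fst_le _
  have h2 : ∫⁻ x, ‖(A.indicator s x).2‖ₑ ^ 2 ≠ ⊤ :=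
    ne_top_of_le_ne_top hb <| lintegral_mono fun x => by
      simp only [← ofReal_norm]
      gcongr
      exact norm_snd_le _
  obtain ⟨F, hF⟩ := exists_of_section hs'.fst h1
  obtain ⟨G, hG⟩ := exists_of_section hs'.snd h2
  exact ⟨(F, G), hF.and hG⟩

theorem truncated_section_mem {K : X → Submodule ℂ (Lp ℂ 2 ν × Lp ℂ 2 ν)}
    {s : X → Lp ℂ 2 ν × Lp ℂ 2 ν} (hsK : ∀ᵐ x, s x ∈ K x) {A : Set X}
    {P : Lp ℂ 2 ((volume : Measure X).prod ν) × Lp ℂ 2 ((volume : Measure X).prod ν)}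
    (hP : ∀ᵐ x, IsFibre P.1 x (A.indicator s x).1 ∧ IsFibre P.2 x (A.indicator s x).2) :
    P ∈ directIntegral K := by
  filter_upwards [hP, hsK] with x hx hK
  refine ⟨_, ?_, hx⟩
  by_cases hxA : x ∈ A
  · rwa [indicator_of_mem hxA]
  · rw [indicator_of_notMem hxA]
    exact (K x).zero_mem

/-- The sets of an exhaustion of `X` by sets of finite measure, on which a section is bounded. -/
theorem exists_exhaustion [SigmaFinite (volume : Measure X)] {E : Type*} [NormedAddCommGroup E]
    {s : X → E} (hs : StronglyMeasurable s) :
    ∃ B : ℕ → Set X, (∀ m, MeasurableSet (B m)) ∧ (∀ m, volume (B m) ≠ ⊤) ∧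
      (∀ m, ∀ x ∈ B m, ‖s x‖ ≤ m) ∧ ∀ x, ∃ m, x ∈ B m := by
  refine ⟨fun m => spanningSets volume m ∩ {x | ‖s x‖ ≤ m}, fun m => ?_, fun m => ?_,
    fun m x hx => hx.2, fun x => ?_⟩
  · exact (measurableSet_spanningSets _ _).inter (hs.norm.measurable measurableSet_Iic)
  · exact (measure_inter_lt_top_of_left_ne_top (measure_spanningSets_lt_top _ m).ne).ne
  · obtain ⟨m, hm⟩ := exists_nat_ge ‖s x‖
    refine ⟨max m (spanningSetsIndex volume x), ?_, ?_⟩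
    · exact monotone_spanningSets _ (le_max_right _ _) (mem_spanningSetsIndex _ _)
    · exact hm.trans (by exact_mod_cast le_max_left _ _)

/-- An element of the adjoint is paired with the generating sections cut down to `A ∩ B m`. Since
`A` is arbitrary, the fibrewise identity holds almost everywhere on `B m`; countably many `n` and
`m` cover everything, and closedness of the condition extends it from the sections to `K x`. The
other inclusion integrates the fibrewise identity. -/
theorem adjoint_directIntegral [SigmaFinite (volume : Measure X)]
    {K : X → Submodule ℂ (Lp ℂ 2 ν × Lp ℂ 2 ν)}
    (hK : IsMeasurableClosedRelationField K) :
    (directIntegral K).adjoint = directIntegral fun x => (K x).adjoint := by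
  obtain ⟨s, hs, hsK⟩ := hK
  have hmem (n : ℕ) : ∀ᵐ x, s n x ∈ K x := hsK.mono fun x hx => by
    rw [← SetLike.mem_coe, hx]
    exact subset_closure ⟨n, rfl⟩
  ext P
  constructor
  · intro hP
    have key : ∀ n m, ∀ (B : ℕ → Set X), (∀ m, MeasurableSet (B m)) → (∀ m, volume (B m) ≠ ⊤) →
        (∀ m, ∀ x ∈ B m, ‖s n x‖ ≤ m) →
        ∀ᵐ x, x ∈ B m → ∀ p : Lp ℂ 2 ν × Lp ℂ 2 ν, IsFibre P.1 x p.1 → IsFibre P.2 x p.2 →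
          inner ℂ (s n x).2 p.1 = inner ℂ (s n x).1 p.2 := by
      intro n m B hBm hBf hBn
      obtain ⟨Q, hQ⟩ := exists_truncated_section (hs n) (hBm m) (hBf m) (hBn m)
      let h : X → ℂ := fun x => (∫ y, inner ℂ (Q.2 (x, y)) (P.1 (x, y)) ∂ν) -
        ∫ y, inner ℂ (Q.1 (x, y)) (P.2 (x, y)) ∂ν
      have hint : Integrable h :=
        (integrable_fibre_inner Q.2 P.1).sub (integrable_fibre_inner Q.1 P.2)
      have hfib : ∀ᵐ x, ∀ p : Lp ℂ 2 ν × Lp ℂ 2 ν, IsFibre P.1 x p.1 → IsFibre P.2 x p.2 →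
          h x = inner ℂ ((B m).indicator (s n) x).2 p.1
            - inner ℂ ((B m).indicator (s n) x).1 p.2 := by
        filter_upwards [hQ] with x hx p h1 h2
        simp only [h]
        rw [hx.2.inner_eq h1, hx.1.inner_eq h2]
      -- The integral of `h` over `A` is the adjoint identity tested on the section truncated to `A
      -- ∩ B m`.
      have h0 : h =ᵐ[volume] 0 := by
        refine Integrable.ae_eq_zero_of_forall_setIntegral_eq_zero hint fun A hA _ => ?_
        have hAB : MeasurableSet (A ∩ B m) := hA.inter (hBm m)
        obtain ⟨R, hR⟩ := exists_truncated_section (hs n) hAB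
          (measure_inter_lt_top_of_right_ne_top (hBf m)).ne fun x hx => hBn m x hx.2
        have hRK : R ∈ directIntegral K := truncated_section_mem (hmem n) hR
        have hz := mem_adjoint.1 hP R hRK
        rw [inner_eq_integral_fibre, inner_eq_integral_fibre, ← sub_eq_zero,
          ← integral_sub (integrable_fibre_inner _ _) (integrable_fibre_inner _ _)] at hz
        rw [← integral_indicator hA, ← hz]
        refine integral_congr_ae ?_
        filter_upwards [hR, hfib, ae_exists_isFibre P.1, ae_exists_isFibre P.2]
          with x hx hf ⟨p, hp⟩ ⟨q, hq⟩
        rw [hx.2.inner_eq hp, hx.1.inner_eq hq]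
        by_cases hxA : x ∈ A
        · rw [indicator_of_mem hxA, hf (p, q) hp hq]
          by_cases hxB : x ∈ B m
          · rw [indicator_of_mem hxB, indicator_of_mem (mem_inter hxA hxB)]
          · rw [indicator_of_notMem hxB, indicator_of_notMem fun h => hxB h.2]
        · rw [indicator_of_notMem hxA, indicator_of_notMem fun h => hxA h.1]
          simp
      filter_upwards [h0, hfib] with x hx hf hxB p hp hq
      have := hf p hp hq
      rw [hx, indicator_of_mem hxB] at this
      exact (sub_eq_zero.1 this.symm)
    have key' : ∀ n, ∀ᵐ x, ∀ p : Lp ℂ 2 ν × Lp ℂ 2 ν, IsFibre P.1 x p.1 → IsFibre P.2 x p.2 →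
          inner ℂ (s n x).2 p.1 = inner ℂ (s n x).1 p.2 := by
      intro n
      obtain ⟨B, h1, h2, h3, h4⟩ := exists_exhaustion (hs n)
      filter_upwards [ae_all_iff.2 fun m => key n m B h1 h2 h3] with x hx
      obtain ⟨m, hm⟩ := h4 x
      exact hx m hm
    filter_upwards [ae_all_iff.2 key', hsK, ae_exists_isFibre P.1, ae_exists_isFibre P.2]
      with x hx hxK ⟨p, hp⟩ ⟨q, hq⟩
    refine ⟨(p, q), mem_adjoint_of_closure hxK.le ?_, hp, hq⟩
    rintro _ ⟨n, rfl⟩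
    exact hx n (p, q) hp hq
  · intro hP
    rw [mem_adjoint]
    intro Q hQ
    rw [inner_eq_integral_fibre, inner_eq_integral_fibre]
    refine integral_congr_ae ?_
    filter_upwards [hP, hQ] with x ⟨p, hp, p1, p2⟩ ⟨q, hq, q1, q2⟩
    rw [q2.inner_eq p1, q1.inner_eq p2]
    exact mem_adjoint.1 hp q hq

/-- No measurability of `L` is required: each truncated section of `K` has fibres in `L x`, and
fibres are unique. This permits taking the adjoint field for `L`. -/
theorem ae_le_of_directIntegral_le [SigmaFinite (volume : Measure X)]
    {K L : X → Submodule ℂ (Lp ℂ 2 ν × Lp ℂ 2 ν)}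
    (hK : IsMeasurableClosedRelationField K) (hL : ∀ x, IsClosed (L x : Set (Lp ℂ 2 ν × Lp ℂ 2 ν)))
    (h : directIntegral K ≤ directIntegral L) : ∀ᵐ x, K x ≤ L x := by
  obtain ⟨s, hs, hsK⟩ := hK
  have hmem (n : ℕ) : ∀ᵐ x, s n x ∈ K x := hsK.mono fun x hx => by
    rw [← SetLike.mem_coe, hx]
    exact subset_closure ⟨n, rfl⟩
  have key : ∀ n, ∀ᵐ x, s n x ∈ L x := by
    intro n
    obtain ⟨B, h1, h2, h3, h4⟩ := exists_exhaustion (hs n)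
    have : ∀ m, ∀ᵐ x, x ∈ B m → s n x ∈ L x := by
      intro m
      obtain ⟨Q, hQ⟩ := exists_truncated_section (hs n) (h1 m) (h2 m) (h3 m)
      filter_upwards [h (truncated_section_mem (hmem n) hQ), hQ] with x ⟨p, hp, p1, p2⟩ hx hxB
      rw [indicator_of_mem hxB] at hx
      have : s n x = p := Prod.ext (hx.1.unique p1) (hx.2.unique p2)
      exact this ▸ hp
    filter_upwards [ae_all_iff.2 this] with x hx
    obtain ⟨m, hm⟩ := h4 x
    exact hx m hm
  filter_upwards [ae_all_iff.2 key, hsK] with x hx hxK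
  rw [← SetLike.coe_subset_coe, hxK]
  refine closure_minimal ?_ (hL x)
  rintro _ ⟨n, rfl⟩
  exact hx n

/-- That self-adjointness descends to the fibres is shown without measurability of the adjoint
field. Symmetry of the fibres comes from `ae_le_of_directIntegral_le`. For the reverse inclusion,
truncated constant sections are decomposed as `p + J q` in the large space; self-adjointness puts
both `p` and `q` in the direct integral, and reading this off on the fibres feeds
`adjoint_le_of_dense_decomposition`. -/
theorem directIntegral_selfAdjoint_iff [SigmaFinite (volume : Measure X)]
    {K : X → Submodule ℂ (Lp ℂ 2 ν × Lp ℂ 2 ν)}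
    (hK : IsMeasurableClosedRelationField K) :
    (directIntegral K).adjoint = directIntegral K ↔ ∀ᵐ x, (K x).adjoint = K x := by
  constructor
  · intro h
    have hcl := isClosed_adjoint (directIntegral K)
    rw [h] at hcl
    have hle : ∀ᵐ x, K x ≤ (K x).adjoint :=
      ae_le_of_directIntegral_le hK (fun x => isClosed_adjoint _)
        ((adjoint_directIntegral hK).symm.trans h).ge
    have : SecondCountableTopology (Lp ℂ 2 ν) :=
      have : Fact ((2 : ENNReal) ≠ ⊤) := ⟨ENNReal.ofNat_ne_top⟩
      Lp.SecondCountableTopology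
    let e := denseSeq (Lp ℂ 2 ν × Lp ℂ 2 ν)
    have key : ∀ n, ∀ᵐ x, ∃ p ∈ K x, ∃ q ∈ K x, (e n).1 = p.1 - q.2 ∧ (e n).2 = p.2 + q.1 := by
      intro n
      -- Even constant sections are truncated, because the base may have infinite measure.
      obtain ⟨B, h1, h2, h3, h4⟩ :=
        exists_exhaustion (stronglyMeasurable_const (α := X) (b := e n))
      have : ∀ m, ∀ᵐ x, x ∈ B m →
          ∃ p ∈ K x, ∃ q ∈ K x, (e n).1 = p.1 - q.2 ∧ (e n).2 = p.2 + q.1 := by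
        intro m
        obtain ⟨Q, hQ⟩ := exists_truncated_section stronglyMeasurable_const (h1 m) (h2 m) (h3 m)
        obtain ⟨P, hP, R, hR, e1, e2⟩ := exists_graph_decomposition hcl Q.1 Q.2
        rw [h] at hR
        filter_upwards [hQ, hP, hR, ae_isFibre_sub P.1 R.2, ae_isFibre_add P.2 R.1]
          with x hx ⟨p, hp, p1, p2⟩ ⟨q, hq, q1, q2⟩ f1 f2 hxB
        rw [indicator_of_mem hxB] at hx
        rw [e1, e2] at hx
        exact ⟨p, hp, q, hq, hx.1.unique (f1 _ _ p1 q2), hx.2.unique (f2 _ _ p2 q1)⟩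
      filter_upwards [ae_all_iff.2 this] with x hx
      obtain ⟨m, hm⟩ := h4 x
      exact hx m hm
    obtain ⟨s, hs, hsK⟩ := hK
    filter_upwards [ae_all_iff.2 key, hsK, hle] with x hx hxK hxle
    refine le_antisymm ?_ hxle
    refine adjoint_le_of_dense_decomposition (hxK ▸ isClosed_closure) hxle
      (denseRange_denseSeq (Lp ℂ 2 ν × Lp ℂ 2 ν)) ?_
    rintro _ ⟨n, rfl⟩
    exact hx n
  · intro h
    rw [adjoint_directIntegral hK]
    ext P
    simp only [mem_directIntegral]
    refine eventually_congr (h.mono fun x hx => ?_)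
    rw [hx]

/-- Approximants within `2⁻ʲ` have fibres that converge at almost every `x`, because the squared
fibre distances have a finite sum of integrals. Closedness of `K x` then catches the limit. -/
theorem isClosed_directIntegral {K : X → Submodule ℂ (Lp ℂ 2 ν × Lp ℂ 2 ν)}
    (hK : ∀ᵐ x, IsClosed (K x : Set (Lp ℂ 2 ν × Lp ℂ 2 ν))) :
    IsClosed (directIntegral K : Set (Lp ℂ 2 ((volume : Measure X).prod ν) ×
      Lp ℂ 2 ((volume : Measure X).prod ν))) := by
  refine isClosed_of_closure_subset fun P hP => ?_
  have hex (j : ℕ) : ∃ Q ∈ directIntegral K, dist P Q < (2⁻¹ : ℝ) ^ j :=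
    Metric.mem_closure_iff.1 hP _ (by positivity)
  choose Q hQ hPQ using hex
  have main (π : Lp ℂ 2 ((volume : Measure X).prod ν) × Lp ℂ 2 ((volume : Measure X).prod ν) →
      Lp ℂ 2 ((volume : Measure X).prod ν)) (hπ : ∀ j, ‖π (Q j) - π P‖ ≤ ‖Q j - P‖) :
      ∀ᵐ x, ∀ p : Lp ℂ 2 ν, IsFibre (π P) x p → ∀ q : ℕ → Lp ℂ 2 ν,
        (∀ j, IsFibre (π (Q j)) x (q j)) → Tendsto q atTop (𝓝 p) := by
    have h0 : ∀ᵐ x, Tendsto (fun j => ∫⁻ y, ‖(π (Q j) - π P) (x, y)‖ₑ ^ 2 ∂ν) atTop (𝓝 0) := by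
      refine ae_tendsto_zero_of_tsum_lintegral (fun j => ?_) ?_
      · exact (((Lp.stronglyMeasurable _).measurable.enorm.pow_const
          2).lintegral_prod_right').aemeasurable
      · simp_rw [lintegral_lintegral_enorm_sq]
        refine ((ENNReal.tsum_le_tsum fun j => enorm_sq_le_of_norm_le ((hπ j).trans ?_)).trans_lt
          (tsum_geometric_inv_two_lt_top)).ne
        rw [← dist_eq_norm, dist_comm]
        exact (hPQ j).le
    filter_upwards [h0, ae_all_iff.2 fun j => ae_isFibre_sub (π (Q j)) (π P)]
      with x hx hsub p hp q hq
    rw [tendsto_iff_norm_sub_tendsto_zero]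
    have h1 (j : ℕ) : ∫⁻ y, ‖(π (Q j) - π P) (x, y)‖ₑ ^ 2 ∂ν = ‖q j - p‖ₑ ^ 2 := by
      rw [← lintegral_enorm_sq]
      exact lintegral_congr_ae ((hsub j _ _ (hq j) hp).mono fun y hy => congrArg (‖·‖ₑ ^ 2) hy)
    simp_rw [h1] at hx
    exact tendsto_norm_zero_of_enorm_sq hx
  have hall : ∀ᵐ x, ∀ j, ∃ p ∈ K x, IsFibre (Q j).1 x p.1 ∧ IsFibre (Q j).2 x p.2 :=
    ae_all_iff.2 hQ
  filter_upwards [hK, hall, main Prod.fst fun j => norm_fst_le (Q j - P),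
    main Prod.snd fun j => norm_snd_le (Q j - P), ae_exists_isFibre P.1, ae_exists_isFibre P.2]
    with x hKx hx m1 m2 ⟨p, hp⟩ ⟨q, hq⟩
  choose r hr hr1 hr2 using hx
  refine ⟨(p, q), ?_, hp, hq⟩
  exact hKx.mem_of_tendsto ((m1 p hp _ hr1).prodMk_nhds (m2 q hq _ hr2)) (.of_forall hr)

end DirectIntegral

/-! ### Test functions and realisations of symmetric differential expressions -/

section TestFunctions

open Filter Topology ComplexConjugate

variable {E : Type*} [NormedAddCommGroup E] [NormedSpace ℝ E] {Ω : Opens E}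

theorem pd_apply (w : E) (η : 𝓓(Ω, ℂ)) (x : E) : pd Ω w η x = fderiv ℝ η x w := by
  have : pd Ω w η x = lineDeriv ℝ η x w := TestFunction.lineDerivCLM_apply_of_le (by simp)
  rw [this, ((η.contDiff.differentiable (by simp)) x).lineDeriv_eq_fderiv]

theorem test_eq_zero {η : 𝓓(Ω, ℂ)} {x : E} (hx : x ∉ Ω) : η x = 0 :=
  image_eq_zero_of_notMem_tsupport fun h => hx (η.tsupport_subset h)

theorem continuous_mul_test {c : E → ℂ} (hc : ContinuousOn c Ω) (η : 𝓓(Ω, ℂ)) :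
    Continuous fun x => c x * η x := by
  rw [continuous_iff_continuousAt]
  intro x
  by_cases hx : x ∈ (Ω : Set E)
  · exact (hc.continuousAt (Ω.isOpen.mem_nhds hx)).mul η.continuous.continuousAt
  · have hx' : x ∉ tsupport η := fun h => hx (η.tsupport_subset h)
    have h0 : (fun y => c y * η y) =ᶠ[𝓝 x] fun _ => (0 : ℂ) := by
      filter_upwards [notMem_tsupport_iff_eventuallyEq.mp hx'] with y hy
      simp [hy]
    exact continuousAt_const.congr h0.symm

/-- A smooth function with compact support in `Ω`, as a test function. -/
def mkTest (g : E → ℂ) (h1 : ContDiff ℝ ∞ g) (h2 : HasCompactSupport g) (h3 : tsupport g ⊆ Ω) :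
    𝓓(Ω, ℂ) :=
  ⟨g, h1, h2, h3⟩

variable [MeasurableSpace E] [BorelSpace E]

section

variable {μ : Measure E} [IsFiniteMeasureOnCompacts μ]

theorem coeFn_testToLp (η : 𝓓(Ω, ℂ)) : testToLp μ η =ᵐ[μ] η :=
  (η.continuous.memLp_of_hasCompactSupport η.hasCompactSupport).coeFn_toLp

theorem inner_testToLp (η : 𝓓(Ω, ℂ)) (Ψ : Lp ℂ 2 μ) :
    inner ℂ (testToLp μ η) Ψ = ∫ x, Ψ x * conj (η x) ∂μ := by
  rw [L2.inner_def]
  exact integral_congr_ae ((coeFn_testToLp η).mono fun x hx => by simp [hx])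

/-- The fundamental lemma of the calculus of variations; real-valued test functions already suffice.
-/
theorem eq_zero_of_inner_testToLp [FiniteDimensional ℝ E] (hμ : ∀ᵐ x ∂μ, x ∈ Ω) {Ψ : Lp ℂ 2 μ}
    (h : ∀ η : 𝓓(Ω, ℂ), inner ℂ (testToLp μ η) Ψ = 0) : Ψ = 0 := by
  have hloc : LocallyIntegrableOn Ψ Ω μ :=
    ((Lp.memLp Ψ).locallyIntegrable (by norm_num)).locallyIntegrableOn _
  have h0 := Ω.isOpen.ae_eq_zero_of_integral_contDiff_smul_eq_zero hloc fun g h1 h2 h3 => by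
    have hs : tsupport (fun x => (g x : ℂ)) ⊆ tsupport g :=
      closure_mono fun x hx => by simpa using hx
    have := h (mkTest (fun x => (g x : ℂ)) (Complex.ofRealCLM.contDiff.comp h1)
      (h2.of_isClosed_subset (isClosed_tsupport _) hs) (hs.trans h3))
    rw [inner_testToLp] at this
    rw [← this]
    refine integral_congr_ae (.of_forall fun x => ?_)
    change (g x : ℂ) * Ψ x = Ψ x * conj (g x : ℂ)
    rw [Complex.conj_ofReal, mul_comm]
  refine Lp.ext ?_
  filter_upwards [h0, hμ, Lp.coeFn_zero ℂ 2 μ] with x h1 h2 h3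
  rw [h1 h2, h3, Pi.zero_apply]

theorem dense_range_testToLp [FiniteDimensional ℝ E] (hμ : ∀ᵐ x ∂μ, x ∈ Ω) :
    Dense (LinearMap.range (testToLp (Ω := Ω) μ) : Set (Lp ℂ 2 μ)) := by
  rw [Submodule.dense_iff_topologicalClosure_eq_top, Submodule.topologicalClosure_eq_top_iff,
    Submodule.eq_bot_iff]
  intro Ψ hΨ
  exact eq_zero_of_inner_testToLp hμ fun η => (Submodule.mem_orthogonal _ _).1 hΨ _ ⟨η, rfl⟩

/-- The pairs `(η, A η)` in `L² × L²`, for test functions `η`. -/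
noncomputable def minimalGraph (μ : Measure E) [IsFiniteMeasureOnCompacts μ]
    (A : Module.End ℂ 𝓓(Ω, ℂ)) :
    Submodule ℂ (Lp ℂ 2 μ × Lp ℂ 2 μ) :=
  LinearMap.range ((testToLp μ).prod (testToLp μ ∘ₗ A))

theorem mem_adjoint_minimalGraph {A : Module.End ℂ 𝓓(Ω, ℂ)} {P : Lp ℂ 2 μ × Lp ℂ 2 μ} :
    P ∈ (minimalGraph μ A).adjoint ↔
      ∀ η, inner ℂ (testToLp μ (A η)) P.1 = inner ℂ (testToLp μ η) P.2 := by
  rw [mem_adjoint]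
  constructor
  · exact fun h η => h _ ⟨η, rfl⟩
  · rintro h _ ⟨η, rfl⟩
    exact h η

/-- Formal symmetry of `A` with respect to `μ`. -/
def IsFormallySymmetric (μ : Measure E) [IsFiniteMeasureOnCompacts μ]
    (A : Module.End ℂ 𝓓(Ω, ℂ)) : Prop :=
  ∀ η ζ, inner ℂ (testToLp μ (A η)) (testToLp μ ζ) = inner ℂ (testToLp μ η) (testToLp μ (A ζ))

theorem IsFormallySymmetric.le_adjoint {A : Module.End ℂ 𝓓(Ω, ℂ)} (hA : IsFormallySymmetric μ A) :
    minimalGraph μ A ≤ (minimalGraph μ A).adjoint := by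
  rintro _ ⟨ζ, rfl⟩
  exact mem_adjoint_minimalGraph.2 fun η => hA η ζ

variable [FiniteDimensional ℝ E] (hμ : ∀ᵐ x ∂μ, x ∈ Ω) {A : Module.End ℂ 𝓓(Ω, ℂ)}
  (hA : IsFormallySymmetric μ A)

include hμ hA

/-- Formal symmetry, tested against a dense set, shows that the class of `A η` depends only on the
class of `η`. So the relation is single-valued and `Submodule.toLinearPMap` keeps it unchanged. -/
theorem graph_minimalOp : (minimalOp μ A).graph = minimalGraph μ A := by
  refine Submodule.toLinearPMap_graph_eq _ ?_
  rintro _ ⟨η, rfl⟩ h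
  refine eq_zero_of_inner_testToLp hμ fun ζ => ?_
  have h' : testToLp μ η = 0 := h
  exact (hA ζ η).symm.trans (by rw [h', inner_zero_right])

theorem dense_domain_minimalOp : Dense ((minimalOp μ A).domain : Set (Lp ℂ 2 μ)) := by
  refine (dense_range_testToLp hμ).mono ?_
  rintro _ ⟨η, rfl⟩
  have : (testToLp μ η, testToLp μ (A η)) ∈ (minimalOp μ A).graph := by
    rw [graph_minimalOp hμ hA]
    exact ⟨η, rfl⟩
  exact (LinearPMap.mem_domain_iff).2 ⟨_, this⟩

theorem graph_maximalOp : (maximalOp μ A).graph = (minimalGraph μ A).adjoint := by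
  rw [maximalOp, LinearPMap.adjoint_graph_eq_graph_adjoint (dense_domain_minimalOp hμ hA),
    graph_minimalOp hμ hA]

theorem isEssentiallySelfAdjoint_minimalOp_iff : IsEssentiallySelfAdjoint (minimalOp μ A) ↔
    (minimalGraph μ A).adjoint = (minimalGraph μ A).topologicalClosure := by
  rw [isEssentiallySelfAdjoint_iff_graph (dense_domain_minimalOp hμ hA),
    graph_minimalOp hμ hA]
  rw [graph_minimalOp hμ hA]
  exact hA.le_adjoint

end

theorem mem_graph_domRestrict {H : Type*} [AddCommGroup H] [Module ℂ H] {T : H →ₗ.[ℂ] H}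
    {S : Submodule ℂ H} {p : H × H} : p ∈ (T.domRestrict S).graph ↔ p ∈ T.graph ∧ p.1 ∈ S := by
  simp only [LinearPMap.mem_graph_iff]
  constructor
  · rintro ⟨y, h1, h2⟩
    have hy : (y : H) ∈ S ⊓ T.domain := y.2
    exact ⟨⟨⟨y, hy.2⟩, h1, by rw [← h2]; exact (LinearPMap.domRestrict_apply rfl).symm⟩, h1 ▸ hy.1⟩
  · rintro ⟨⟨y, h1, h2⟩, hS⟩
    refine ⟨⟨y, ⟨h1 ▸ hS, y.2⟩⟩, h1, ?_⟩
    rw [← h2]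
    exact LinearPMap.domRestrict_apply rfl

end TestFunctions

/-! ### Second order differential expressions in one variable -/

section OneVariable

open Filter Topology ComplexConjugate

variable {Ω : Opens ℝ}

theorem hasDerivAt_test (η : 𝓓(Ω, ℂ)) (v : ℝ) : HasDerivAt η (pd Ω 1 η v) v := by
  rw [pd_apply]
  exact ((η.contDiff.differentiable (by simp)) v).hasFDerivAt.hasDerivAt

theorem integrable_mul_conj_test {g : ℝ → ℂ} (hg : ContinuousOn g Ω) (ζ : 𝓓(Ω, ℂ)) :
    Integrable fun v => g v * conj (ζ v) := by
  have hc : Continuous fun v => g v * conj (ζ v) := by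
    have := Complex.continuous_conj.comp
      (continuous_mul_test (c := fun v => conj (g v)) (Complex.continuous_conj.comp_continuousOn hg)
        ζ)
    simpa [Function.comp_def] using this
  exact hc.integrable_of_hasCompactSupport
    (ζ.hasCompactSupport.comp_left (map_zero conj)).mul_left

/-- The difference of the integrands has the primitive `f conj(η') - f' conj(η)`. Nothing is known
about `f` outside `Ω`, but near every point there the primitive vanishes identically, by the support
of `η`. -/
theorem integral_second_deriv_mul (η : 𝓓(Ω, ℂ)) {f f' f'' : ℝ → ℂ}
    (hf : ∀ v ∈ Ω, HasDerivAt f (f' v) v) (hf' : ∀ v ∈ Ω, HasDerivAt f' (f'' v) v)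
    (hf'' : ContinuousOn f'' Ω) :
    ∫ v, f v * conj (pd Ω 1 (pd Ω 1 η) v) = ∫ v, f'' v * conj (η v) := by
  have c0 : ContinuousOn f Ω := fun v hv => (hf v hv).continuousAt.continuousWithinAt
  have c1 : ContinuousOn f' Ω := fun v hv => (hf' v hv).continuousAt.continuousWithinAt
  have int {g : ℝ → ℂ} (hg : ContinuousOn g Ω) (ζ : 𝓓(Ω, ℂ)) := integrable_mul_conj_test hg ζ
  rw [← sub_eq_zero, ← integral_sub (int c0 _) (int hf'' _)]
  refine integral_eq_zero_of_hasDerivAt_of_integrable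
    (f := fun v => f v * conj (pd Ω 1 η v) - f' v * conj (η v)) (fun v => ?_)
    ((int c0 _).sub (int hf'' _)) ((int c0 _).sub (int c1 _))
  by_cases hv : v ∈ Ω
  · have d0 : HasDerivAt (fun v => conj (η v)) (conj (pd Ω 1 η v)) v := (hasDerivAt_test η v).star
    have d1 : HasDerivAt (fun v => conj (pd Ω 1 η v)) (conj (pd Ω 1 (pd Ω 1 η) v)) v :=
      (hasDerivAt_test (pd Ω 1 η) v).star
    convert! ((hf v hv).mul d1).sub ((hf' v hv).mul d0) using 1
    ring
  · have hv' : v ∉ tsupport η := fun h => hv (η.tsupport_subset h)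
    have hv1 : v ∉ tsupport (pd Ω 1 η) := fun h => hv ((pd Ω 1 η).tsupport_subset h)
    have h0 : (fun v => f v * conj (pd Ω 1 η v) - f' v * conj (η v)) =ᶠ[𝓝 v] fun _ => 0 := by
      filter_upwards [notMem_tsupport_iff_eventuallyEq.mp hv',
        notMem_tsupport_iff_eventuallyEq.mp hv1] with y h1 h2
      simp [h1, h2]
    rw [test_eq_zero hv, test_eq_zero hv]
    simpa using (hasDerivAt_const v (0 : ℂ)).congr_of_eventuallyEq h0

/-- `B` is the differential expression `-a ∂² - q`. -/
def IsSchrodinger (B : Module.End ℂ 𝓓(Ω, ℂ)) (a : ℝ) (q : ℝ → ℝ) : Prop :=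
  ContinuousOn q Ω ∧ ∀ η v, B η v = -(a : ℂ) * pd Ω 1 (pd Ω 1 η) v - (q v : ℂ) * η v

variable {ν : Measure ℝ} [IsFiniteMeasureOnCompacts ν] (hν : ν = volume.restrict Ω)
  {B : Module.End ℂ 𝓓(Ω, ℂ)} {a : ℝ} {q : ℝ → ℝ} (hB : IsSchrodinger B a q)

include hν

omit [IsFiniteMeasureOnCompacts ν] in
theorem ae_mem_of_eq_restrict : ∀ᵐ v ∂ν, v ∈ Ω := by
  rw [hν]
  exact ae_restrict_mem Ω.isOpen.measurableSet

omit [IsFiniteMeasureOnCompacts ν] in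
theorem integral_eq_of_eq_restrict {g : ℝ → ℂ} (hg : ∀ v ∉ Ω, g v = 0) :
    ∫ v, g v ∂ν = ∫ v, g v := by
  rw [hν]
  exact setIntegral_eq_integral_of_forall_compl_eq_zero hg

include hB

theorem mem_adjoint_minimalGraph_of_hasDerivAt {F G : Lp ℂ 2 ν} {f f' f'' : ℝ → ℂ}
    (hf : ∀ v ∈ Ω, HasDerivAt f (f' v) v) (hf' : ∀ v ∈ Ω, HasDerivAt f' (f'' v) v)
    (hf'' : ContinuousOn f'' Ω) (hF : F =ᵐ[ν] f)
    (hG : G =ᵐ[ν] fun v => -(a : ℂ) * f'' v - (q v : ℂ) * f v) :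
    (F, G) ∈ (minimalGraph ν B).adjoint := by
  rw [mem_adjoint_minimalGraph]
  intro η
  rw [inner_testToLp, inner_testToLp]
  have e1 : ∫ v, F v * conj (B η v) ∂ν = ∫ v, f v * conj (B η v) := by
    rw [← integral_eq_of_eq_restrict hν fun v hv => by rw [test_eq_zero hv, map_zero, mul_zero]]
    exact integral_congr_ae (hF.mono fun v hv => by simp only [hv])
  have e2 : ∫ v, G v * conj (η v) ∂ν =
      ∫ v, (-(a : ℂ) * f'' v - (q v : ℂ) * f v) * conj (η v) := by
    rw [← integral_eq_of_eq_restrict hν fun v hv => by rw [test_eq_zero hv, map_zero, mul_zero]]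
    exact integral_congr_ae (hG.mono fun v hv => by simp only [hv])
  rw [e1, e2]
  have c0 : ContinuousOn f Ω := fun v hv => (hf v hv).continuousAt.continuousWithinAt
  have hq : ContinuousOn (fun v => (q v : ℂ)) Ω := Complex.continuous_ofReal.comp_continuousOn hB.1
  have i1 := integrable_mul_conj_test c0 (pd Ω 1 (pd Ω 1 η))
  have i2 := integrable_mul_conj_test hf'' η
  have i3 := integrable_mul_conj_test (g := fun v => q v * f v) (hq.mul c0) η
  have s1 : ∀ v, f v * conj (B η v) =
      -(a : ℂ) * (f v * conj (pd Ω 1 (pd Ω 1 η) v)) - (q v * f v) * conj (η v) := by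
    intro v
    rw [hB.2]
    simp only [map_sub, map_mul, map_neg, Complex.conj_ofReal]
    ring
  have s2 : ∀ v, (-(a : ℂ) * f'' v - (q v : ℂ) * f v) * conj (η v) =
      -(a : ℂ) * (f'' v * conj (η v)) - (q v * f v) * conj (η v) := fun v => by ring
  simp_rw [s1, s2]
  rw [integral_sub (i1.const_mul _) i3, integral_sub (i2.const_mul _) i3, integral_const_mul,
    integral_const_mul, integral_second_deriv_mul η hf hf' hf'']

theorem IsSchrodinger.isFormallySymmetric : IsFormallySymmetric ν B := by
  intro η ζ
  refine mem_adjoint_minimalGraph.1 (mem_adjoint_minimalGraph_of_hasDerivAt hν hB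
    (F := testToLp ν ζ) (G := testToLp ν (B ζ)) (fun v _ => hasDerivAt_test ζ v)
    (fun v _ => hasDerivAt_test _ v) (TestFunction.continuous _).continuousOn (coeFn_testToLp ζ)
    ((coeFn_testToLp _).mono fun v hv => hv.trans (hB.2 ζ v))) η

/-- Two solutions of the form `f₀`, `conj f₀` which are cut off near one end point, and are
square integrable at the other, prevent `-a ∂² - q` from being essentially self-adjoint. -/
theorem IsSchrodinger.not_isEssentiallySelfAdjoint (ha : a ≠ 0) (h12 : Icc 1 2 ⊆ (Ω : Set ℝ))
    {χ : ℝ → ℝ} (hχ : ContDiff ℝ ∞ χ) {c₀ c₁ : ℝ} (hχ0 : ∀ v ≤ 1, χ v = c₀)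
    (hχ1 : ∀ v, 2 ≤ v → χ v = c₁) (hc : c₀ ^ 2 ≠ c₁ ^ 2) {f₀ r r' : ℝ → ℂ} {κ m : ℝ}
    (hκ : κ ≠ 0) (hf₀ : ∀ v ∈ Ω, HasDerivAt f₀ (r v * f₀ v) v)
    (hr : ∀ v ∈ Ω, HasDerivAt r (r' v) v) (hr' : ContinuousOn r' Ω)
    (hq : ∀ v ∈ Ω, -(a : ℂ) * (r' v + r v ^ 2) - q v = m)
    (hW : ∀ v ∈ Ω, ‖f₀ v‖ ^ 2 * (r v).im = κ) (hL : MemLp (fun v => χ v * f₀ v) 2 ν) :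
    ¬ IsEssentiallySelfAdjoint (minimalOp ν B) := by
  intro hesa
  rw [isEssentiallySelfAdjoint_minimalOp_iff (ae_mem_of_eq_restrict hν)
    (hB.isFormallySymmetric hν)] at hesa
  have dχ : ∀ v, HasDerivAt χ (deriv χ v) v := fun v =>
    ((hχ.differentiable (by simp)) v).hasDerivAt
  have hχ' : ContDiff ℝ ∞ (deriv χ) := (contDiff_infty_iff_deriv.1 hχ).2
  have dχ' : ∀ v, HasDerivAt (deriv χ) (deriv (deriv χ) v) v := fun v =>
    ((hχ'.differentiable (by simp)) v).hasDerivAt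
  have zχ : ∀ v, v ∉ Icc (1 : ℝ) 2 → deriv χ v = 0 ∧ deriv (deriv χ) v = 0 := by
    intro v hv
    have : ∃ c, χ =ᶠ[𝓝 v] fun _ => c := by
      rw [mem_Icc, not_and_or, not_le, not_le] at hv
      rcases hv with hv | hv
      · exact ⟨c₀, (eventually_lt_nhds hv).mono fun w hw => hχ0 w hw.le⟩
      · exact ⟨c₁, (eventually_gt_nhds hv).mono fun w hw => hχ1 w hw.le⟩
    obtain ⟨c, hc⟩ := this
    have h1 := hc.deriv
    have h2 := h1.deriv
    exact ⟨by simpa using h1.eq_of_nhds, by simpa using h2.eq_of_nhds⟩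
  have cf₀ : ContinuousOn f₀ Ω := fun v hv => (hf₀ v hv).continuousAt.continuousWithinAt
  have cr : ContinuousOn r Ω := fun v hv => (hr v hv).continuousAt.continuousWithinAt
  have cχ : Continuous fun v => (χ v : ℂ) := Complex.continuous_ofReal.comp hχ.continuous
  have cχ' : Continuous fun v => ((deriv χ v : ℝ) : ℂ) :=
    Complex.continuous_ofReal.comp hχ'.continuous
  have cχ'' : Continuous fun v => ((deriv (deriv χ) v : ℝ) : ℂ) :=
    Complex.continuous_ofReal.comp (contDiff_infty_iff_deriv.1 hχ').2.continuous
  -- Here `r` is the logarithmic derivative of `f₀`, so the second derivative of `f₀` is `(r' + r²)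
  -- f₀`. The function `g` collects the terms in which `χ` is differentiated; it lives on `[1, 2]`
  -- and is therefore square integrable.
  let f' : ℝ → ℂ := fun v => (deriv χ v + χ v * r v) * f₀ v
  let f'' : ℝ → ℂ := fun v =>
    (deriv (deriv χ) v + 2 * deriv χ v * r v + χ v * (r' v + r v ^ 2)) * f₀ v
  let g : ℝ → ℂ := fun v => (deriv (deriv χ) v + 2 * deriv χ v * r v) * f₀ v
  have hg : MemLp g 2 ν := by
    have h1 : MemLp (fun v => (Icc (1 : ℝ) 2).indicator g v) 2 ν := by
      rw [memLp_indicator_iff_restrict measurableSet_Icc]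
      have hgc : ContinuousOn g (Icc 1 2) :=
        ((cχ''.continuousOn.add ((continuousOn_const.mul cχ'.continuousOn).mul cr)).mul cf₀).mono
          h12
      obtain ⟨C, hC⟩ := isCompact_Icc.exists_bound_of_continuousOn hgc
      have : IsFiniteMeasure (ν.restrict (Icc 1 2)) :=
        ⟨by rw [Measure.restrict_apply_univ]; exact isCompact_Icc.measure_lt_top⟩
      exact MemLp.of_bound (hgc.aestronglyMeasurable measurableSet_Icc) C
        ((ae_restrict_mem measurableSet_Icc).mono hC)
    convert h1 with v
    by_cases hv : v ∈ Icc (1 : ℝ) 2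
    · rw [indicator_of_mem hv]
    · rw [indicator_of_notMem hv]
      simp [g, zχ v hv]
  have hG : MemLp (fun v => -(a : ℂ) * g v + m * (χ v * f₀ v)) 2 ν :=
    (hg.const_mul _).add (hL.const_mul _)
  have hmem : (hL.toLp _, hG.toLp _) ∈ (minimalGraph ν B).adjoint := by
    refine mem_adjoint_minimalGraph_of_hasDerivAt hν hB (f' := f') (f'' := f'') ?_ ?_ ?_
      hL.coeFn_toLp ?_
    · intro v hv
      convert! (dχ v).ofReal_comp.mul (hf₀ v hv) using 1
      simp only [f']
      ring
    · intro v hv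
      convert! ((dχ' v).ofReal_comp.add ((dχ v).ofReal_comp.mul (hr v hv))).mul (hf₀ v hv) using 1
      simp only [f'', Pi.add_apply, Pi.mul_apply]
      ring
    · exact ((cχ''.continuousOn.add ((continuousOn_const.mul cχ'.continuousOn).mul cr)).add
        (cχ.continuousOn.mul (hr'.add (cr.pow 2)))).mul cf₀
    · filter_upwards [hG.coeFn_toLp, ae_mem_of_eq_restrict hν] with v h1 h2
      rw [h1, ← hq v h2]
      simp only [f'', g]
      ring
  -- Under essential self-adjointness the pair lies both in the closed minimal graph and in the
  -- adjoint of it, so it may be paired with itself.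
  have hsym := hmem
  rw [← adjoint_topologicalClosure] at hsym
  rw [hesa] at hmem
  have h := mem_adjoint.1 hsym _ hmem
  simp only at h
  rw [L2.inner_def, L2.inner_def, ← sub_eq_zero,
    ← integral_sub (L2.integrable_inner _ _) (L2.integrable_inner _ _)] at h
  have hd : ∀ v, HasDerivAt (fun v => χ v ^ 2) (2 * χ v * deriv χ v) v := fun v => by
    convert! (dχ v).pow 2 using 1
    ring
  have hI : ∫ v, (2 * χ v * deriv χ v) ∂ν = c₁ ^ 2 - c₀ ^ 2 := by
    have : ∫ v, (2 * χ v * deriv χ v) ∂ν = ∫ v in (1 : ℝ)..2, (2 * χ v * deriv χ v) := by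
      rw [hν, intervalIntegral.integral_of_le one_le_two, ← integral_Icc_eq_integral_Ioc]
      rw [setIntegral_eq_of_subset_of_forall_sdiff_eq_zero Ω.isOpen.measurableSet h12]
      intro v hv
      rw [(zχ v hv.2).1, mul_zero]
    rw [this, intervalIntegral.integral_eq_sub_of_hasDerivAt fun v _ => hd v,
      hχ0 1 le_rfl, hχ1 2 le_rfl]
    exact (((continuous_const.mul hχ.continuous).mul hχ'.continuous)).intervalIntegrable _ _
  -- The term with the real number `m` cancels. By constancy of the Wronskian, `‖f₀‖² Im r = κ`, the
  -- rest is a nonzero constant times the derivative of `χ²`, with integral proportional to `c₁² -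
  -- c₀² ≠ 0`.
  have hint : ∀ᵐ v ∂ν, inner ℂ (hG.toLp _ v) (hL.toLp _ v) - inner ℂ (hL.toLp _ v) (hG.toLp _ v) =
      (2 * a * κ * Complex.I) * ((2 * χ v * deriv χ v : ℝ) : ℂ) := by
    filter_upwards [hG.coeFn_toLp, hL.coeFn_toLp, ae_mem_of_eq_restrict hν] with v h1 h2 h3
    rw [h1, h2, ← hW v h3]
    have hn : ((‖f₀ v‖ ^ 2 : ℝ) : ℂ) = conj (f₀ v) * f₀ v := by
      rw [← Complex.normSq_eq_norm_sq, Complex.normSq_eq_conj_mul_self]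
    have him : r v - conj (r v) = 2 * (r v).im * Complex.I := by
      rw [Complex.sub_conj]; push_cast; ring
    simp only [RCLike.inner_apply, g, map_add, map_mul, map_neg, Complex.conj_ofReal, map_ofNat]
    push_cast at hn ⊢
    rw [hn]
    linear_combination (2 * a * χ v * ((deriv χ v : ℝ) : ℂ) * f₀ v * conj (f₀ v)) * him
  rw [integral_congr_ae hint, integral_const_mul, integral_complex_ofReal, hI] at h
  simp only [mul_eq_zero, Complex.ofReal_eq_zero, Complex.I_ne_zero, or_false,
    two_ne_zero, false_or, ha, hκ, sub_eq_zero] at h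
  exact hc h.symm

end OneVariable

/-! ### The partial Fourier transform of test functions -/

section PartialFourier

open Filter Topology ComplexConjugate

variable {X : Type*} [NormedAddCommGroup X] [NormedSpace ℝ X]

/-- The function `x ↦ e^{-i θ(ξ, x)}`. -/
noncomputable def wave (θ : X →L[ℝ] X →L[ℝ] ℝ) (ξ x : X) : ℂ :=
  Complex.exp (-(Complex.I * (θ ξ x : ℂ)))

variable {θ : X →L[ℝ] X →L[ℝ] ℝ}

theorem norm_wave (ξ x : X) : ‖wave θ ξ x‖ = 1 := by
  have : -(Complex.I * (θ ξ x : ℂ)) = ((-(θ ξ x) : ℝ) : ℂ) * Complex.I := by push_cast; ring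
  rw [wave, this, Complex.norm_exp_ofReal_mul_I]

theorem wave_add (ξ x y : X) : wave θ ξ (x + y) = wave θ ξ x * wave θ ξ y := by
  rw [wave, wave, wave, ← Complex.exp_add, map_add]
  push_cast
  ring_nf

theorem continuous_wave : Continuous fun p : X × X => wave θ p.1 p.2 := by
  unfold wave
  fun_prop

theorem continuous_wave_right (ξ : X) : Continuous (wave θ ξ) := by
  unfold wave
  fun_prop

theorem hasFDerivAt_wave (ξ x : X) : HasFDerivAt (wave θ ξ)
    (wave θ ξ x • (-Complex.I) • Complex.ofRealCLM.comp (θ ξ)) x := by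
  have h1 : HasFDerivAt (fun x => -(Complex.I * (θ ξ x : ℂ)))
      ((-Complex.I) • Complex.ofRealCLM.comp (θ ξ)) x := by
    have := ((Complex.ofRealCLM.comp (θ ξ)).hasFDerivAt (x := x)).const_mul (-Complex.I)
    convert! this using 1
    ext y
    simp
  exact h1.cexp

variable {Ω : Opens (X × ℝ)}

theorem hasDerivAt_test_snd (η : 𝓓(Ω, ℂ)) (x : X) (v : ℝ) :
    HasDerivAt (fun v => η (x, v)) (pd Ω (0, 1) η (x, v)) v := by
  rw [pd_apply]
  have h := ((η.contDiff.differentiable (by simp)) (x, v)).hasFDerivAt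
  have h2 : HasDerivAt (fun v : ℝ => (x, v)) ((0 : X), (1 : ℝ)) v :=
    (hasDerivAt_const v x).prodMk (hasDerivAt_id v)
  exact h.comp_hasDerivAt v h2

theorem hasFDerivAt_test_fst (η : 𝓓(Ω, ℂ)) (x : X) (v : ℝ) :
    HasFDerivAt (fun x => η (x, v))
      ((fderiv ℝ η (x, v)).comp (ContinuousLinearMap.inl ℝ X ℝ)) x := by
  have h := ((η.contDiff.differentiable (by simp)) (x, v)).hasFDerivAt
  have h2 : HasFDerivAt (fun x : X => (x, v)) (ContinuousLinearMap.inl ℝ X ℝ) x := by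
    convert! (hasFDerivAt_id x).prodMk (hasFDerivAt_const v x) using 1
  exact h.comp x h2

theorem continuous_test_fst (η : 𝓓(Ω, ℂ)) (v : ℝ) : Continuous fun x => η (x, v) :=
  η.continuous.comp (by fun_prop)

theorem test_eq_zero_of_fst {η : 𝓓(Ω, ℂ)} {x : X} (hx : x ∉ Prod.fst '' tsupport η) (v : ℝ) :
    η (x, v) = 0 :=
  image_eq_zero_of_notMem_tsupport fun h => hx ⟨_, h, rfl⟩

theorem test_eq_zero_of_snd {η : 𝓓(Ω, ℂ)} {v : ℝ} (hv : v ∉ Prod.snd '' tsupport η) (x : X) :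
    η (x, v) = 0 :=
  image_eq_zero_of_notMem_tsupport fun h => hv ⟨_, h, rfl⟩

theorem isCompact_fst_tsupport (η : 𝓓(Ω, ℂ)) : IsCompact (Prod.fst '' tsupport η) :=
  η.hasCompactSupport.isCompact.image continuous_fst

theorem isCompact_snd_tsupport (η : 𝓓(Ω, ℂ)) : IsCompact (Prod.snd '' tsupport η) :=
  η.hasCompactSupport.isCompact.image continuous_snd

theorem hasCompactSupport_test_fst (η : 𝓓(Ω, ℂ)) (v : ℝ) : HasCompactSupport fun x => η (x, v) :=
  HasCompactSupport.intro (isCompact_fst_tsupport η) fun _ hx => test_eq_zero_of_fst hx v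

variable {Ω₁ : Opens ℝ}

theorem exists_translate_test (hΩ : ∀ p : X × ℝ, p ∈ Ω ↔ p.2 ∈ Ω₁) (η : 𝓓(Ω, ℂ)) (a : X) :
    ∃ ζ : 𝓓(Ω, ℂ), ∀ x v, ζ (x, v) = η (x - a, v) := by
  let τ : X × ℝ ≃ₜ X × ℝ := Homeomorph.subRight ((a, 0) : X × ℝ)
  have hs : tsupport (η ∘ τ) = τ ⁻¹' tsupport η := tsupport_comp_eq_preimage η τ
  refine ⟨mkTest (η ∘ τ) (η.contDiff.comp (contDiff_id.sub contDiff_const))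
    (η.hasCompactSupport.comp_homeomorph τ) ?_, fun x v => ?_⟩
  · rw [hs]
    intro p hp
    have := (hΩ _).1 (η.tsupport_subset hp)
    refine (hΩ p).2 ?_
    simpa [τ] using this
  · change η (τ (x, v)) = _
    simp [τ]

theorem exists_tensor_test (hΩ : ∀ p : X × ℝ, p ∈ Ω ↔ p.2 ∈ Ω₁) {g : X → ℝ} (hg : ContDiff ℝ ∞ g)
    (hg' : HasCompactSupport g) (f : 𝓓(Ω₁, ℂ)) :
    ∃ ζ : 𝓓(Ω, ℂ), ∀ x v, ζ (x, v) = g x * f v := by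
  have hs : Function.support (fun p : X × ℝ => (g p.1 : ℂ) * f p.2) ⊆ tsupport g ×ˢ tsupport f := by
    intro p hp
    rw [Function.mem_support, mul_ne_zero_iff] at hp
    exact ⟨subset_tsupport _ (by simpa using hp.1), subset_tsupport _ hp.2⟩
  have hs' := closure_minimal hs ((isClosed_tsupport g).prod (isClosed_tsupport f))
  refine ⟨mkTest (fun p : X × ℝ => (g p.1 : ℂ) * f p.2) ?_ ?_ ?_, fun x v => rfl⟩
  · exact (Complex.ofRealCLM.contDiff.comp (hg.comp contDiff_fst)).mul
      (f.contDiff.comp contDiff_snd)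
  · exact (hg'.isCompact.prod f.hasCompactSupport.isCompact).of_isClosed_subset
      (isClosed_tsupport _) hs'
  · exact fun p hp => (hΩ p).2 (f.tsupport_subset (hs' hp).2)

variable [MeasureSpace X] [BorelSpace X] [(volume : Measure X).IsAddHaarMeasure]

/-- The Fourier integral in the first variable. -/
noncomputable def fourierFst (θ : X →L[ℝ] X →L[ℝ] ℝ) (ξ : X) (F : X × ℝ → ℂ) (v : ℝ) : ℂ :=
  ∫ x, wave θ ξ x * F (x, v)

theorem integrable_wave_mul_test (η : 𝓓(Ω, ℂ)) (ξ : X) (v : ℝ) :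
    Integrable fun x => wave θ ξ x * η (x, v) :=
  ((continuous_wave_right ξ).mul (continuous_test_fst η v)).integrable_of_hasCompactSupport
    (hasCompactSupport_test_fst η v).mul_left

theorem hasDerivAt_fourierFst (η : 𝓓(Ω, ℂ)) (ξ : X) (v : ℝ) :
    HasDerivAt (fourierFst θ ξ η) (fourierFst θ ξ (pd Ω (0, 1) η) v) v := by
  obtain ⟨C, hC⟩ := (pd Ω (0, 1) η).hasCompactSupport.exists_bound_of_continuous
    (pd Ω (0, 1) η).continuous
  let K := Prod.fst '' tsupport (pd Ω (0, 1) η)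
  have hK : IsCompact K := isCompact_fst_tsupport _
  refine (hasDerivAt_integral_of_dominated_loc_of_deriv_le (s := univ)
    (F := fun v x => wave θ ξ x * η (x, v))
    (F' := fun v x => wave θ ξ x * pd Ω (0, 1) η (x, v)) (bound := K.indicator fun _ => C)
    univ_mem ?_ (integrable_wave_mul_test η ξ v) ?_ ?_ ?_ ?_).2
  · exact .of_forall fun w => (integrable_wave_mul_test η ξ w).aestronglyMeasurable
  · exact (integrable_wave_mul_test _ ξ v).aestronglyMeasurable
  · refine .of_forall fun x w _ => ?_
    rw [norm_mul, norm_wave, one_mul]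
    by_cases hx : x ∈ K
    · rw [indicator_of_mem hx]
      exact hC _
    · rw [indicator_of_notMem hx, test_eq_zero_of_fst hx, norm_zero]
  · exact (integrable_indicator_iff hK.isClosed.measurableSet).2
      (integrableOn_const hK.measure_lt_top.ne)
  · exact .of_forall fun x w _ => (hasDerivAt_test_snd η x w).const_mul _

/-- The derivative is the transform of another test function, so induction on the order works once
`η` is generalised. -/
theorem contDiff_fourierFst (η : 𝓓(Ω, ℂ)) (ξ : X) : ContDiff ℝ ∞ (fourierFst θ ξ η) := by
  rw [contDiff_infty]
  intro n
  induction n generalizing η with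
  | zero =>
    exact contDiff_zero.2 (continuous_iff_continuousAt.2 fun v =>
      (hasDerivAt_fourierFst η ξ v).continuousAt)
  | succ n ih =>
    have : ((n + 1 : ℕ) : ℕ∞ω) = (n : ℕ∞ω) + 1 := by norm_cast
    rw [this, contDiff_succ_iff_deriv]
    refine ⟨fun v => (hasDerivAt_fourierFst η ξ v).differentiableAt, by simp, ?_⟩
    rw [show deriv (fourierFst θ ξ η) = fourierFst θ ξ (pd Ω (0, 1) η) from
      funext fun v => (hasDerivAt_fourierFst η ξ v).deriv]
    exact ih _

omit [BorelSpace X] [(volume : Measure X).IsAddHaarMeasure] in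
theorem fourierFst_eq_zero {η : 𝓓(Ω, ℂ)} {v : ℝ} (hv : v ∉ Prod.snd '' tsupport η) (ξ : X) :
    fourierFst θ ξ η v = 0 := by
  rw [fourierFst]
  simp_rw [test_eq_zero_of_snd hv, mul_zero, integral_zero]

omit [BorelSpace X] [(volume : Measure X).IsAddHaarMeasure] in
theorem tsupport_fourierFst (η : 𝓓(Ω, ℂ)) (ξ : X) :
    tsupport (fourierFst θ ξ η) ⊆ Prod.snd '' tsupport η := by
  refine closure_minimal (fun v hv => ?_) (isCompact_snd_tsupport η).isClosed
  by_contra h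
  exact hv (fourierFst_eq_zero h ξ)

/-- `N` times the Fourier transform in the first variable, at a fixed frequency. -/
noncomputable def partialFourier (hΩ : ∀ p : X × ℝ, p ∈ Ω ↔ p.2 ∈ Ω₁) (N : ℝ)
    (θ : X →L[ℝ] X →L[ℝ] ℝ) (ξ : X) : 𝓓(Ω, ℂ) →ₗ[ℂ] 𝓓(Ω₁, ℂ) where
  toFun η := (N : ℂ) • mkTest (fourierFst θ ξ η) (contDiff_fourierFst η ξ)
    (HasCompactSupport.intro (isCompact_snd_tsupport η) fun _ hv => fourierFst_eq_zero hv ξ)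
    ((tsupport_fourierFst η ξ).trans (by
      rintro _ ⟨p, hp, rfl⟩
      exact (hΩ p).1 (η.tsupport_subset hp)))
  map_add' η ζ := by
    rw [← smul_add]
    congr 1
    ext v
    change ∫ x, wave θ ξ x * (η (x, v) + ζ (x, v)) =
      (∫ x, wave θ ξ x * η (x, v)) + ∫ x, wave θ ξ x * ζ (x, v)
    simp_rw [mul_add]
    exact integral_add (integrable_wave_mul_test η ξ v) (integrable_wave_mul_test ζ ξ v)
  map_smul' c η := by
    rw [RingHom.id_apply, smul_comm c]
    congr 1
    ext v
    change ∫ x, wave θ ξ x * (c * η (x, v)) = c * ∫ x, wave θ ξ x * η (x, v)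
    rw [← integral_const_mul]
    exact integral_congr_ae (.of_forall fun x => by ring)

variable {hΩ : ∀ p : X × ℝ, p ∈ Ω ↔ p.2 ∈ Ω₁} {N : ℝ}

theorem partialFourier_apply (ξ : X) (η : 𝓓(Ω, ℂ)) (v : ℝ) :
    partialFourier hΩ N θ ξ η v = N * ∫ x, wave θ ξ x * η (x, v) := rfl

theorem partialFourier_pd_snd (ξ : X) (η : 𝓓(Ω, ℂ)) :
    partialFourier hΩ N θ ξ (pd Ω (0, 1) η) = pd Ω₁ 1 (partialFourier hΩ N θ ξ η) := by
  ext v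
  have h1 := hasDerivAt_test (partialFourier hΩ N θ ξ η) v
  have h2 : HasDerivAt (partialFourier hΩ N θ ξ η) (N * fourierFst θ ξ (pd Ω (0, 1) η) v) v :=
    (hasDerivAt_fourierFst η ξ v).const_mul (N : ℂ)
  exact h2.unique h1

theorem partialFourier_mulBy {c : ℝ → ℝ} (hc : ContDiffOn ℝ ∞ c Ω₁)
    (hc' : ContDiffOn ℝ ∞ (fun p : X × ℝ => c p.2) Ω) (ξ : X) (η : 𝓓(Ω, ℂ)) :
    partialFourier hΩ N θ ξ (mulBy (fun p : X × ℝ => c p.2) hc' η) =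
      mulBy c hc (partialFourier hΩ N θ ξ η) := by
  ext v
  change _ = c v • partialFourier hΩ N θ ξ η v
  rw [partialFourier_apply, partialFourier_apply, Complex.real_smul, mul_left_comm]
  congr 1
  rw [← integral_const_mul]
  refine integral_congr_ae (.of_forall fun x => ?_)
  change wave θ ξ x * (c v • η (x, v)) = _
  rw [Complex.real_smul]
  ring

theorem partialFourier_pd_fst [FiniteDimensional ℝ X]
    (ξ y : X) (η : 𝓓(Ω, ℂ)) : partialFourier hΩ N θ ξ (pd Ω (y, 0) η) =
      (Complex.I * θ ξ y) • partialFourier hΩ N θ ξ η := by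
  ext v
  change _ = (Complex.I * θ ξ y) * _
  rw [partialFourier_apply, partialFourier_apply, mul_left_comm]
  congr 1
  have e1 (x : X) : fderiv ℝ (fun x => η (x, v)) x y = pd Ω (y, 0) η (x, v) := by
    rw [(hasFDerivAt_test_fst η x v).fderiv, pd_apply]
    simp
  have e2 (x : X) : fderiv ℝ (wave θ ξ) x y = -(Complex.I * θ ξ y) * wave θ ξ x := by
    rw [(hasFDerivAt_wave ξ x).fderiv]
    simp
    ring
  have h := integral_mul_fderiv_eq_neg_fderiv_mul_of_integrable (μ := (volume : Measure X))
    (f := wave θ ξ) (g := fun x => η (x, v)) (v := y) ?_ ?_ (integrable_wave_mul_test η ξ v)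
    (fun x _ => (hasFDerivAt_wave ξ x).differentiableAt)
    (fun x _ => (hasFDerivAt_test_fst η x v).differentiableAt)
  · simp_rw [e1, e2] at h
    rw [h, ← integral_const_mul, ← integral_neg]
    exact integral_congr_ae (.of_forall fun x => by ring)
  · simp_rw [e2, mul_assoc]
    exact (integrable_wave_mul_test η ξ v).const_mul _
  · simp_rw [e1]
    exact integrable_wave_mul_test _ ξ v

/-- A translation acts as a character of the frequency. Varying `a` thus gives access to the Fourier
transform, in `ξ`, of any pairing with `η`. -/
theorem partialFourier_translate {η ζ : 𝓓(Ω, ℂ)} {a : X}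
    (h : ∀ x v, ζ (x, v) = η (x - a, v)) (ξ : X) :
    partialFourier hΩ N θ ξ ζ = wave θ ξ a • partialFourier hΩ N θ ξ η := by
  ext v
  change _ = wave θ ξ a * _
  rw [partialFourier_apply, partialFourier_apply, mul_left_comm]
  congr 1
  rw [← integral_sub_right_eq_self (fun x => wave θ ξ x * η (x, v)) a, ← integral_const_mul]
  refine integral_congr_ae (.of_forall fun x => ?_)
  simp only [h]
  nth_rw 1 [← sub_add_cancel x a]
  rw [wave_add]
  ring

/-- There are countably many test functions whose partial Fourier transforms attain, up to a
nonzero factor, a given test function at every frequency. -/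
theorem exists_partialFourier_eq_smul [FiniteDimensional ℝ X] (hN : N ≠ 0) (f : 𝓓(Ω₁, ℂ)) :
    ∃ ζ : ℕ → 𝓓(Ω, ℂ), ∀ ξ, ∃ m, ∃ c : ℂ, c ≠ 0 ∧ partialFourier hΩ N θ ξ (ζ m) = c • f := by
  -- The bumps shrink to the origin. As soon as `m > ‖θ ξ‖`, the phase `θ ξ x` is at most `1` in
  -- absolute value on the ball of radius `1 / (m + 1)`, so the real part of the wave is at least
  -- `cos 1 > 0` there and the transform of the bump does not vanish at `ξ`.
  let b (m : ℕ) : ContDiffBump (0 : X) :=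
    ⟨1 / (2 * (m + 1)), 1 / (m + 1), by positivity, by
      rw [one_div_lt_one_div (by positivity) (by positivity)]
      linarith [show (0 : ℝ) < m + 1 by positivity]⟩
  have hex (m : ℕ) : ∃ ζ : 𝓓(Ω, ℂ), ∀ x v, ζ (x, v) = b m x * f v :=
    exists_tensor_test hΩ (b m).contDiff (b m).hasCompactSupport f
  choose ζ hζ using hex
  refine ⟨ζ, fun ξ => ?_⟩
  obtain ⟨m, hm⟩ := exists_nat_gt ‖θ ξ‖
  have hint : Integrable fun x => wave θ ξ x * (b m x : ℂ) := by
    refine ((continuous_wave_right ξ).mul (Complex.continuous_ofReal.comp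
      (b m).continuous)).integrable_of_hasCompactSupport ?_
    exact ((b m).hasCompactSupport.comp_left (g := Complex.ofReal) Complex.ofReal_zero).mul_left
  refine ⟨m, N * ∫ x, wave θ ξ x * (b m x : ℂ), mul_ne_zero (by exact_mod_cast hN) ?_, ?_⟩
  · have hre : 0 < (∫ x, wave θ ξ x * (b m x : ℂ)).re := by
      have hpos : 0 < ∫ x, Real.cos 1 * b m x := by
        rw [integral_const_mul]
        exact mul_pos Real.cos_one_pos (b m).integral_pos
      have : (∫ x, wave θ ξ x * (b m x : ℂ)).re = ∫ x, (wave θ ξ x * (b m x : ℂ)).re :=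
        (Complex.reCLM.integral_comp_comm hint).symm
      rw [this]
      refine hpos.trans_le (integral_mono ((b m).integrable.const_mul _) hint.re fun x => ?_)
      have hw : (wave θ ξ x).re = Real.cos (θ ξ x) := by
        have : -(Complex.I * (θ ξ x : ℂ)) = ((-(θ ξ x) : ℝ) : ℂ) * Complex.I := by
          push_cast; ring
        rw [wave, this, Complex.exp_ofReal_mul_I_re, Real.cos_neg]
      simp only [Complex.mul_re, Complex.ofReal_re, Complex.ofReal_im,
        mul_zero, sub_zero, hw]
      by_cases hx : x ∈ Metric.ball (0 : X) (b m).rOut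
      · refine mul_le_mul_of_nonneg_right ?_ (b m).nonneg
        rw [← Real.cos_abs (θ ξ x)]
        refine Real.cos_le_cos_of_nonneg_of_le_pi (abs_nonneg _) (by linarith [Real.pi_gt_three]) ?_
        rw [mem_ball_zero_iff] at hx
        have h1 : |θ ξ x| ≤ ‖θ ξ‖ * ‖x‖ := (θ ξ).le_opNorm x
        have h2 : ‖x‖ < 1 / (m + 1) := hx
        rw [lt_div_iff₀ (by positivity)] at h2
        nlinarith [norm_nonneg x, norm_nonneg (θ ξ)]
      · have : b m x = 0 := (b m).zero_of_le_dist (by simpa using hx)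
        simp [this]
    exact fun h => by simp [h] at hre
  · ext v
    change _ = _ * f v
    rw [partialFourier_apply, mul_assoc, ← integral_mul_const]
    congr 1
    exact integral_congr_ae (.of_forall fun x => by simp only [hζ]; ring)

end PartialFourier

/-! ### Fourier kernels: uniqueness and Plancherel's identity -/

section Kernel

open Filter Topology ComplexConjugate

/-! ### Injectivity of the Fourier transform on integrable functions. -/

section Uniqueness

variable {X : Type*} [NormedAddCommGroup X] [NormedSpace ℝ X] [FiniteDimensional ℝ X]
  [MeasureSpace X] [BorelSpace X] {θ : X →L[ℝ] X →L[ℝ] ℝ}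

omit [FiniteDimensional ℝ X] [MeasureSpace X] [BorelSpace X] in
theorem continuous_wave_left (a : X) : Continuous fun ξ => wave θ ξ a := by
  unfold wave
  fun_prop

omit [FiniteDimensional ℝ X] in
theorem integrable_wave_mul {E : X → ℂ} (hE : Integrable E) (a : X) :
    Integrable fun ξ => wave θ ξ a * E ξ := by
  have := hE.bdd_mul (c := 1) (continuous_wave_left (θ := θ) a).aestronglyMeasurable
    (.of_forall fun ξ => (norm_wave ξ a).le)
  exact this

/-- The positive and negative parts of `g` are densities of finite measures with equal
characteristic functions, so the measures agree. Nondegeneracy of `θ` makes the characters separate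
points. -/
theorem ae_eq_zero_of_integral_wave_mul_ofReal (hθ : ∀ ξ ≠ 0, θ ξ ≠ 0) {g : X → ℝ}
    (hg : Integrable g) (h : ∀ a, ∫ ξ, wave θ ξ a * g ξ = 0) : g =ᵐ[volume] 0 := by
  have : ProperSpace X := FiniteDimensional.proper_real X
  have hm := hg.aestronglyMeasurable.aemeasurable
  have m1 : AEMeasurable (fun x => ENNReal.ofReal (g x)) := hm.ennreal_ofReal
  have m2 : AEMeasurable (fun x => ENNReal.ofReal (-g x)) := hm.neg.ennreal_ofReal
  have f1 : IsFiniteMeasure (volume.withDensity fun x => ENNReal.ofReal (g x)) :=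
    isFiniteMeasure_withDensity_ofReal hg.2
  have f2 : IsFiniteMeasure (volume.withDensity fun x => ENNReal.ofReal (-g x)) :=
    isFiniteMeasure_withDensity_ofReal hg.neg.2
  have hL : Continuous fun p : X × X => θ.toLinearMap₁₂ p.1 p.2 := by
    change Continuous fun p : X × X => θ p.1 p.2
    fun_prop
  have hi {u : X → ℝ} (hu : Integrable u) (a : X) :
      Integrable fun ξ => (ENNReal.ofReal (u ξ)).toReal •
        BoundedContinuousFunction.char Real.continuous_probChar hL a ξ := by
    have h1 : Integrable fun ξ => ((max (u ξ) 0 : ℝ) : ℂ) := hu.pos_part.ofReal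
    have h2 := h1.bdd_mul (c := 1)
      (BoundedContinuousFunction.char Real.continuous_probChar hL a).continuous.aestronglyMeasurable
      (.of_forall fun ξ => (Circle.norm_coe _).le)
    refine h2.congr (.of_forall fun ξ => ?_)
    simp only
    rw [ENNReal.toReal_ofReal', Complex.real_smul]
    exact mul_comm _ _
  have hP : (volume.withDensity fun x => ENNReal.ofReal (g x)) =
      volume.withDensity fun x => ENNReal.ofReal (-g x) := by
    refine ext_of_integral_char_eq Real.continuous_probChar Real.probChar_ne_one
      (L := θ.toLinearMap₁₂) ?_ hL fun a => ?_
    · intro ξ hξ h0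
      exact hθ ξ hξ (by ext x; exact congrArg (fun l : X →ₗ[ℝ] ℝ => l x) h0)
    · rw [integral_withDensity_eq_integral_toReal_smul₀ m1 (.of_forall fun x => by simp),
        integral_withDensity_eq_integral_toReal_smul₀ m2 (.of_forall fun x => by simp),
        ← sub_eq_zero, ← integral_sub]
      -- The characters here are `e^{+iθ}`, while `wave` carries a minus sign.
      · rw [← h (-a)]
        refine integral_congr_ae (.of_forall fun ξ => ?_)
        simp only [BoundedContinuousFunction.char_apply, ENNReal.toReal_ofReal']
        rw [← sub_smul, max_zero_sub_max_neg_zero_eq_self]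
        rw [Complex.real_smul, mul_comm, wave]
        congr 1
        change Complex.exp _ = _
        simp [mul_comm]
      · exact hi hg a
      · exact hi hg.neg a
  have := (withDensity_eq_iff m1 m2 ?_).1 hP
  · filter_upwards [this] with x hx
    have := congrArg ENNReal.toReal hx
    rw [ENNReal.toReal_ofReal', ENNReal.toReal_ofReal'] at this
    rw [Pi.zero_apply, ← max_zero_sub_max_neg_zero_eq_self (g x), this, sub_self]
  · exact (hg.lintegral_lt_top).ne

/-- Conjugating the hypothesis at `-a` shows that `conj G` also has vanishing transform. Hence so do
the real and imaginary parts. -/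
theorem ae_eq_zero_of_integral_wave_mul (hθ : ∀ ξ ≠ 0, θ ξ ≠ 0) {G : X → ℂ}
    (hG : Integrable G) (h : ∀ a, ∫ ξ, wave θ ξ a * G ξ = 0) : G =ᵐ[volume] 0 := by
  have hconj (a : X) : ∫ ξ, wave θ ξ a * conj (G ξ) = 0 := by
    rw [← map_zero conj, ← h (-a), ← integral_conj]
    refine integral_congr_ae (.of_forall fun ξ => ?_)
    simp only [map_mul]
    rw [wave, wave, ← Complex.exp_conj]
    simp
  have i1 := integrable_wave_mul (θ := θ) hG
  have i2 (a : X) : Integrable fun ξ => wave θ ξ a * conj (G ξ) :=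
    integrable_wave_mul (E := fun ξ => conj (G ξ))
      (Complex.conjCLE.toContinuousLinearMap.integrable_comp hG) a
  have hre := ae_eq_zero_of_integral_wave_mul_ofReal hθ hG.re fun a => by
    have : ∫ ξ, wave θ ξ a * (G ξ + conj (G ξ)) = 0 := by
      simp_rw [mul_add]
      rw [integral_add (i1 a) (i2 a), h, hconj, add_zero]
    simp_rw [Complex.add_conj] at this
    rw [← mul_eq_zero_iff_left (two_ne_zero (α := ℂ)), ← this, ← integral_const_mul]
    exact integral_congr_ae (.of_forall fun x => by simp; ring)
  have him := ae_eq_zero_of_integral_wave_mul_ofReal hθ hG.im fun a => by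
    have : ∫ ξ, wave θ ξ a * (G ξ - conj (G ξ)) = 0 := by
      simp_rw [mul_sub]
      rw [integral_sub (i1 a) (i2 a), h, hconj, sub_zero]
    simp_rw [Complex.sub_conj] at this
    rw [← mul_eq_zero_iff_left (mul_ne_zero (two_ne_zero (α := ℂ)) Complex.I_ne_zero), ← this,
      ← integral_const_mul]
    exact integral_congr_ae (.of_forall fun x => by simp; ring)
  filter_upwards [hre, him] with x h1 h2
  exact Complex.ext h1 h2

end Uniqueness

/-! ### Plancherel's identity for the kernels on the line and on the plane. -/

section Plancherel

open scoped FourierTransform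

theorem lintegral_enorm_sq_fourier {V : Type*} [NormedAddCommGroup V] [InnerProductSpace ℝ V]
    [FiniteDimensional ℝ V] [MeasurableSpace V] [BorelSpace V] {g : V → ℂ} (hg : ContDiff ℝ ∞ g)
    (hg' : HasCompactSupport g) : ∫⁻ ξ, ‖𝓕 g ξ‖ₑ ^ 2 = ∫⁻ x, ‖g x‖ₑ ^ 2 := by
  let f : SchwartzMap V ℂ := hg'.toSchwartzMap hg
  have h := SchwartzMap.norm_fourier_toL2_eq f
  have h1 := lintegral_enorm_sq ((𝓕 f).toLp 2)
  have h2 := lintegral_enorm_sq (f.toLp 2)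
  have h' : ‖(𝓕 f).toLp 2‖ₑ = ‖f.toLp 2‖ₑ := by rw [← ofReal_norm, h, ofReal_norm]
  rw [h', ← h2] at h1
  have e1 : ∫⁻ ξ, ‖(𝓕 f).toLp 2 volume ξ‖ₑ ^ 2 = ∫⁻ ξ, ‖𝓕 g ξ‖ₑ ^ 2 :=
    lintegral_congr_ae (((𝓕 f).coeFn_toLp 2 volume).mono fun x hx => by
      simp only [hx]
      rfl)
  have e2 : ∫⁻ ξ, ‖f.toLp 2 volume ξ‖ₑ ^ 2 = ∫⁻ ξ, ‖g ξ‖ₑ ^ 2 :=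
    lintegral_congr_ae ((f.coeFn_toLp 2 volume).mono fun x hx => by
      simp only [hx]
      rfl)
  rw [← e1, ← e2, h1]

theorem lintegral_comp_mul_left_of_pos {h : ℝ → ENNReal} (hh : Measurable h) {c : ℝ} (hc : 0 < c) :
    ∫⁻ x, h (c * x) = ENNReal.ofReal c⁻¹ * ∫⁻ x, h x := by
  have := Real.map_volume_mul_left hc.ne'
  rw [← lintegral_map hh (measurable_const_mul c), this, lintegral_smul_measure,
    abs_of_pos (inv_pos.2 hc), smul_eq_mul]

/-- A bilinear form `θ` for which `N ∫ e^{-i θ(ξ, x)} (·) dx` is isometric. -/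
structure IsFourierKernel {X : Type*} [NormedAddCommGroup X] [NormedSpace ℝ X] [MeasureSpace X]
    (N : ℝ) (θ : X →L[ℝ] X →L[ℝ] ℝ) : Prop where
  ne_zero : N ≠ 0
  nondegenerate : ∀ ξ ≠ 0, θ ξ ≠ 0
  plancherel : ∀ g : X → ℂ, ContDiff ℝ ∞ g → HasCompactSupport g →
    ∫⁻ ξ, ‖(N : ℂ) * ∫ x, wave θ ξ x * g x‖ₑ ^ 2 = ∫⁻ x, ‖g x‖ₑ ^ 2

/-- The form `(ξ, x) ↦ c ξ x` on `ℝ`. -/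
noncomputable def mulForm (c : ℝ) : ℝ →L[ℝ] ℝ →L[ℝ] ℝ := c • ContinuousLinearMap.mul ℝ ℝ

theorem mulForm_apply (c ξ x : ℝ) : mulForm c ξ x = c * (ξ * x) := rfl

/-- The dilation `ξ ↦ c ξ / 2π` reduces the kernel to that of `𝓕`; its Jacobian factor `2π / c` is
cancelled by `N²`. -/
theorem isFourierKernel_mulForm {c N : ℝ} (hc : 0 < c) (hN : N ^ 2 * (2 * Real.pi) = c) :
    IsFourierKernel N (mulForm c) := by
  have hN0 : N ≠ 0 := by rintro rfl; simp at hN; exact hc.ne hN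
  refine ⟨hN0, fun ξ hξ h => ?_, fun g hg hg' => ?_⟩
  · have := congrArg (fun l : ℝ →L[ℝ] ℝ => l 1) h
    simp [mulForm_apply, hc.ne', hξ] at this
  · have hF : Continuous (𝓕 g) := by
      exact (𝓕 (hg'.toSchwartzMap hg)).continuous
    have hk (ξ : ℝ) : ∫ x, wave (mulForm c) ξ x * g x = 𝓕 g ((c / (2 * Real.pi)) * ξ) := by
      rw [Real.fourier_real_eq_integral_exp_smul]
      refine integral_congr_ae (.of_forall fun x => ?_)
      simp only [wave, mulForm_apply, smul_eq_mul]
      congr 2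
      have := Real.pi_ne_zero
      push_cast
      field_simp
    simp_rw [hk, enorm_mul, mul_pow]
    rw [lintegral_const_mul' _ _ (by simp)]
    rw [lintegral_comp_mul_left_of_pos (h := fun ξ => ‖𝓕 g ξ‖ₑ ^ 2)
      (hF.measurable.enorm.pow_const 2)
      (by positivity), lintegral_enorm_sq_fourier hg hg', ← mul_assoc]
    have : ‖(N : ℂ)‖ₑ ^ 2 * ENNReal.ofReal (c / (2 * Real.pi))⁻¹ = 1 := by
      rw [← ofReal_norm, ← ENNReal.ofReal_pow (norm_nonneg _),
        ← ENNReal.ofReal_mul (by positivity), Complex.norm_real, Real.norm_eq_abs, sq_abs,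
        ← hN]
      have := Real.pi_ne_zero
      rw [← ENNReal.ofReal_one]
      congr 1
      field_simp
    rw [this, one_mul]

/-- The form `(ξ, x) ↦ c₁ ξ₁ x₁ + c₂ ξ₂ x₂` on `ℝ × ℝ`. -/
noncomputable def prodForm (c₁ c₂ : ℝ) : (ℝ × ℝ) →L[ℝ] (ℝ × ℝ) →L[ℝ] ℝ :=
  (mulForm c₁).bilinearComp (.fst ℝ ℝ ℝ) (.fst ℝ ℝ ℝ) +
    (mulForm c₂).bilinearComp (.snd ℝ ℝ ℝ) (.snd ℝ ℝ ℝ)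

theorem prodForm_apply (c₁ c₂ : ℝ) (ξ x : ℝ × ℝ) :
    prodForm c₁ c₂ ξ x = c₁ * (ξ.1 * x.1) + c₂ * (ξ.2 * x.2) := rfl

theorem isFourierKernel_prodForm {c₁ c₂ N : ℝ} (hc₁ : 0 < c₁) (hc₂ : 0 < c₂)
    (hN : N ^ 2 * (2 * Real.pi) ^ 2 = c₁ * c₂) : IsFourierKernel N (prodForm c₁ c₂) := by
  have hN0 : N ≠ 0 := by rintro rfl; simp at hN; rcases hN with h | h <;> linarith
  refine ⟨hN0, fun ξ hξ h => hξ ?_, fun g hg hg' => ?_⟩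
  · have h1 := congrArg (fun l : ℝ × ℝ →L[ℝ] ℝ => l (1, 0)) h
    have h2 := congrArg (fun l : ℝ × ℝ →L[ℝ] ℝ => l (0, 1)) h
    simp [prodForm_apply, hc₁.ne', hc₂.ne'] at h1 h2
    exact Prod.ext h1 h2
  -- The transform `𝓕` needs an inner product space, while `ℝ × ℝ` carries the maximum norm. The
  -- identification preserves volume.
  · let e := WithLp.prodContinuousLinearEquiv 2 ℝ ℝ ℝ
    have hg1 : ContDiff ℝ ∞ (g ∘ e) := hg.comp e.contDiff
    have hg2 : HasCompactSupport (g ∘ e) := hg'.comp_homeomorph e.toHomeomorph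
    let Φ : ℝ × ℝ → ℂ := fun p => 𝓕 (g ∘ e) (WithLp.toLp 2 p)
    have hΦ : Continuous Φ :=
      (𝓕 (hg2.toSchwartzMap hg1)).continuous.comp (WithLp.prod_continuous_toLp 2 ℝ ℝ)
    have hk (ξ : ℝ × ℝ) : ∫ x, wave (prodForm c₁ c₂) ξ x * g x =
        Φ ((c₁ / (2 * Real.pi)) * ξ.1, (c₂ / (2 * Real.pi)) * ξ.2) := by
      simp only [Φ]
      rw [Real.fourier_eq', ← (WithLp.volume_preserving_toLp (U := ℝ) (V := ℝ)).integral_comp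
        (MeasurableEquiv.toLp 2 (ℝ × ℝ)).measurableEmbedding]
      refine integral_congr_ae (.of_forall fun x => ?_)
      simp only [wave, prodForm_apply, smul_eq_mul]
      have hx : (g ∘ e) (WithLp.toLp 2 x) = g x := rfl
      rw [hx, WithLp.prod_inner_apply]
      congr 2
      have := Real.pi_ne_zero
      simp
      field_simp
    have hΦ2 : ∫⁻ p, ‖Φ p‖ₑ ^ 2 = ∫⁻ x, ‖g x‖ₑ ^ 2 := by
      have h := lintegral_enorm_sq_fourier hg1 hg2
      rw [← (WithLp.volume_preserving_toLp (U := ℝ) (V := ℝ)).lintegral_comp_emb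
        (MeasurableEquiv.toLp 2 (ℝ × ℝ)).measurableEmbedding,
        ← (WithLp.volume_preserving_toLp (U := ℝ) (V := ℝ)).lintegral_comp_emb
        (MeasurableEquiv.toLp 2 (ℝ × ℝ)).measurableEmbedding] at h
      exact h
    have hm1 : Measurable fun p => ‖Φ p‖ₑ ^ 2 := hΦ.measurable.enorm.pow_const 2
    have hm2 : Measurable fun ξ : ℝ × ℝ =>
        ‖Φ ((c₁ / (2 * Real.pi)) * ξ.1, (c₂ / (2 * Real.pi)) * ξ.2)‖ₑ ^ 2 :=
      hm1.comp (f := fun ξ : ℝ × ℝ =>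
        ((c₁ / (2 * Real.pi)) * ξ.1, (c₂ / (2 * Real.pi)) * ξ.2)) (by fun_prop)
    have hs : ∫⁻ ξ : ℝ × ℝ, ‖Φ ((c₁ / (2 * Real.pi)) * ξ.1, (c₂ / (2 * Real.pi)) * ξ.2)‖ₑ ^ 2 =
        ENNReal.ofReal (c₁ / (2 * Real.pi))⁻¹ * ENNReal.ofReal (c₂ / (2 * Real.pi))⁻¹ *
          ∫⁻ p, ‖Φ p‖ₑ ^ 2 := by
      rw [Measure.volume_eq_prod, lintegral_prod _ hm2.aemeasurable,
        lintegral_prod _ hm1.aemeasurable]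
      have h1 (a : ℝ) : ∫⁻ y, ‖Φ (a, (c₂ / (2 * Real.pi)) * y)‖ₑ ^ 2 =
          ENNReal.ofReal (c₂ / (2 * Real.pi))⁻¹ * ∫⁻ y, ‖Φ (a, y)‖ₑ ^ 2 :=
        lintegral_comp_mul_left_of_pos (h := fun y => ‖Φ (a, y)‖ₑ ^ 2)
          (hm1.comp measurable_prodMk_left)
          (by positivity)
      simp_rw [h1]
      have hm : Measurable fun a => ∫⁻ y, ‖Φ (a, y)‖ₑ ^ 2 :=
        hm1.lintegral_prod_right'
      rw [lintegral_const_mul' _ _ (by simp)]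
      rw [lintegral_comp_mul_left_of_pos (h := fun a => ∫⁻ y, ‖Φ (a, y)‖ₑ ^ 2) hm
        (by positivity)]
      ring
    simp_rw [hk, enorm_mul, mul_pow]
    rw [lintegral_const_mul _ hm2, hs, hΦ2, ← mul_assoc]
    have : ‖(N : ℂ)‖ₑ ^ 2 * (ENNReal.ofReal (c₁ / (2 * Real.pi))⁻¹ *
        ENNReal.ofReal (c₂ / (2 * Real.pi))⁻¹) = 1 := by
      rw [← ofReal_norm, ← ENNReal.ofReal_pow (norm_nonneg _),
        ← ENNReal.ofReal_mul (by positivity), ← ENNReal.ofReal_mul (by positivity),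
        Complex.norm_real, Real.norm_eq_abs, sq_abs, ← ENNReal.ofReal_one]
      have := Real.pi_ne_zero
      congr 1
      field_simp
      linear_combination hN
    rw [this, one_mul]

end Plancherel

end Kernel

/-! ### The rescaled Fourier transform as a unitary map -/

section RescaledFourier

open Filter Topology ComplexConjugate

/-- Multiplication by `w` is an isometry from `L²(ρ)` to `L²(ν)`, where `ν` lives on `Ω₁` and `w` is
smooth and does not vanish there. -/
structure IsRescaling (Ω₁ : Opens ℝ) (w : ℝ → ℝ) (ρ ν : Measure ℝ) : Prop where
  contDiffOn : ContDiffOn ℝ ∞ w Ω₁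
  measurable : Measurable w
  ne_zero : ∀ v ∈ Ω₁, w v ≠ 0
  ae_mem : ∀ᵐ v ∂ν, v ∈ Ω₁
  eq_withDensity : ρ = ν.withDensity fun v => ‖w v‖ₑ ^ 2

theorem IsRescaling.ae_mem_left {Ω₁ : Opens ℝ} {w : ℝ → ℝ} {ρ ν : Measure ℝ}
    (hw : IsRescaling Ω₁ w ρ ν) : ∀ᵐ v ∂ρ, v ∈ Ω₁ := by
  rw [hw.eq_withDensity]
  exact (withDensity_absolutelyContinuous _ _).ae_le hw.ae_mem

theorem ae_mem_prod {X : Type*} [MeasureSpace X] [TopologicalSpace X]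
    {Ω : Opens (X × ℝ)} {Ω₁ : Opens ℝ} (hΩ : ∀ p : X × ℝ, p ∈ Ω ↔ p.2 ∈ Ω₁) {ν : Measure ℝ}
    [SFinite ν] (hν : ∀ᵐ v ∂ν, v ∈ Ω₁) : ∀ᵐ p ∂(volume : Measure X).prod ν, p ∈ Ω := by
  simp_rw [hΩ]
  exact Measure.quasiMeasurePreserving_snd.ae hν

variable {X : Type*} [NormedAddCommGroup X] [NormedSpace ℝ X] [FiniteDimensional ℝ X]
  [MeasureSpace X] [BorelSpace X] [(volume : Measure X).IsAddHaarMeasure]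
  [SecondCountableTopology X]
  {Ω : Opens (X × ℝ)} {Ω₁ : Opens ℝ} (hΩ : ∀ p : X × ℝ, p ∈ Ω ↔ p.2 ∈ Ω₁)
  {w : ℝ → ℝ} {ρ ν : Measure ℝ} (hw : IsRescaling Ω₁ w ρ ν)
  {N : ℝ} {θ : X →L[ℝ] X →L[ℝ] ℝ}

variable (N θ) in
/-- Multiplication by `w`, followed by the partial Fourier transform at a fixed frequency. -/
noncomputable def rescaledFourier (ξ : X) : 𝓓(Ω, ℂ) →ₗ[ℂ] 𝓓(Ω₁, ℂ) :=
  mulBy w hw.contDiffOn ∘ₗ partialFourier hΩ N θ ξ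

omit [FiniteDimensional ℝ X] [SecondCountableTopology X] in
theorem rescaledFourier_apply (ξ : X) (η : 𝓓(Ω, ℂ)) (v : ℝ) :
    rescaledFourier hΩ hw N θ ξ η v = w v * (N * ∫ x, wave θ ξ x * η (x, v)) := by
  change w v • (N * ∫ x, wave θ ξ x * η (x, v) : ℂ) = _
  rw [Complex.real_smul]

omit [SecondCountableTopology X] in
theorem exists_rescaledFourier_eq_smul (hN : N ≠ 0) (f : 𝓓(Ω₁, ℂ)) :
    ∃ ζ : ℕ → 𝓓(Ω, ℂ), ∀ ξ, ∃ m, ∃ c : ℂ, c ≠ 0 ∧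
      rescaledFourier hΩ hw N θ ξ (ζ m) = c • f := by
  obtain ⟨ζ, hζ⟩ := exists_partialFourier_eq_smul (hΩ := hΩ) (θ := θ) hN
    (mulBy (fun v => (w v)⁻¹) (hw.contDiffOn.inv hw.ne_zero) f)
  refine ⟨ζ, fun ξ => ?_⟩
  obtain ⟨m, c, hc, h⟩ := hζ ξ
  refine ⟨m, c, hc, ?_⟩
  rw [rescaledFourier, LinearMap.comp_apply, h, map_smul]
  congr 1
  ext v
  change w v • (w v)⁻¹ • f v = f v
  by_cases hv : v ∈ Ω₁
  · rw [smul_inv_smul₀ (hw.ne_zero v hv)]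
  · rw [test_eq_zero hv, smul_zero, smul_zero]

theorem stronglyMeasurable_rescaledFourier (η : 𝓓(Ω, ℂ)) :
    StronglyMeasurable fun p : X × ℝ => rescaledFourier hΩ hw N θ p.1 η p.2 := by
  simp_rw [rescaledFourier_apply]
  have h1 : StronglyMeasurable fun p : X × ℝ => ∫ x, wave θ p.1 x * η (x, p.2) := by
    have : StronglyMeasurable (Function.uncurry fun (p : X × ℝ) (x : X) =>
        wave θ p.1 x * η (x, p.2)) := by
      refine Continuous.stronglyMeasurable ?_
      refine (continuous_wave.comp (g := fun p : X × X => wave θ p.1 p.2)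
        (f := fun q : (X × ℝ) × X => (q.1.1, q.2)) (by fun_prop)).mul ?_
      exact η.continuous.comp (by fun_prop)
    exact this.integral_prod_right
  have h2 : StronglyMeasurable fun p : X × ℝ => (w p.2 : ℂ) :=
    (Complex.measurable_ofReal.comp (hw.measurable.comp measurable_snd)).stronglyMeasurable
  exact h2.mul (stronglyMeasurable_const.mul h1)

variable [SFinite ρ] [SFinite ν] [IsFiniteMeasureOnCompacts ((volume : Measure X).prod ρ)]
  (hθ : IsFourierKernel N θ)

-- Plancherel at each fixed `v` leaves the factor `(w v)²`, which is the density of `ρ` with respect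
-- to `ν`.
include hθ in
theorem lintegral_rescaledFourier (η : 𝓓(Ω, ℂ)) :
    ∫⁻ p : X × ℝ, ‖rescaledFourier hΩ hw N θ p.1 η p.2‖ₑ ^ 2 ∂(volume : Measure X).prod ν =
      ‖testToLp ((volume : Measure X).prod ρ) η‖ₑ ^ 2 := by
  have hm : Measurable fun p : X × ℝ => ‖η p‖ₑ ^ 2 := η.continuous.measurable.enorm.pow_const 2
  have h2 : ‖testToLp ((volume : Measure X).prod ρ) η‖ₑ ^ 2 =
      ∫⁻ p, ‖η p‖ₑ ^ 2 ∂(volume : Measure X).prod ρ := by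
    rw [← lintegral_enorm_sq]
    exact lintegral_congr_ae ((coeFn_testToLp η).mono fun p hp => by simp only [hp])
  rw [h2, lintegral_prod_symm _ hm.aemeasurable, lintegral_prod_symm _
    ((stronglyMeasurable_rescaledFourier hΩ hw η).measurable.enorm.pow_const 2).aemeasurable]
  have h3 (v : ℝ) : ∫⁻ ξ, ‖rescaledFourier hΩ hw N θ ξ η v‖ₑ ^ 2 =
      ‖w v‖ₑ ^ 2 * ∫⁻ x, ‖η (x, v)‖ₑ ^ 2 := by
    simp_rw [rescaledFourier_apply, enorm_mul (w v : ℂ), mul_pow]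
    rw [lintegral_const_mul' _ _ (by simp), hθ.plancherel (fun x => η (x, v))
      (η.contDiff.comp (contDiff_id.prodMk contDiff_const)) (hasCompactSupport_test_fst η v)]
    congr 2
    rw [← ofReal_norm, ← ofReal_norm, Complex.norm_real]
  simp_rw [h3]
  conv_rhs => rw [hw.eq_withDensity]
  rw [lintegral_withDensity_eq_lintegral_mul _ (hw.measurable.enorm.pow_const 2)
    hm.lintegral_prod_left']
  rfl

include hθ in
theorem memLp_rescaledFourier (η : 𝓓(Ω, ℂ)) :
    MemLp (fun p : X × ℝ => rescaledFourier hΩ hw N θ p.1 η p.2) 2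
      ((volume : Measure X).prod ν) := by
  refine memLp_two_of_lintegral
    (stronglyMeasurable_rescaledFourier hΩ hw η).aestronglyMeasurable ?_
  rw [lintegral_rescaledFourier hΩ hw hθ (ρ := ρ)]
  simp

/-- The rescaled Fourier transform on test functions, with values in `L²`. -/
noncomputable def fourierToLp : 𝓓(Ω, ℂ) →ₗ[ℂ] Lp ℂ 2 ((volume : Measure X).prod ν) where
  toFun η := (memLp_rescaledFourier hΩ hw hθ η).toLp _
  map_add' η ζ := by
    rw [← MemLp.toLp_add]
    congr 1
    ext p
    rw [map_add]
    rfl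
  map_smul' c η := by
    rw [RingHom.id_apply, ← MemLp.toLp_const_smul]
    congr 1
    ext p
    rw [map_smul]
    rfl

theorem coeFn_fourierToLp (η : 𝓓(Ω, ℂ)) : fourierToLp hΩ hw hθ η =ᵐ[(volume : Measure X).prod ν]
    fun p => rescaledFourier hΩ hw N θ p.1 η p.2 :=
  (memLp_rescaledFourier hΩ hw hθ η).coeFn_toLp

theorem norm_fourierToLp (η : 𝓓(Ω, ℂ)) :
    ‖fourierToLp hΩ hw hθ η‖ = ‖testToLp ((volume : Measure X).prod ρ) η‖ := by
  have h : ‖fourierToLp hΩ hw hθ η‖ₑ ^ 2 = ‖testToLp ((volume : Measure X).prod ρ) η‖ₑ ^ 2 := by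
    rw [← lintegral_enorm_sq, ← lintegral_rescaledFourier hΩ hw hθ]
    exact lintegral_congr_ae ((coeFn_fourierToLp hΩ hw hθ η).mono fun p hp => by simp only [hp])
  have h' := congrArg ENNReal.toReal h
  simp only [ENNReal.toReal_pow, toReal_enorm] at h'
  exact (sq_eq_sq₀ (norm_nonneg _) (norm_nonneg _)).1 h'

variable [IsFiniteMeasureOnCompacts ν]

theorem ae_isFibre_fourierToLp (η : 𝓓(Ω, ℂ)) :
    ∀ᵐ ξ, IsFibre (fourierToLp hΩ hw hθ η) ξ (testToLp ν (rescaledFourier hΩ hw N θ ξ η)) := by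
  filter_upwards [Measure.ae_ae_of_ae_prod (coeFn_fourierToLp hΩ hw hθ η)] with ξ hξ
  exact EventuallyEq.trans hξ (coeFn_testToLp (rescaledFourier hΩ hw N θ ξ η)).symm

/-- Weak identities on test functions hold on the fibres. -/
theorem ae_inner_rescaledFourier {A : Module.End ℂ 𝓓(Ω, ℂ)} {T : X → Module.End ℂ 𝓓(Ω₁, ℂ)}
    (hT : ∀ ξ η, rescaledFourier hΩ hw N θ ξ (A η) = T ξ (rescaledFourier hΩ hw N θ ξ η))
    {Ψ χ : Lp ℂ 2 ((volume : Measure X).prod ν)}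
    (h : ∀ η, inner ℂ (fourierToLp hΩ hw hθ (A η)) Ψ = inner ℂ (fourierToLp hΩ hw hθ η) χ)
    (η : 𝓓(Ω, ℂ)) : ∀ᵐ ξ, ∀ f g : Lp ℂ 2 ν, IsFibre Ψ ξ f → IsFibre χ ξ g →
      inner ℂ (testToLp ν (T ξ (rescaledFourier hΩ hw N θ ξ η))) f =
        inner ℂ (testToLp ν (rescaledFourier hΩ hw N θ ξ η)) g := by
  let V := fourierToLp hΩ hw hθ
  -- The test function occupies the second slot, where the inner product is linear, so a translation
  -- multiplies `R` by the wave and not by its conjugate.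
  let R (ζ : 𝓓(Ω, ℂ)) (ξ : X) : ℂ :=
    (∫ y, inner ℂ (Ψ (ξ, y)) (V (A ζ) (ξ, y)) ∂ν) - ∫ y, inner ℂ (χ (ξ, y)) (V ζ (ξ, y)) ∂ν
  have hint (ζ : 𝓓(Ω, ℂ)) : Integrable (R ζ) :=
    (integrable_fibre_inner _ _).sub (integrable_fibre_inner _ _)
  have hR (ζ : 𝓓(Ω, ℂ)) : ∫ ξ, R ζ ξ = 0 := by
    rw [integral_sub (integrable_fibre_inner _ _) (integrable_fibre_inner _ _),
      ← inner_eq_integral_fibre, ← inner_eq_integral_fibre, ← inner_conj_symm,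
      ← inner_conj_symm χ, h, sub_self]
  have hRf (ζ : 𝓓(Ω, ℂ)) : ∀ᵐ ξ, ∀ f g : Lp ℂ 2 ν, IsFibre Ψ ξ f → IsFibre χ ξ g → R ζ ξ =
      inner ℂ f (testToLp ν (T ξ (rescaledFourier hΩ hw N θ ξ ζ))) -
        inner ℂ g (testToLp ν (rescaledFourier hΩ hw N θ ξ ζ)) := by
    filter_upwards [ae_isFibre_fourierToLp hΩ hw hθ ζ, ae_isFibre_fourierToLp hΩ hw hθ (A ζ)]
      with ξ h1 h2 f g hf hg
    rw [hT] at h2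
    simp only [R]
    rw [hf.inner_eq h2, hg.inner_eq h1]
  have h0 : R η =ᵐ[volume] 0 := by
    -- The Fourier integral of `R η` at `a` is the integral of `R` for the translate of `η` by `a`,
    -- which vanishes by the weak identity.
    refine ae_eq_zero_of_integral_wave_mul hθ.nondegenerate (hint η) fun a => ?_
    obtain ⟨ζ, hζ⟩ := exists_translate_test hΩ η a
    rw [← hR ζ]
    refine integral_congr_ae ?_
    filter_upwards [hRf η, hRf ζ, ae_exists_isFibre Ψ, ae_exists_isFibre χ]
      with ξ h1 h2 ⟨f, hf⟩ ⟨g, hg⟩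
    have e : rescaledFourier hΩ hw N θ ξ ζ = wave θ ξ a • rescaledFourier hΩ hw N θ ξ η := by
      rw [rescaledFourier, LinearMap.comp_apply, partialFourier_translate hζ, map_smul,
        LinearMap.comp_apply]
    rw [h1 f g hf hg, h2 f g hf hg, e, map_smul, map_smul, map_smul, inner_smul_right,
      inner_smul_right, mul_sub]
  filter_upwards [h0, hRf η] with ξ h1 h2 f g hf hg
  have := h2 f g hf hg
  rw [h1, Pi.zero_apply, eq_comm, sub_eq_zero] at this
  rw [← inner_conj_symm, this, inner_conj_symm]

/-- In `ae_inner_rescaledFourier` the function tested on the fibre varies with `ξ`. At each `ξ` some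
member of a countable family has transform `c • φ` with `c ≠ 0`, and `c` cancels. -/
theorem ae_inner_test {A : Module.End ℂ 𝓓(Ω, ℂ)} {T : X → Module.End ℂ 𝓓(Ω₁, ℂ)}
    (hT : ∀ ξ η, rescaledFourier hΩ hw N θ ξ (A η) = T ξ (rescaledFourier hΩ hw N θ ξ η))
    {Ψ χ : Lp ℂ 2 ((volume : Measure X).prod ν)}
    (h : ∀ η, inner ℂ (fourierToLp hΩ hw hθ (A η)) Ψ = inner ℂ (fourierToLp hΩ hw hθ η) χ)
    (φ : 𝓓(Ω₁, ℂ)) : ∀ᵐ ξ, ∀ f g : Lp ℂ 2 ν, IsFibre Ψ ξ f → IsFibre χ ξ g →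
      inner ℂ (testToLp ν (T ξ φ)) f = inner ℂ (testToLp ν φ) g := by
  obtain ⟨ζ, hζ⟩ := exists_rescaledFourier_eq_smul hΩ hw (θ := θ) hθ.ne_zero φ
  filter_upwards [ae_all_iff.2 fun m => ae_inner_rescaledFourier hΩ hw hθ hT h (ζ m)]
    with ξ hξ f g hf hg
  obtain ⟨m, c, hc, e⟩ := hζ ξ
  have := hξ m f g hf hg
  rw [e, map_smul, map_smul, map_smul, inner_smul_left, inner_smul_left] at this
  exact mul_left_cancel₀ (by simpa using hc) this

/-- The values of sections at a fixed frequency exhaust the graph of a differential expression. -/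
theorem exists_core (L₁ L₂ : Module.End ℂ 𝓓(Ω₁, ℂ)) : ∃ e : ℕ → 𝓓(Ω₁, ℂ), ∀ (b : ℂ) (f : 𝓓(Ω₁, ℂ)),
    (testToLp ν f, testToLp ν ((L₁ + b • L₂) f)) ∈
      closure (range fun n => (testToLp ν (e n), testToLp ν ((L₁ + b • L₂) (e n)))) := by
  have : SecondCountableTopology (Lp ℂ 2 ν) :=
    have : Fact ((2 : ENNReal) ≠ ⊤) := ⟨ENNReal.ofNat_ne_top⟩
    Lp.SecondCountableTopology
  -- Approximating `f`, `L₁ f` and `L₂ f` simultaneously makes one sequence serve every coefficient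
  -- `b`.
  let L (f : 𝓓(Ω₁, ℂ)) : Lp ℂ 2 ν × Lp ℂ 2 ν × Lp ℂ 2 ν :=
    (testToLp ν f, testToLp ν (L₁ f), testToLp ν (L₂ f))
  have hne : Nonempty (range L) := ⟨⟨L 0, 0, rfl⟩⟩
  choose e he using fun n => (denseSeq (range L) n).2
  refine ⟨e, fun b f => ?_⟩
  have h1 : L f ∈ closure (range fun n => L (e n)) := by
    have := (denseRange_denseSeq (range L)) ⟨L f, f, rfl⟩
    have h2 := image_closure_subset_closure_image continuous_subtype_val
      (mem_image_of_mem Subtype.val this)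
    rw [← range_comp] at h2
    convert h2 using 3
    ext1 n
    exact he n
  let Φ : Lp ℂ 2 ν × Lp ℂ 2 ν × Lp ℂ 2 ν → Lp ℂ 2 ν × Lp ℂ 2 ν :=
    fun p => (p.1, p.2.1 + b • p.2.2)
  have hΦ : Continuous Φ := by fun_prop
  have h3 := image_closure_subset_closure_image hΦ (mem_image_of_mem Φ h1)
  rw [← range_comp] at h3
  have hL (f : 𝓓(Ω₁, ℂ)) : Φ (L f) = (testToLp ν f, testToLp ν ((L₁ + b • L₂) f)) := by
    simp [Φ, L]
  have hr : (Φ ∘ fun n => L (e n)) =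
      fun n => (testToLp ν (e n), testToLp ν ((L₁ + b • L₂) (e n))) := funext fun n => hL (e n)
  rwa [hL, hr] at h3

/-- Orthogonality of `χ` to the range is a weak identity for the zero expressions with `Ψ = 0`. It
passes to the fibres of `χ`, which are then orthogonal to all test functions. -/
theorem dense_range_fourierToLp : DenseRange (fourierToLp hΩ hw hθ) := by
  change Dense (LinearMap.range (fourierToLp hΩ hw hθ) : Set (Lp ℂ 2 ((volume : Measure X).prod ν)))
  rw [Submodule.dense_iff_topologicalClosure_eq_top, Submodule.topologicalClosure_eq_top_iff,
    Submodule.eq_bot_iff]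
  intro χ hχ
  have h (η : 𝓓(Ω, ℂ)) : inner ℂ (fourierToLp hΩ hw hθ ((0 : Module.End ℂ 𝓓(Ω, ℂ)) η))
      (0 : Lp ℂ 2 ((volume : Measure X).prod ν)) = inner ℂ (fourierToLp hΩ hw hθ η) χ := by
    rw [inner_zero_right]
    exact ((Submodule.mem_orthogonal _ _).1 hχ _ ⟨η, rfl⟩).symm
  obtain ⟨e, he⟩ := exists_core (ν := ν) (0 : Module.End ℂ 𝓓(Ω₁, ℂ)) 0
  have key := fun n => ae_inner_test hΩ hw hθ (T := fun _ => 0) (by simp) h (e n)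
  refine eq_of_ae_isFibre ?_
  filter_upwards [ae_all_iff.2 key, ae_exists_isFibre χ, ae_isFibre_zero (X := X) (ν := ν)]
    with ξ hξ ⟨g, hg⟩ h0
  refine ⟨0, ?_, h0⟩
  have : g = 0 := by
    refine eq_zero_of_inner_testToLp hw.ae_mem fun φ => ?_
    have hcl : IsClosed {p : Lp ℂ 2 ν × Lp ℂ 2 ν | inner ℂ p.1 g = 0} :=
      isClosed_eq (by fun_prop) continuous_const
    refine closure_minimal (range_subset_iff.2 fun n => ?_) hcl (he 0 φ)
    have := hξ n 0 g h0 hg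
    rw [inner_zero_right] at this
    exact this.symm
  exact this ▸ hg

/-- The rescaled Fourier transform as a unitary map. -/
noncomputable def fourierUnitary :
    Lp ℂ 2 ((volume : Measure X).prod ρ) ≃ₗᵢ[ℂ] Lp ℂ 2 ((volume : Measure X).prod ν) :=
  (LinearEquiv.refl ℂ 𝓓(Ω, ℂ)).extendOfIsometry (testToLp _) (fourierToLp hΩ hw hθ)
    (dense_range_testToLp (ae_mem_prod hΩ hw.ae_mem_left)) (dense_range_fourierToLp hΩ hw hθ)
    (norm_fourierToLp hΩ hw hθ)

theorem fourierUnitary_testToLp (η : 𝓓(Ω, ℂ)) :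
    fourierUnitary hΩ hw hθ (testToLp _ η) = fourierToLp hΩ hw hθ η :=
  LinearEquiv.extendOfIsometry_eq _ _ _ _ _ _ η

theorem isRescaledFourier_fourierUnitary :
    IsRescaledFourier Ω w N (fun ξ x => θ ξ x) (fourierUnitary hΩ hw hθ) := by
  intro η
  rw [fourierUnitary_testToLp]
  filter_upwards [coeFn_fourierToLp hΩ hw hθ η] with p hp
  rw [hp, rescaledFourier_apply, mul_left_comm, ← integral_const_mul]
  congr 1
  exact integral_congr_ae (.of_forall fun x => by simp only [wave]; ring)

end RescaledFourier

/-! ### Relations transported by unitary maps and by affine changes of the operator -/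

section Transport

variable {H K : Type*} [NormedAddCommGroup H] [InnerProductSpace ℂ H]
  [NormedAddCommGroup K] [InnerProductSpace ℂ K]

/-- If `Γ` is the graph of `T`, then this is the graph of `c + σ T`, for `σ = ± 1`. -/
def shear (c σ : ℝ) (Γ : Submodule ℂ (H × H)) : Submodule ℂ (H × H) :=
  Γ.comap ((LinearMap.fst ℂ H H).prod
    ((σ : ℂ) • (LinearMap.snd ℂ H H - (c : ℂ) • LinearMap.fst ℂ H H)))

theorem mem_shear {c σ : ℝ} {Γ : Submodule ℂ (H × H)} {p : H × H} :
    p ∈ shear c σ Γ ↔ (p.1, (σ : ℂ) • (p.2 - (c : ℂ) • p.1)) ∈ Γ := Iff.rfl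

theorem ofReal_mul_self {σ : ℝ} (hσ : σ * σ = 1) : (σ : ℂ) * σ = 1 := by exact_mod_cast hσ

/-- The map of pairs which underlies `shear`, as a homeomorphism. -/
def shearHomeomorph (c : ℝ) {σ : ℝ} (hσ : σ * σ = 1) : H × H ≃ₜ H × H where
  toFun p := (p.1, (σ : ℂ) • (p.2 - (c : ℂ) • p.1))
  invFun p := (p.1, (c : ℂ) • p.1 + (σ : ℂ) • p.2)
  left_inv p := by simp [smul_smul, hσ]
  right_inv p := by simp [smul_smul, hσ]
  continuous_toFun := by fun_prop
  continuous_invFun := by fun_prop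

theorem coe_shear (c : ℝ) {σ : ℝ} (hσ : σ * σ = 1) (Γ : Submodule ℂ (H × H)) :
    (shear c σ Γ : Set (H × H)) = shearHomeomorph c hσ ⁻¹' Γ := rfl

theorem mem_shear_iff_exists {c σ : ℝ} (hσ : σ * σ = 1) {Γ : Submodule ℂ (H × H)} {p : H × H} :
    p ∈ shear c σ Γ ↔ ∃ q ∈ Γ, p = (q.1, (c : ℂ) • q.1 + (σ : ℂ) • q.2) := by
  constructor
  · exact fun h => ⟨_, h, ((shearHomeomorph c hσ).left_inv p).symm⟩
  · rintro ⟨q, hq, rfl⟩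
    have h : ((q.1, (σ : ℂ) • ((c : ℂ) • q.1 + (σ : ℂ) • q.2 - (c : ℂ) • q.1)) : H × H) = q :=
      (shearHomeomorph c hσ).right_inv q
    rw [mem_shear, h]
    exact hq

theorem shear_inj {c σ : ℝ} (hσ : σ * σ = 1) {Γ Γ' : Submodule ℂ (H × H)} :
    shear c σ Γ = shear c σ Γ' ↔ Γ = Γ' := by
  refine ⟨fun h => ?_, fun h => h ▸ rfl⟩
  have := congrArg (fun S : Submodule ℂ (H × H) => (S : Set (H × H))) h
  simp only [coe_shear c hσ] at this
  exact SetLike.coe_injective ((shearHomeomorph c hσ).surjective.preimage_injective this)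

/-- The coefficients are real, so they move across the inner product unchanged, and `σ² = 1` allows
division by `σ`. -/
theorem adjoint_shear {c σ : ℝ} (hσ : σ * σ = 1) (Γ : Submodule ℂ (H × H)) :
    (shear c σ Γ).adjoint = shear c σ Γ.adjoint := by
  have hσ' := ofReal_mul_self hσ
  have key (q x : H × H) : inner ℂ ((c : ℂ) • q.1 + (σ : ℂ) • q.2) x.1 = inner ℂ q.1 x.2 ↔
      inner ℂ q.2 x.1 = inner ℂ q.1 ((σ : ℂ) • (x.2 - (c : ℂ) • x.1)) := by
    rw [inner_add_left, inner_smul_left, inner_smul_left, inner_smul_right, inner_sub_right,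
      inner_smul_right, Complex.conj_ofReal, Complex.conj_ofReal]
    constructor <;> intro h
    · linear_combination (σ : ℂ) * h - (inner ℂ q.2 x.1) * hσ'
    · linear_combination (σ : ℂ) * h + (inner ℂ q.1 x.2 - c * inner ℂ q.1 x.1) * hσ'
  ext x
  rw [mem_adjoint, mem_shear, mem_adjoint]
  constructor
  · exact fun h q hq => (key q x).1 (h _ ((mem_shear_iff_exists hσ).2 ⟨q, hq, rfl⟩))
  · intro h p hp
    obtain ⟨q, hq, rfl⟩ := (mem_shear_iff_exists hσ).1 hp
    exact (key q x).2 (h q hq)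

/-- The inverse image of a relation under a unitary map. -/
def comapUnitary (U : H ≃ₗᵢ[ℂ] K) (Γ : Submodule ℂ (K × K)) : Submodule ℂ (H × H) :=
  Γ.comap (U.toLinearEquiv.toLinearMap.prodMap U.toLinearEquiv.toLinearMap)

theorem mem_comapUnitary {U : H ≃ₗᵢ[ℂ] K} {Γ : Submodule ℂ (K × K)} {p : H × H} :
    p ∈ comapUnitary U Γ ↔ (U p.1, U p.2) ∈ Γ := Iff.rfl

theorem comapUnitary_inj {U : H ≃ₗᵢ[ℂ] K} {Γ Γ' : Submodule ℂ (K × K)} :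
    comapUnitary U Γ = comapUnitary U Γ' ↔ Γ = Γ' := by
  refine ⟨fun h => ?_, fun h => h ▸ rfl⟩
  ext p
  have := SetLike.ext_iff.1 h (U.symm p.1, U.symm p.2)
  simpa [mem_comapUnitary] using this

theorem adjoint_comapUnitary {U : H ≃ₗᵢ[ℂ] K} (Γ : Submodule ℂ (K × K)) :
    (comapUnitary U Γ).adjoint = comapUnitary U Γ.adjoint := by
  ext x
  rw [mem_adjoint, mem_comapUnitary, mem_adjoint]
  constructor
  · intro h p hp
    have := h (U.symm p.1, U.symm p.2) (by simpa [mem_comapUnitary] using hp)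
    rw [← U.inner_map_map, ← U.inner_map_map (U.symm p.1)] at this
    simpa using this
  · intro h p hp
    have := h _ hp
    simpa using this

theorem isClosed_comapUnitary {U : H ≃ₗᵢ[ℂ] K} {Γ : Submodule ℂ (K × K)}
    (hΓ : IsClosed (Γ : Set (K × K))) : IsClosed (comapUnitary U Γ : Set (H × H)) :=
  hΓ.preimage (U.continuous.prodMap U.continuous)

end Transport

/-! ### Differential expressions which act fibrewise -/

section Fibred

open Filter Topology

theorem mem_pullback {X : Type*} [MeasureSpace X] {ρ ν : Measure ℝ} [SFinite ν]
    {U : Lp ℂ 2 ((volume : Measure X).prod ρ) ≃ₗᵢ[ℂ] Lp ℂ 2 ((volume : Measure X).prod ν)}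
    {S : X → Submodule ℂ (Lp ℂ 2 ν)} {Ψ : Lp ℂ 2 ((volume : Measure X).prod ρ)} :
    Ψ ∈ pullback U S ↔ ∀ᵐ ξ, ∃ f ∈ S ξ, IsFibre (U Ψ) ξ f := Iff.rfl

/-- The shear is a preimage under a homeomorphism, so generating sections are carried along by its
inverse, measurably because `c` is measurable. -/
theorem IsMeasurableClosedRelationField.shear {X : Type*} [MeasureSpace X] {ν : Measure ℝ}
    {K : X → Submodule ℂ (Lp ℂ 2 ν × Lp ℂ 2 ν)} (hK : IsMeasurableClosedRelationField K)
    {c : X → ℝ} (hc : Measurable c) {σ : ℝ} (hσ : σ * σ = 1) :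
    IsMeasurableClosedRelationField fun x => shear (c x) σ (K x) := by
  obtain ⟨s, hs, hsK⟩ := hK
  refine ⟨fun n x => (shearHomeomorph (c x) hσ).symm (s n x), fun n => ?_, ?_⟩
  · have hc' : StronglyMeasurable fun x => (c x : ℂ) :=
      (Complex.measurable_ofReal.comp hc).stronglyMeasurable
    exact (hs n).fst.prodMk ((hc'.smul (hs n).fst).add ((hs n).snd.const_smul (σ : ℂ)))
  · filter_upwards [hsK] with x hx
    rw [coe_shear (c x) hσ, hx, (shearHomeomorph (c x) hσ).preimage_closure,
      ← Homeomorph.image_symm, ← range_comp]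
    rfl

variable {X : Type*} [NormedAddCommGroup X] [NormedSpace ℝ X] [MeasureSpace X] [BorelSpace X]
  [SecondCountableTopology X] {Ω : Opens (X × ℝ)} {Ω₁ : Opens ℝ} {ρ ν : Measure ℝ}
  [SFinite ν] [IsFiniteMeasureOnCompacts ((volume : Measure X).prod ρ)]
  [IsFiniteMeasureOnCompacts ν]

/-- The unitary map `U` carries the differential expression `A` to `c(ξ) + σ B(ξ)` on the fibres,
`σ = ± 1`. -/
structure IsFibred
    (U : Lp ℂ 2 ((volume : Measure X).prod ρ) ≃ₗᵢ[ℂ] Lp ℂ 2 ((volume : Measure X).prod ν))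
    (A : Module.End ℂ 𝓓(Ω, ℂ)) (B : X → Module.End ℂ 𝓓(Ω₁, ℂ)) (c : X → ℝ) (σ : ℝ) : Prop where
  ae_mem : ∀ᵐ p ∂(volume : Measure X).prod ρ, p ∈ Ω
  ae_mem_fibre : ∀ᵐ v ∂ν, v ∈ Ω₁
  symmetric : IsFormallySymmetric ((volume : Measure X).prod ρ) A
  symmetric_fibre : ∀ ξ, IsFormallySymmetric ν (B ξ)
  measurable : Measurable c
  mul_self : σ * σ = 1
  field : IsMeasurableClosedRelationField fun ξ => (minimalGraph ν (B ξ)).topologicalClosure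
  adjoint : (minimalGraph ((volume : Measure X).prod ρ) A).adjoint =
    comapUnitary U (directIntegral fun ξ => shear (c ξ) σ (minimalGraph ν (B ξ)).adjoint)

variable {U : Lp ℂ 2 ((volume : Measure X).prod ρ) ≃ₗᵢ[ℂ] Lp ℂ 2 ((volume : Measure X).prod ν)}
  {A : Module.End ℂ 𝓓(Ω, ℂ)} {B : X → Module.End ℂ 𝓓(Ω₁, ℂ)} {c : X → ℝ} {σ : ℝ}
  [FiniteDimensional ℝ X]

omit [SecondCountableTopology X] in
theorem IsFibred.mem_graph_maximalOp (h : IsFibred U A B c σ)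
    {P : Lp ℂ 2 ((volume : Measure X).prod ρ) × Lp ℂ 2 ((volume : Measure X).prod ρ)} :
    P ∈ (maximalOp ((volume : Measure X).prod ρ) A).graph ↔
      ∀ᵐ ξ, ∃ p ∈ (maximalOp ν (B ξ)).graph, IsFibre (U P.1) ξ p.1 ∧
        IsFibre (U P.2) ξ ((c ξ : ℂ) • p.1 + (σ : ℂ) • p.2) := by
  rw [graph_maximalOp h.ae_mem h.symmetric, h.adjoint, mem_comapUnitary, mem_directIntegral]
  refine eventually_congr (.of_forall fun ξ => ?_)
  rw [graph_maximalOp h.ae_mem_fibre (h.symmetric_fibre ξ)]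
  constructor
  · rintro ⟨p, hp, h1, h2⟩
    obtain ⟨q, hq, rfl⟩ := (mem_shear_iff_exists h.mul_self).1 hp
    exact ⟨q, hq, h1, h2⟩
  · rintro ⟨q, hq, h1, h2⟩
    exact ⟨_, (mem_shear_iff_exists h.mul_self).2 ⟨q, hq, rfl⟩, h1, h2⟩

omit [SecondCountableTopology X] in
theorem IsFibred.graph_domRestrict (h : IsFibred U A B c σ) (S : X → Submodule ℂ (Lp ℂ 2 ν)) :
    ((maximalOp ((volume : Measure X).prod ρ) A).domRestrict (pullback U S)).graph =
      comapUnitary U (directIntegral fun ξ =>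
        shear (c ξ) σ ((maximalOp ν (B ξ)).domRestrict (S ξ)).graph) := by
  ext P
  rw [mem_graph_domRestrict, h.mem_graph_maximalOp, mem_pullback, ← eventually_and,
    mem_comapUnitary, mem_directIntegral]
  refine eventually_congr (.of_forall fun ξ => ?_)
  constructor
  · rintro ⟨⟨q, hq, h1, h2⟩, f, hf, h3⟩
    have hqf : q.1 = f := h1.unique h3
    exact ⟨_, (mem_shear_iff_exists h.mul_self).2
      ⟨q, mem_graph_domRestrict.2 ⟨hq, hqf ▸ hf⟩, rfl⟩, h1, h2⟩
  · rintro ⟨p, hp, h1, h2⟩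
    obtain ⟨q, hq, rfl⟩ := (mem_shear_iff_exists h.mul_self).1 hp
    obtain ⟨h3, h4⟩ := mem_graph_domRestrict.1 hq
    exact ⟨⟨q, h3, h1, h2⟩, q.1, h4, h1⟩

variable [SigmaFinite (volume : Measure X)]

omit [SecondCountableTopology X] in
theorem IsFibred.isSelfAdjoint_iff (h : IsFibred U A B c σ) {S : X → Submodule ℂ (Lp ℂ 2 ν)}
    (hS : IsMeasurableClosedField fun ξ => (maximalOp ν (B ξ)).domRestrict (S ξ)) :
    IsSelfAdjoint ((maximalOp ((volume : Measure X).prod ρ) A).domRestrict (pullback U S)) ↔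
      ∀ᵐ ξ, IsSelfAdjoint ((maximalOp ν (B ξ)).domRestrict (S ξ)) := by
  have hK : IsMeasurableClosedRelationField fun ξ =>
    ((maximalOp ν (B ξ)).domRestrict (S ξ)).graph := hS
  rw [isSelfAdjoint_iff_graph, h.graph_domRestrict, adjoint_comapUnitary, comapUnitary_inj,
    directIntegral_selfAdjoint_iff (hK.shear h.measurable h.mul_self)]
  refine eventually_congr (.of_forall fun ξ => ?_)
  rw [adjoint_shear h.mul_self, shear_inj h.mul_self, isSelfAdjoint_iff_graph]

-- The point is that the closed minimal graph of `A` is the direct integral of the sheared fibre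
-- closures. Both relations are closed and have the same adjoint, and a closed relation equals its
-- double adjoint.
omit [SecondCountableTopology X] in
theorem IsFibred.isEssentiallySelfAdjoint_iff (h : IsFibred U A B c σ) :
    IsEssentiallySelfAdjoint (minimalOp ((volume : Measure X).prod ρ) A) ↔
      ∀ᵐ ξ, IsEssentiallySelfAdjoint (minimalOp ν (B ξ)) := by
  let K : X → Submodule ℂ (Lp ℂ 2 ν × Lp ℂ 2 ν) := fun ξ =>
    shear (c ξ) σ (minimalGraph ν (B ξ)).topologicalClosure
  have hK : IsMeasurableClosedRelationField K := h.field.shear h.measurable h.mul_self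
  have hKc : ∀ ξ, IsClosed (K ξ : Set (Lp ℂ 2 ν × Lp ℂ 2 ν)) := fun ξ =>
    (Submodule.isClosed_topologicalClosure _).preimage
      (shearHomeomorph (c ξ) h.mul_self).continuous
  have hadj : (minimalGraph ((volume : Measure X).prod ρ) A).adjoint =
      (comapUnitary U (directIntegral K)).adjoint := by
    rw [h.adjoint, adjoint_comapUnitary, adjoint_directIntegral hK]
    congr 2
    ext1 ξ
    rw [adjoint_shear h.mul_self, adjoint_topologicalClosure]
  have hcl : (minimalGraph ((volume : Measure X).prod ρ) A).topologicalClosure =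
      comapUnitary U (directIntegral K) := by
    rw [← adjoint_adjoint_of_isClosed (Submodule.isClosed_topologicalClosure _),
      adjoint_topologicalClosure, hadj, adjoint_adjoint_of_isClosed
      (isClosed_comapUnitary (isClosed_directIntegral (.of_forall hKc)))]
  rw [isEssentiallySelfAdjoint_minimalOp_iff h.ae_mem h.symmetric, hcl, hadj,
    adjoint_comapUnitary, comapUnitary_inj, directIntegral_selfAdjoint_iff hK]
  refine eventually_congr (.of_forall fun ξ => ?_)
  rw [isEssentiallySelfAdjoint_minimalOp_iff h.ae_mem_fibre (h.symmetric_fibre ξ),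
    adjoint_shear h.mul_self, shear_inj h.mul_self, adjoint_topologicalClosure]

end Fibred

/-! ### Affine families of fibre expressions are decomposed by the Fourier transform. -/

section FibredFourier

open Filter Topology

variable {X : Type*} [NormedAddCommGroup X] [NormedSpace ℝ X] [FiniteDimensional ℝ X]
  [MeasureSpace X] [BorelSpace X] [(volume : Measure X).IsAddHaarMeasure]
  [SecondCountableTopology X]
  {Ω : Opens (X × ℝ)} {Ω₁ : Opens ℝ} (hΩ : ∀ p : X × ℝ, p ∈ Ω ↔ p.2 ∈ Ω₁)
  {w : ℝ → ℝ} {ρ ν : Measure ℝ} (hw : IsRescaling Ω₁ w ρ ν)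
  {N : ℝ} {θ : X →L[ℝ] X →L[ℝ] ℝ} (hθ : IsFourierKernel N θ)
  [SFinite ρ] [SFinite ν] [IsFiniteMeasureOnCompacts ((volume : Measure X).prod ρ)]
  [IsFiniteMeasureOnCompacts ν]

/-- Because only the coefficient `b ξ` varies, the sequence from `exists_core` is a core for every
`B ξ`: it reduces the fibrewise weak identities to countably many and also witnesses measurability
of the closed minimal field. -/
theorem isFibred_fourierUnitary {A : Module.End ℂ 𝓓(Ω, ℂ)} {B : X → Module.End ℂ 𝓓(Ω₁, ℂ)}
    {c : X → ℝ} {σ : ℝ} (hB : ∀ ξ, IsFormallySymmetric ν (B ξ)) {L₁ L₂ : Module.End ℂ 𝓓(Ω₁, ℂ)}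
    {b : X → ℂ} (hb : Measurable b) (hBL : ∀ ξ, B ξ = L₁ + b ξ • L₂) (hc : Measurable c)
    (hσ : σ * σ = 1) (hA : ∀ ξ η, rescaledFourier hΩ hw N θ ξ (A η) =
      (c ξ : ℂ) • rescaledFourier hΩ hw N θ ξ η +
        (σ : ℂ) • B ξ (rescaledFourier hΩ hw N θ ξ η)) :
    IsFibred (fourierUnitary hΩ hw hθ) A B c σ := by
  have hσ' := ofReal_mul_self hσ
  let T : X → Module.End ℂ 𝓓(Ω₁, ℂ) := fun ξ => (c ξ : ℂ) • 1 + (σ : ℂ) • B ξ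
  have hT (ξ : X) (η : 𝓓(Ω, ℂ)) :
      rescaledFourier hΩ hw N θ ξ (A η) = T ξ (rescaledFourier hΩ hw N θ ξ η) := hA ξ η
  have hTin (ξ : X) (φ : 𝓓(Ω₁, ℂ)) (f : Lp ℂ 2 ν) : inner ℂ (testToLp ν (T ξ φ)) f =
      c ξ * inner ℂ (testToLp ν φ) f + σ * inner ℂ (testToLp ν (B ξ φ)) f := by
    change inner ℂ (testToLp ν ((c ξ : ℂ) • φ + (σ : ℂ) • B ξ φ)) f = _
    rw [map_add, map_smul, map_smul, inner_add_left, inner_smul_left, inner_smul_left,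
      Complex.conj_ofReal, Complex.conj_ofReal]
  have hmem (P : Lp ℂ 2 ((volume : Measure X).prod ρ) × Lp ℂ 2 ((volume : Measure X).prod ρ)) :
      P ∈ (minimalGraph ((volume : Measure X).prod ρ) A).adjoint ↔
        ∀ η, inner ℂ (fourierToLp hΩ hw hθ (A η)) (fourierUnitary hΩ hw hθ P.1) =
          inner ℂ (fourierToLp hΩ hw hθ η) (fourierUnitary hΩ hw hθ P.2) := by
    rw [mem_adjoint_minimalGraph]
    simp_rw [← fourierUnitary_testToLp, LinearIsometryEquiv.inner_map_map]
  obtain ⟨e, he⟩ := exists_core (ν := ν) L₁ L₂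
  have hadj : (minimalGraph ((volume : Measure X).prod ρ) A).adjoint =
      comapUnitary (fourierUnitary hΩ hw hθ)
        (directIntegral fun ξ => shear (c ξ) σ (minimalGraph ν (B ξ)).adjoint) := by
    ext P
    rw [hmem, mem_comapUnitary, mem_directIntegral]
    constructor
    · intro h
      filter_upwards [ae_all_iff.2 fun n => ae_inner_test hΩ hw hθ hT h (e n),
        ae_exists_isFibre (fourierUnitary hΩ hw hθ P.1),
        ae_exists_isFibre (fourierUnitary hΩ hw hθ P.2)] with ξ hξ ⟨f, hf⟩ ⟨g, hg⟩
      refine ⟨(f, g), ?_, hf, hg⟩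
      rw [mem_shear]
      refine mem_adjoint_of_closure
        (s := range fun n => (testToLp ν (e n), testToLp ν (B ξ (e n)))) ?_ ?_
      · rintro _ ⟨φ, rfl⟩
        simp_rw [hBL ξ]
        exact he (b ξ) φ
      · rintro _ ⟨n, rfl⟩
        have := hξ n f g hf hg
        rw [hTin] at this
        simp only [inner_smul_right, inner_sub_right]
        linear_combination (σ : ℂ) * this - inner ℂ (testToLp ν (B ξ (e n))) f * hσ'
    · intro h η
      rw [inner_eq_integral_fibre, inner_eq_integral_fibre]
      refine integral_congr_ae ?_
      filter_upwards [h, ae_isFibre_fourierToLp hΩ hw hθ η,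
        ae_isFibre_fourierToLp hΩ hw hθ (A η)] with ξ ⟨p, hp, p1, p2⟩ h1 h2
      rw [h2.inner_eq p1, h1.inner_eq p2, hT, hTin]
      have := mem_adjoint_minimalGraph.1 (mem_shear.1 hp) (rescaledFourier hΩ hw N θ ξ η)
      simp only [inner_smul_right, inner_sub_right] at this
      linear_combination (σ : ℂ) * this + (inner ℂ (testToLp ν (rescaledFourier hΩ hw N θ ξ η)) p.2
        - c ξ * inner ℂ (testToLp ν (rescaledFourier hΩ hw N θ ξ η)) p.1) * hσ'
  refine ⟨ae_mem_prod hΩ hw.ae_mem_left, hw.ae_mem, fun η ζ => ?_, hB, hc, hσ, ?_, hadj⟩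
  -- Formal symmetry of `A` is inherited from the fibres, so no integration by parts on the product
  -- is needed.
  · suffices h : (testToLp ((volume : Measure X).prod ρ) ζ, testToLp _ (A ζ)) ∈
        (minimalGraph ((volume : Measure X).prod ρ) A).adjoint from mem_adjoint_minimalGraph.1 h η
    rw [hadj, mem_comapUnitary, mem_directIntegral]
    simp only [fourierUnitary_testToLp]
    filter_upwards [ae_isFibre_fourierToLp hΩ hw hθ ζ,
      ae_isFibre_fourierToLp hΩ hw hθ (A ζ)] with ξ h1 h2
    refine ⟨_, (mem_shear_iff_exists hσ).2 ⟨_, (hB ξ).le_adjoint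
      ⟨rescaledFourier hΩ hw N θ ξ ζ, rfl⟩, rfl⟩, h1, ?_⟩
    rw [hA, map_add, map_smul, map_smul] at h2
    exact h2
  · refine ⟨fun n ξ => (testToLp ν (e n), testToLp ν (B ξ (e n))), fun n => ?_,
      .of_forall fun ξ => ?_⟩
    · have : (fun ξ => testToLp ν (B ξ (e n))) =
          fun ξ => testToLp ν (L₁ (e n)) + b ξ • testToLp ν (L₂ (e n)) := by
        ext1 ξ
        rw [hBL, ← map_smul, ← map_add]
        rfl
      refine stronglyMeasurable_const.prodMk ?_
      rw [this]
      exact stronglyMeasurable_const.add (hb.stronglyMeasurable.smul stronglyMeasurable_const)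
    · rw [Submodule.topologicalClosure_coe]
      refine subset_antisymm (closure_minimal ?_ isClosed_closure) (closure_mono ?_)
      · rintro _ ⟨φ, rfl⟩
        simp_rw [hBL ξ]
        exact he (b ξ) φ
      · rintro _ ⟨n, rfl⟩
        exact ⟨e n, rfl⟩

end FibredFourier

/-! ### The rescaled Fourier transform intertwines the differential expressions -/

section Intertwining

open Filter Topology

theorem mem_posPart_iff {X : Type*} [TopologicalSpace X] (p : X × ℝ) :
    p ∈ posPart X ↔ p.2 ∈ posLine := Iff.rfl

theorem mem_top_iff_snd {X : Type*} [TopologicalSpace X] (p : X × ℝ) :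
    p ∈ (⊤ : Opens (X × ℝ)) ↔ p.2 ∈ (⊤ : Opens ℝ) := Iff.rfl

theorem isRescaling_sqrt : IsRescaling posLine Real.sqrt halfLineV halfLine where
  contDiffOn v hv := (Real.contDiffAt_sqrt (ne_of_gt hv)).contDiffWithinAt
  measurable := Real.continuous_sqrt.measurable
  ne_zero v hv := (Real.sqrt_pos.2 hv).ne'
  ae_mem := ae_restrict_mem measurableSet_Ioi
  eq_withDensity := by
    refine withDensity_congr_ae ?_
    filter_upwards [ae_restrict_mem measurableSet_Ioi] with v hv
    rw [Real.enorm_of_nonneg (Real.sqrt_nonneg v), ← ENNReal.ofReal_pow (Real.sqrt_nonneg v),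
      Real.sq_sqrt (le_of_lt hv)]

theorem isRescaling_one : IsRescaling ⊤ (fun _ => 1) volume volume where
  contDiffOn := contDiffOn_const
  measurable := measurable_const
  ne_zero _ _ := one_ne_zero
  ae_mem := .of_forall fun _ => trivial
  eq_withDensity := by simp

variable {X : Type*} [NormedAddCommGroup X] [NormedSpace ℝ X] [FiniteDimensional ℝ X]
  [MeasureSpace X] [BorelSpace X] [(volume : Measure X).IsAddHaarMeasure]
  {Ω : Opens (X × ℝ)} {Ω₁ : Opens ℝ} (hΩ : ∀ p : X × ℝ, p ∈ Ω ↔ p.2 ∈ Ω₁)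
  {w : ℝ → ℝ} {ρ ν : Measure ℝ} (hw : IsRescaling Ω₁ w ρ ν)
  {N : ℝ} {θ : X →L[ℝ] X →L[ℝ] ℝ}

theorem rescaledFourier_pd_fst (ξ y : X) (η : 𝓓(Ω, ℂ)) :
    rescaledFourier hΩ hw N θ ξ (pd Ω (y, 0) η) =
      (Complex.I * θ ξ y) • rescaledFourier hΩ hw N θ ξ η := by
  rw [rescaledFourier, LinearMap.comp_apply, partialFourier_pd_fst, map_smul]
  rfl

omit [FiniteDimensional ℝ X] in
theorem rescaledFourier_mulBy {c : ℝ → ℝ} (hc : ContDiffOn ℝ ∞ c Ω₁)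
    (hc' : ContDiffOn ℝ ∞ (fun p : X × ℝ => c p.2) Ω) (ξ : X) (η : 𝓓(Ω, ℂ)) :
    rescaledFourier hΩ hw N θ ξ (mulBy (fun p : X × ℝ => c p.2) hc' η) =
      mulBy c hc (rescaledFourier hΩ hw N θ ξ η) := by
  rw [rescaledFourier, LinearMap.comp_apply, partialFourier_mulBy hc hc']
  ext v
  exact smul_comm _ _ _

omit [FiniteDimensional ℝ X] in
theorem rescaledFourier_one_pd_snd {hΩ : ∀ p : X × ℝ, p ∈ Ω ↔ p.2 ∈ (⊤ : Opens ℝ)} (ξ : X)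
    (η : 𝓓(Ω, ℂ)) : rescaledFourier hΩ isRescaling_one N θ ξ (pd Ω (0, 1) η) =
      pd ⊤ 1 (rescaledFourier hΩ isRescaling_one N θ ξ η) := by
  have h (η : 𝓓(Ω, ℂ)) :
      rescaledFourier hΩ isRescaling_one N θ ξ η = partialFourier hΩ N θ ξ η := by
    ext v
    exact one_smul ℝ _
  rw [h, h, partialFourier_pd_snd]

/-- Conjugation with `v^{1/2}` turns `∂² + v⁻¹ ∂` into `∂² + 1/(4 v²)`. -/
theorem mulBy_sqrt_laplacian (f : 𝓓(posLine, ℂ)) :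
    mulBy Real.sqrt isRescaling_sqrt.contDiffOn (pd posLine 1 (pd posLine 1 f)) +
        mulBy Real.sqrt isRescaling_sqrt.contDiffOn (invPow 1 (pd posLine 1 f)) =
      pd posLine 1 (pd posLine 1 (mulBy Real.sqrt isRescaling_sqrt.contDiffOn f)) +
        (1 / 4 : ℂ) • invPow 2 (mulBy Real.sqrt isRescaling_sqrt.contDiffOn f) := by
  set g := mulBy Real.sqrt isRescaling_sqrt.contDiffOn f with hg
  have hgv (v : ℝ) : g v = (√v : ℂ) * f v := Complex.real_smul
  ext v
  change √v • pd posLine 1 (pd posLine 1 f) v + √v • ((v ^ 1)⁻¹ • pd posLine 1 f v) =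
    pd posLine 1 (pd posLine 1 g) v + (1 / 4 : ℂ) * ((v ^ 2)⁻¹ • g v)
  by_cases hv : v ∈ posLine
  · have hsqrt (x : ℝ) (hx : x ∈ posLine) :
        HasDerivAt (fun x : ℝ => (√x : ℂ)) ((√x : ℂ) * (2 * x : ℂ)⁻¹) x := by
      have hx' : 0 < x := hx
      convert! (Real.hasDerivAt_sqrt hx'.ne').ofReal_comp using 1
      have h1 : (√x : ℂ) * √x = x := by exact_mod_cast Real.mul_self_sqrt hx'.le
      have h2 : (√x : ℂ) ≠ 0 := by exact_mod_cast (Real.sqrt_pos.2 hx').ne'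
      push_cast
      rw [← h1]
      field_simp
    have hd (x : ℝ) (hx : x ∈ posLine) : pd posLine 1 g x =
        (√x : ℂ) * (2 * x : ℂ)⁻¹ * f x + √x * pd posLine 1 f x := by
      refine (hasDerivAt_test g x).unique ?_
      convert! (hsqrt x hx).mul (hasDerivAt_test f x) using 1
    have hv0 : (v : ℂ) ≠ 0 := by exact_mod_cast (ne_of_gt hv : v ≠ 0)
    have hinv : HasDerivAt (fun x : ℝ => (2 * x : ℂ)⁻¹) (-(2 * 1) / (2 * v : ℂ) ^ 2) v :=
      (((hasDerivAt_id v).ofReal_comp).const_mul (2 : ℂ)).inv (by simpa using hv0)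
    have hdd : pd posLine 1 (pd posLine 1 g) v = _ :=
      (hasDerivAt_test (pd posLine 1 g) v).unique
        (((((hsqrt v hv).mul hinv).mul (hasDerivAt_test f v)).add
          ((hsqrt v hv).mul (hasDerivAt_test (pd posLine 1 f) v))).congr_of_eventuallyEq
          (by filter_upwards [posLine.isOpen.mem_nhds hv] with x hx using hd x hx))
    rw [hdd, hgv]
    simp only [Complex.real_smul, Pi.mul_apply]
    push_cast
    field_simp
    ring
  · simp [test_eq_zero hv]

omit [FiniteDimensional ℝ X] in
theorem rescaledFourier_sqrt_laplacian {hΩ : ∀ p : X × ℝ, p ∈ posPart X ↔ p.2 ∈ posLine} (ξ : X)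
    (η : 𝓓(posPart X, ℂ)) :
    rescaledFourier hΩ isRescaling_sqrt N θ ξ (pd (posPart X) (0, 1) (pd (posPart X) (0, 1) η)) +
        rescaledFourier hΩ isRescaling_sqrt N θ ξ (invPow' X 1 (pd (posPart X) (0, 1) η)) =
      pd posLine 1 (pd posLine 1 (rescaledFourier hΩ isRescaling_sqrt N θ ξ η)) +
        (1 / 4 : ℂ) • invPow 2 (rescaledFourier hΩ isRescaling_sqrt N θ ξ η) := by
  have h := partialFourier_mulBy (hΩ := hΩ) (N := N) (θ := θ) (contDiffOn_inv 1)
    (contDiffOn_inv' X 1) ξ (pd (posPart X) (0, 1) η)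
  simp only [rescaledFourier, LinearMap.comp_apply] at h ⊢
  rw [invPow', h, partialFourier_pd_snd, partialFourier_pd_snd]
  exact mulBy_sqrt_laplacian _

omit [FiniteDimensional ℝ X] in
theorem rescaledFourier_invPow' {hΩ : ∀ p : X × ℝ, p ∈ posPart X ↔ p.2 ∈ posLine} (n : ℕ)
    {hw : IsRescaling posLine w ρ ν} (ξ : X) (η : 𝓓(posPart X, ℂ)) :
    rescaledFourier hΩ hw N θ ξ (invPow' X n η) = invPow n (rescaledFourier hΩ hw N θ ξ η) :=
  rescaledFourier_mulBy hΩ hw (contDiffOn_inv n) (contDiffOn_inv' X n) ξ η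

omit [FiniteDimensional ℝ X] in
theorem rescaledFourier_expMul' {hΩ : ∀ p : X × ℝ, p ∈ (⊤ : Opens (X × ℝ)) ↔ p.2 ∈ (⊤ : Opens ℝ)}
    (v₀ : ℝ) {hw : IsRescaling ⊤ w ρ ν} (ξ : X) (η : 𝓓((⊤ : Opens (X × ℝ)), ℂ)) :
    rescaledFourier hΩ hw N θ ξ (expMul' X v₀ η) =
      expMul v₀ (rescaledFourier hΩ hw N θ ξ η) :=
  rescaledFourier_mulBy hΩ hw (c := fun u => v₀ ^ 2 * Real.exp (2 * u)) (by fun_prop)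
    (by fun_prop) ξ η

/-- With `ξ = (k, λ)`, the derivative `∂_φ` becomes `ik` and `-iħ ∂_t` becomes `λ`. -/
theorem rescaledFourier_C₁ {ħ : ℝ} (hħ : 0 < ħ) (ξ : ℝ × ℝ) (η : 𝓓(posPart (ℝ × ℝ), ℂ)) :
    rescaledFourier mem_posPart_iff isRescaling_sqrt N (prodForm 1 (1 / ħ)) ξ (C₁ ħ η) =
      (ξ.2 : ℂ) • rescaledFourier mem_posPart_iff isRescaling_sqrt N (prodForm 1 (1 / ħ)) ξ η +
        ((-1 : ℝ) : ℂ) • D₁ ħ ξ.1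
          (rescaledFourier mem_posPart_iff isRescaling_sqrt N (prodForm 1 (1 / ħ)) ξ η) := by
  have hħ' : (ħ : ℂ) ≠ 0 := by exact_mod_cast hħ.ne'
  have h1 := rescaledFourier_sqrt_laplacian (N := N) (θ := prodForm 1 (1 / ħ))
    (hΩ := mem_posPart_iff) ξ η
  change rescaledFourier _ _ _ _ _
    ((ħ : ℂ) ^ 2 • pd _ (0, 1) (pd _ (0, 1) η) + (ħ : ℂ) ^ 2 • invPow' _ 1 (pd _ (0, 1) η)
      - (ħ : ℂ) ^ 2 • invPow' _ 2 (pd _ ((1, 0), 0) (pd _ ((1, 0), 0) η))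
      - (Complex.I * ħ) • pd _ ((0, 1), 0) η) = _
  rw [map_sub, map_sub, ← smul_add, map_smul, map_add, h1, map_smul, map_smul,
    rescaledFourier_invPow', rescaledFourier_pd_fst, rescaledFourier_pd_fst,
    rescaledFourier_pd_fst]
  ext v
  generalize rescaledFourier mem_posPart_iff isRescaling_sqrt N (prodForm 1 (1 / ħ)) ξ η = g
  change (ħ : ℂ) ^ 2 * (pd _ 1 (pd _ 1 g) v + (1 / 4 : ℂ) * ((v ^ 2)⁻¹ • g v))
    - (ħ : ℂ) ^ 2 * ((v ^ 2)⁻¹ • ((Complex.I * prodForm 1 (1 / ħ) ξ (1, 0) : ℂ) *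
      ((Complex.I * prodForm 1 (1 / ħ) ξ (1, 0) : ℂ) * g v)))
    - (Complex.I * ħ) * ((Complex.I * prodForm 1 (1 / ħ) ξ (0, 1) : ℂ) * g v) =
    ξ.2 * g v + ((-1 : ℝ) : ℂ) * ((ħ : ℂ) ^ 2 * (-(pd _ 1 (pd _ 1 g) v)
      - (1 / 4 + (ξ.1 : ℂ) ^ 2) * ((v ^ 2)⁻¹ • g v)))
  simp only [prodForm_apply, Complex.real_smul]
  push_cast
  linear_combination (-(ħ : ℂ) ^ 2 * ξ.1 ^ 2 * (v ^ 2 : ℂ)⁻¹ * g v - ξ.2 * g v) * Complex.I_sq -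
    ξ.2 * g v * Complex.I ^ 2 * mul_one_div_cancel hħ'

theorem rescaledFourier_Ham (ħ k : ℝ) (η : 𝓓(posPart ℝ, ℂ)) :
    rescaledFourier mem_posPart_iff isRescaling_sqrt N (mulForm 1) k (Ham ħ η) =
      ((0 : ℝ) : ℂ) • rescaledFourier mem_posPart_iff isRescaling_sqrt N (mulForm 1) k η +
        ((1 : ℝ) : ℂ) • D₁ ħ k
          (rescaledFourier mem_posPart_iff isRescaling_sqrt N (mulForm 1) k η) := by
  have h1 := rescaledFourier_sqrt_laplacian (N := N) (θ := mulForm 1)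
    (hΩ := mem_posPart_iff) k η
  change rescaledFourier _ _ _ _ _ ((ħ : ℂ) ^ 2 • (-(pd _ (0, 1) (pd _ (0, 1) η))
    - invPow' _ 1 (pd _ (0, 1) η) + invPow' _ 2 (pd _ (1, 0) (pd _ (1, 0) η)))) = _
  rw [map_smul, map_add, ← neg_add', map_neg, map_add, h1, 
    rescaledFourier_invPow', rescaledFourier_pd_fst, rescaledFourier_pd_fst]
  ext v
  generalize rescaledFourier mem_posPart_iff isRescaling_sqrt N (mulForm 1) k η = g
  change (ħ : ℂ) ^ 2 * (-(pd _ 1 (pd _ 1 g) v + (1 / 4 : ℂ) * ((v ^ 2)⁻¹ • g v))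
    + (v ^ 2)⁻¹ • ((Complex.I * mulForm 1 k 1 : ℂ) * ((Complex.I * mulForm 1 k 1 : ℂ) * g v))) =
    ((0 : ℝ) : ℂ) * g v + ((1 : ℝ) : ℂ) * ((ħ : ℂ) ^ 2 * (-(pd _ 1 (pd _ 1 g) v)
      - (1 / 4 + (k : ℂ) ^ 2) * ((v ^ 2)⁻¹ • g v)))
  simp only [mulForm_apply, Complex.real_smul]
  push_cast
  linear_combination ((ħ : ℂ) ^ 2 * k ^ 2 * (v ^ 2 : ℂ)⁻¹ * g v) * Complex.I_sq

/-- The roles are exchanged: `k` now enters only through the shift, whereas `λ` multiplies the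
exponential and stays in the fibre operator. -/
theorem rescaledFourier_C₂ {ħ : ℝ} (hħ : 0 < ħ) (v₀ : ℝ) (ξ : ℝ × ℝ)
    (η : 𝓓((⊤ : Opens ((ℝ × ℝ) × ℝ)), ℂ)) :
    rescaledFourier mem_top_iff_snd isRescaling_one N (prodForm 1 (1 / ħ)) ξ (C₂ ħ v₀ η) =
      ((-(ħ ^ 2 * ξ.1 ^ 2) : ℝ) : ℂ) •
          rescaledFourier mem_top_iff_snd isRescaling_one N (prodForm 1 (1 / ħ)) ξ η +
        ((1 : ℝ) : ℂ) • D₂ ħ v₀ ξ.2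
          (rescaledFourier mem_top_iff_snd isRescaling_one N (prodForm 1 (1 / ħ)) ξ η) := by
  have hħ' : (ħ : ℂ) ≠ 0 := by exact_mod_cast hħ.ne'
  change rescaledFourier _ _ _ _ _
    ((ħ : ℂ) ^ 2 • pd _ ((1, 0), 0) (pd _ ((1, 0), 0) η) - (ħ : ℂ) ^ 2 • pd _ (0, 1) (pd _ (0, 1) η)
      + (Complex.I * ħ) • expMul' _ v₀ (pd _ ((0, 1), 0) η)) = _
  rw [map_add, map_sub, map_smul, map_smul, map_smul, rescaledFourier_expMul',
    rescaledFourier_one_pd_snd, rescaledFourier_one_pd_snd, rescaledFourier_pd_fst,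
    rescaledFourier_pd_fst, rescaledFourier_pd_fst]
  ext v
  generalize rescaledFourier mem_top_iff_snd isRescaling_one N (prodForm 1 (1 / ħ)) ξ η = g
  change (ħ : ℂ) ^ 2 * ((Complex.I * prodForm 1 (1 / ħ) ξ (1, 0) : ℂ) *
      ((Complex.I * prodForm 1 (1 / ħ) ξ (1, 0) : ℂ) * g v))
    - (ħ : ℂ) ^ 2 * pd _ 1 (pd _ 1 g) v + (Complex.I * ħ) * ((v₀ ^ 2 * Real.exp (2 * v)) •
      ((Complex.I * prodForm 1 (1 / ħ) ξ (0, 1) : ℂ) * g v)) =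
    ((-(ħ ^ 2 * ξ.1 ^ 2) : ℝ) : ℂ) * g v + ((1 : ℝ) : ℂ) * ((ħ : ℂ) ^ 2 * (-(pd _ 1 (pd _ 1 g) v))
      - (ξ.2 : ℂ) * ((v₀ ^ 2 * Real.exp (2 * v)) • g v))
  simp only [prodForm_apply, Complex.real_smul]
  push_cast
  field_simp
  linear_combination ((ħ : ℂ) ^ 2 * ξ.1 ^ 2 * g v +
    ξ.2 * (v₀ ^ 2 * Complex.exp (2 * v)) * g v) * Complex.I_sq

theorem rescaledFourier_Gop {ħ : ℝ} (hħ : 0 < ħ) (v₀ l : ℝ) (η : 𝓓((⊤ : Opens (ℝ × ℝ)), ℂ)) :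
    rescaledFourier mem_top_iff_snd isRescaling_one N (mulForm (1 / ħ)) l (Gop ħ v₀ η) =
      ((0 : ℝ) : ℂ) • rescaledFourier mem_top_iff_snd isRescaling_one N (mulForm (1 / ħ)) l η +
        ((1 : ℝ) : ℂ) • D₂ ħ v₀ l
          (rescaledFourier mem_top_iff_snd isRescaling_one N (mulForm (1 / ħ)) l η) := by
  have hħ' : (ħ : ℂ) ≠ 0 := by exact_mod_cast hħ.ne'
  change rescaledFourier _ _ _ _ _ ((ħ : ℂ) ^ 2 • -(pd _ (0, 1) (pd _ (0, 1) η))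
    - expMul' _ v₀ ((-(Complex.I * ħ)) • pd _ (1, 0) η)) = _
  rw [map_sub, map_smul, map_neg, map_smul, map_smul, rescaledFourier_expMul',
    rescaledFourier_one_pd_snd, rescaledFourier_one_pd_snd, rescaledFourier_pd_fst]
  ext v
  generalize rescaledFourier mem_top_iff_snd isRescaling_one N (mulForm (1 / ħ)) l η = g
  change (ħ : ℂ) ^ 2 * -(pd _ 1 (pd _ 1 g) v) - -(Complex.I * ħ) * ((v₀ ^ 2 * Real.exp (2 * v)) •
      ((Complex.I * mulForm (1 / ħ) l 1 : ℂ) * g v)) =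
    ((0 : ℝ) : ℂ) * g v + ((1 : ℝ) : ℂ) * ((ħ : ℂ) ^ 2 * (-(pd _ 1 (pd _ 1 g) v))
      - (l : ℂ) * ((v₀ ^ 2 * Real.exp (2 * v)) • g v))
  simp only [mulForm_apply, Complex.real_smul]
  push_cast
  field_simp
  linear_combination (l * (v₀ ^ 2 * Complex.exp (2 * v)) * g v) * Complex.I_sq

end Intertwining

/-! ### The one-dimensional operators -/

section OneDimensional

open Filter Topology

theorem isSchrodinger_D₁ (ħ k : ℝ) :
    IsSchrodinger (D₁ ħ k) (ħ ^ 2) fun v => ħ ^ 2 * (1 / 4 + k ^ 2) * (v ^ 2)⁻¹ := by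
  refine ⟨continuousOn_const.mul (contDiffOn_inv 2).continuousOn, fun η v => ?_⟩
  change (ħ : ℂ) ^ 2 * (-(pd posLine 1 (pd posLine 1 η) v) -
    (1 / 4 + (k : ℂ) ^ 2) * ((v ^ 2)⁻¹ • η v)) = _
  rw [Complex.real_smul]
  push_cast
  ring

theorem isSchrodinger_D₂ (ħ v₀ l : ℝ) :
    IsSchrodinger (D₂ ħ v₀ l) (ħ ^ 2) fun u => l * (v₀ ^ 2 * Real.exp (2 * u)) := by
  refine ⟨by fun_prop, fun η u => ?_⟩
  change (ħ : ℂ) ^ 2 * (-(pd ⊤ 1 (pd ⊤ 1 η) u)) -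
    (l : ℂ) * ((v₀ ^ 2 * Real.exp (2 * u)) • η u) = _
  rw [Complex.real_smul]
  push_cast
  ring

theorem volume_eq_restrict_top : (volume : Measure ℝ) = volume.restrict ((⊤ : Opens ℝ) : Set ℝ) :=
  Measure.restrict_univ.symm

/-- The function `v^{1/2 + ik}` is annihilated by the expression, is bounded near `0`, and has
`|f₀|² Im r = v · k / v = k`. It is cut off before infinity. -/
theorem not_isEssentiallySelfAdjoint_D₁ {ħ k : ℝ} (hħ : 0 < ħ) (hk : k ≠ 0) :
    ¬ IsEssentiallySelfAdjoint (minimalOp halfLine (D₁ ħ k)) := by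
  have hχ : ContDiff ℝ ∞ fun v : ℝ => Real.smoothTransition (2 - v) :=
    Real.smoothTransition.contDiff.comp (contDiff_const.sub contDiff_id)
  refine (isSchrodinger_D₁ ħ k).not_isEssentiallySelfAdjoint rfl (by positivity)
    (fun v hv => zero_lt_one.trans_le hv.1) hχ (c₀ := 1) (c₁ := 0)
    (fun v hv => Real.smoothTransition.one_of_one_le (by linarith))
    (fun v hv => Real.smoothTransition.zero_of_nonpos (by linarith)) (by norm_num)
    (f₀ := fun v => (√v : ℂ) * Complex.exp (Complex.I * (k * Real.log v : ℝ)))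
    (r := fun v => (1 / 2 + Complex.I * k) * (v : ℂ)⁻¹)
    (r' := fun v => (1 / 2 + Complex.I * k) * -((v : ℂ) ^ 2)⁻¹) (κ := k) (m := 0) hk ?_ ?_ ?_ ?_ ?_
    ?_
  · intro v hv
    have hv' : 0 < v := hv
    have h1 := (Real.hasDerivAt_sqrt hv'.ne').ofReal_comp
    have h2 := ((((Real.hasDerivAt_log hv'.ne').const_mul k).ofReal_comp).const_mul
      Complex.I).cexp
    convert! h1.mul h2 using 1
    have h3 : (√v : ℂ) * √v = v := by exact_mod_cast Real.mul_self_sqrt hv'.le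
    have h4 : (√v : ℂ) ≠ 0 := by exact_mod_cast (Real.sqrt_pos.2 hv').ne'
    push_cast
    rw [← h3]
    field_simp
  · intro v hv
    have hv' : (v : ℂ) ≠ 0 := by exact_mod_cast (ne_of_gt hv : v ≠ 0)
    have h1 : HasDerivAt (fun v : ℝ => (v : ℂ)⁻¹) (-((v : ℂ) ^ 2)⁻¹) v :=
      (hasDerivAt_inv hv').comp_ofReal
    exact h1.const_mul _
  · refine continuousOn_const.mul (ContinuousOn.neg (ContinuousOn.inv₀ (by fun_prop) ?_))
    intro v hv
    have hv' : (v : ℂ) ≠ 0 := by exact_mod_cast (ne_of_gt hv : v ≠ 0)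
    exact pow_ne_zero 2 hv'
  · intro v hv
    push_cast
    linear_combination (-(ħ : ℂ) ^ 2 * k ^ 2 * ((v : ℂ) ^ 2)⁻¹) * Complex.I_sq
  · intro v hv
    have hv' : 0 < v := hv
    have h1 : ‖Complex.exp (Complex.I * (k * Real.log v : ℝ))‖ = 1 := by
      rw [mul_comm, Complex.norm_exp_ofReal_mul_I]
    have h2 : ((1 / 2 + Complex.I * k) * (v : ℂ)⁻¹).im = k * v⁻¹ := by
      rw [← Complex.ofReal_inv, Complex.im_mul_ofReal]
      simp
    rw [norm_mul, h1, mul_one, Complex.norm_real, Real.norm_of_nonneg (Real.sqrt_nonneg v),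
      Real.sq_sqrt hv'.le, h2]
    field_simp
  · have hm : Measurable fun v : ℝ => ((Real.smoothTransition (2 - v) : ℝ) : ℂ) *
        ((√v : ℂ) * Complex.exp (Complex.I * (k * Real.log v : ℝ))) := by
      refine (Complex.measurable_ofReal.comp hχ.continuous.measurable).mul
        ((Complex.measurable_ofReal.comp Real.continuous_sqrt.measurable).mul
          (Complex.measurable_exp.comp ((Complex.measurable_ofReal.comp
            (Real.measurable_log.const_mul k)).const_mul _)))
    have hs : (Iic (2 : ℝ)).indicator (fun v : ℝ => ((Real.smoothTransition (2 - v) : ℝ) : ℂ) *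
        ((√v : ℂ) * Complex.exp (Complex.I * (k * Real.log v : ℝ)))) =
        fun v : ℝ => ((Real.smoothTransition (2 - v) : ℝ) : ℂ) *
        ((√v : ℂ) * Complex.exp (Complex.I * (k * Real.log v : ℝ))) := by
      refine indicator_eq_self.2 fun v hv => ?_
      by_contra h
      refine hv ?_
      have h0 : Real.smoothTransition (2 - v) = 0 :=
        Real.smoothTransition.zero_of_nonpos (by linarith [not_le.1 (show ¬ v ≤ 2 from h)])
      simp [h0]
    rw [← hs, memLp_indicator_iff_restrict measurableSet_Iic]
    have hfin : IsFiniteMeasure ((volume.restrict (posLine : Set ℝ)).restrict (Iic 2)) := by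
      refine ⟨?_⟩
      change ((volume.restrict (Ioi (0 : ℝ))).restrict (Iic 2)) univ < ⊤
      rw [Measure.restrict_restrict measurableSet_Iic, Measure.restrict_apply_univ,
        inter_comm, Ioi_inter_Iic]
      simp
    refine MemLp.of_bound hm.aestronglyMeasurable √2 ?_
    filter_upwards [ae_restrict_mem measurableSet_Iic] with v hv
    have h1 : ‖Complex.exp (Complex.I * (k * Real.log v : ℝ))‖ = 1 := by
      rw [mul_comm, Complex.norm_exp_ofReal_mul_I]
    rw [norm_mul, norm_mul, h1, mul_one, Complex.norm_real, Complex.norm_real,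
      Real.norm_of_nonneg (Real.sqrt_nonneg v),
      Real.norm_of_nonneg (Real.smoothTransition.nonneg _)]
    calc Real.smoothTransition (2 - v) * √v ≤ 1 * √2 :=
          mul_le_mul (Real.smoothTransition.le_one _) (Real.sqrt_le_sqrt hv)
            (Real.sqrt_nonneg _) zero_le_one
      _ = √2 := one_mul _

/-- The function `exp(-u/2 + i c eᵘ)` is an exact solution with the real eigenvalue `-ħ²/4`. Its
square modulus `e⁻ᵘ` is integrable at `+∞`, and it is cut off towards `-∞`. -/
theorem not_isEssentiallySelfAdjoint_D₂ {ħ v₀ l : ℝ} (hħ : 0 < ħ) (hv₀ : 0 < v₀) (hl : 0 < l) :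
    ¬ IsEssentiallySelfAdjoint (minimalOp volume (D₂ ħ v₀ l)) := by
  have hχ : ContDiff ℝ ∞ fun u : ℝ => Real.smoothTransition (u - 1) :=
    Real.smoothTransition.contDiff.comp (contDiff_id.sub contDiff_const)
  -- This `c` makes the `e^{2u}` term of `r²` cancel the potential. The real part `-1/2` of `r`
  -- cancels the `eᵘ` term `r'`, leaving a constant.
  obtain ⟨c, hc, hcl⟩ : ∃ c : ℝ, 0 < c ∧ ħ ^ 2 * c ^ 2 = l * v₀ ^ 2 := by
    refine ⟨√l * v₀ / ħ, by positivity, ?_⟩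
    rw [div_pow, mul_pow, Real.sq_sqrt hl.le]
    field_simp
  have hnorm (u : ℝ) : ‖Complex.exp ((-u / 2 : ℝ) + Complex.I * (c * Real.exp u : ℝ))‖ ^ 2 =
      Real.exp (-u) := by
    rw [Complex.norm_exp, ← Real.exp_nat_mul]
    congr 1
    simp
    ring
  refine (isSchrodinger_D₂ ħ v₀ l).not_isEssentiallySelfAdjoint volume_eq_restrict_top
    (by positivity) (fun _ _ => trivial) hχ (c₀ := 0) (c₁ := 1)
    (fun u hu => Real.smoothTransition.zero_of_nonpos (by linarith))
    (fun u hu => Real.smoothTransition.one_of_one_le (by linarith)) (by norm_num)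
    (f₀ := fun u => Complex.exp ((-u / 2 : ℝ) + Complex.I * (c * Real.exp u : ℝ)))
    (r := fun u => -1 / 2 + Complex.I * (c * Real.exp u : ℝ))
    (r' := fun u => Complex.I * (c * Real.exp u : ℝ)) (κ := c) (m := -ħ ^ 2 / 4) hc.ne'
    ?_ ?_ ?_ ?_ ?_ ?_
  · intro u _
    have h1 : HasDerivAt (fun u : ℝ => ((-u / 2 : ℝ) : ℂ)) ((-1 / 2 : ℝ) : ℂ) u :=
      ((hasDerivAt_id u).neg.div_const 2).ofReal_comp
    have h2 := (((Real.hasDerivAt_exp u).const_mul c).ofReal_comp).const_mul Complex.I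
    convert! (h1.add h2).cexp using 1
    push_cast
    simp only [Pi.add_apply]
    ring
  · intro u _
    exact ((((Real.hasDerivAt_exp u).const_mul c).ofReal_comp).const_mul Complex.I).const_add _
  · fun_prop
  · intro u _
    have h : (ħ : ℂ) ^ 2 * c ^ 2 = l * v₀ ^ 2 := by exact_mod_cast hcl
    have h2 : Complex.exp (2 * u) = Complex.exp u ^ 2 := by
      rw [← Complex.exp_nat_mul]; norm_num
    push_cast
    rw [h2]
    linear_combination (-(ħ : ℂ) ^ 2 * c ^ 2 * Complex.exp u ^ 2) * Complex.I_sq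
      + Complex.exp u ^ 2 * h
  · intro u _
    rw [hnorm]
    have : (-1 / 2 + Complex.I * (c * Real.exp u : ℝ)).im = c * Real.exp u := by
      rw [Complex.add_im, Complex.I_mul_im, Complex.ofReal_re]
      norm_num
    rw [this, mul_left_comm, ← Real.exp_add]
    simp
  · have hm : Continuous fun u : ℝ => ((Real.smoothTransition (u - 1) : ℝ) : ℂ) *
        Complex.exp ((-u / 2 : ℝ) + Complex.I * (c * Real.exp u : ℝ)) :=
      (Complex.continuous_ofReal.comp hχ.continuous).mul (by fun_prop)
    have hs : (Ioi (0 : ℝ)).indicator (fun u : ℝ => ((Real.smoothTransition (u - 1) : ℝ) : ℂ) *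
        Complex.exp ((-u / 2 : ℝ) + Complex.I * (c * Real.exp u : ℝ))) =
        fun u : ℝ => ((Real.smoothTransition (u - 1) : ℝ) : ℂ) *
        Complex.exp ((-u / 2 : ℝ) + Complex.I * (c * Real.exp u : ℝ)) := by
      refine indicator_eq_self.2 fun u hu => ?_
      by_contra h
      refine hu ?_
      have h0 : Real.smoothTransition (u - 1) = 0 :=
        Real.smoothTransition.zero_of_nonpos (by linarith [not_lt.1 (show ¬ 0 < u from h)])
      simp [h0]
    rw [← hs, memLp_indicator_iff_restrict measurableSet_Ioi,
      memLp_two_iff_integrable_sq_norm hm.aestronglyMeasurable]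
    refine (integrableOn_exp_neg_Ioi 0).mono' (hm.norm.pow 2).aestronglyMeasurable
      (.of_forall fun u => ?_)
    rw [norm_mul, mul_pow, hnorm, Complex.norm_real, norm_mul, norm_pow, norm_norm,
      Real.norm_of_nonneg (Real.exp_pos _).le]
    refine mul_le_of_le_one_left (Real.exp_pos _).le (pow_le_one₀ (norm_nonneg _) ?_)
    rw [Real.norm_of_nonneg (Real.smoothTransition.nonneg _)]
    exact Real.smoothTransition.le_one _

/-- If `P` fails on `(0, ∞)`, both conditions fail. -/
theorem ae_iff_forall_of_not {P : ℝ → Prop} (h : ∀ x > 0, ¬ P x) : (∀ᵐ x, P x) ↔ ∀ x, P x := by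
  refine ⟨fun hP => ?_, fun hP => .of_forall hP⟩
  have h0 : volume (Ioi (0 : ℝ)) = 0 := measure_mono_null (fun x hx => h x hx) hP
  simp at h0

end OneDimensional

/-! ### The change of variables `v = v₀ eᵘ` -/

section ChangeOfVariables

variable {X : Type*} [NormedAddCommGroup X] [NormedSpace ℝ X] {v₀ : ℝ}
  {η : 𝓓(posPart X, ℂ)} {ζ : 𝓓((⊤ : Opens (X × ℝ)), ℂ)}

theorem pd_fst_eq_of_comp_exp (h : ∀ x u, ζ (x, u) = η (x, v₀ * Real.exp u)) (y x : X) (u : ℝ) :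
    pd ⊤ (y, 0) ζ (x, u) = pd (posPart X) (y, 0) η (x, v₀ * Real.exp u) := by
  have h1 := hasFDerivAt_test_fst ζ x u
  simp_rw [h] at h1
  have h2 := congrArg (fun L : X →L[ℝ] ℂ => L y)
    (h1.unique (hasFDerivAt_test_fst η x (v₀ * Real.exp u)))
  simpa [pd_apply] using h2

theorem pd_snd_eq_of_comp_exp (h : ∀ x u, ζ (x, u) = η (x, v₀ * Real.exp u)) (x : X) (u : ℝ) :
    pd ⊤ (0, 1) ζ (x, u) =
      (v₀ * Real.exp u : ℝ) • pd (posPart X) (0, 1) η (x, v₀ * Real.exp u) := by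
  have h1 := hasDerivAt_test_snd ζ x u
  simp_rw [h] at h1
  have h2 := (hasDerivAt_test_snd η x (v₀ * Real.exp u)).scomp u
    ((Real.hasDerivAt_exp u).const_mul v₀)
  exact h1.unique h2

theorem pd_snd_pd_snd_eq_of_comp_exp (h : ∀ x u, ζ (x, u) = η (x, v₀ * Real.exp u)) (x : X)
    (u : ℝ) : pd ⊤ (0, 1) (pd ⊤ (0, 1) ζ) (x, u) =
      (v₀ * Real.exp u : ℝ) • pd (posPart X) (0, 1) η (x, v₀ * Real.exp u) +
        ((v₀ * Real.exp u) ^ 2 : ℝ) •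
          pd (posPart X) (0, 1) (pd (posPart X) (0, 1) η) (x, v₀ * Real.exp u) := by
  have h1 := hasDerivAt_test_snd (pd ⊤ (0, 1) ζ) x u
  simp_rw [pd_snd_eq_of_comp_exp h] at h1
  have h2 := (hasDerivAt_test_snd (pd (posPart X) (0, 1) η) x (v₀ * Real.exp u)).scomp u
    ((Real.hasDerivAt_exp u).const_mul v₀)
  rw [h1.unique (((Real.hasDerivAt_exp u).const_mul v₀).smul h2), smul_smul, ← pow_two, add_comm]

/-- Since `∂_u = v ∂_v`, one has `∂_u² = v² ∂_v² + v ∂_v`, which absorbs the first-order term of the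
constraint. -/
theorem C₂_eq_of_comp_exp (ħ : ℝ) {v₀ : ℝ} (hv₀ : 0 < v₀) {η : 𝓓(posPart (ℝ × ℝ), ℂ)}
    {ζ : 𝓓((⊤ : Opens ((ℝ × ℝ) × ℝ)), ℂ)} (h : ∀ x u, ζ (x, u) = η (x, v₀ * Real.exp u))
    (x : ℝ × ℝ) (u : ℝ) : C₂ ħ v₀ ζ (x, u) =
      -((v₀ * Real.exp u : ℝ) : ℂ) ^ 2 * C₁ ħ η (x, v₀ * Real.exp u) := by
  have h1 := pd_fst_eq_of_comp_exp (pd_fst_eq_of_comp_exp h (1, 0)) (1, 0) x u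
  have h2 := pd_fst_eq_of_comp_exp h (0, 1) x u
  have h3 := pd_snd_pd_snd_eq_of_comp_exp h x u
  have hv : ((v₀ * Real.exp u : ℝ) : ℂ) ≠ 0 := by
    exact_mod_cast (mul_pos hv₀ (Real.exp_pos u)).ne'
  have he : ((v₀ ^ 2 * Real.exp (2 * u) : ℝ) : ℂ) = ((v₀ * Real.exp u : ℝ) : ℂ) ^ 2 := by
    rw [two_mul, Real.exp_add]
    push_cast
    ring
  change (ħ : ℂ) ^ 2 * pd _ ((1, 0), 0) (pd _ ((1, 0), 0) ζ) (x, u)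
    - (ħ : ℂ) ^ 2 * pd _ (0, 1) (pd _ (0, 1) ζ) (x, u)
    + (Complex.I * ħ) * ((v₀ ^ 2 * Real.exp (2 * u)) • pd _ ((0, 1), 0) ζ (x, u)) = _
  rw [h1, h2, h3]
  generalize hvv : v₀ * Real.exp u = v at *
  change _ = -(v : ℂ) ^ 2 * ((ħ : ℂ) ^ 2 * pd _ (0, 1) (pd _ (0, 1) η) (x, v)
    + (ħ : ℂ) ^ 2 * ((v ^ 1)⁻¹ • pd _ (0, 1) η (x, v))
    - (ħ : ℂ) ^ 2 * ((v ^ 2)⁻¹ • pd _ ((1, 0), 0) (pd _ ((1, 0), 0) η) (x, v))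
    - (Complex.I * ħ) * pd _ ((0, 1), 0) η (x, v))
  simp only [Complex.real_smul, he]
  push_cast
  field_simp
  ring

end ChangeOfVariables

/-! ### The four constraint and Hamiltonian operators -/

section Operators

open Filter Topology

theorem exists_mem_graph_iff {H : Type*} [AddCommGroup H] [Module ℂ H] {T : H →ₗ.[ℂ] H}
    {P : H → H → Prop} : (∃ p ∈ T.graph, P p.1 p.2) ↔
      ∃ f : (T.domRestrict ⊤).domain, P f (T.domRestrict ⊤ f) := by
  constructor
  · rintro ⟨p, hp, h⟩
    obtain ⟨f, hf1, hf2⟩ := (LinearPMap.mem_graph_iff _).1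
      (mem_graph_domRestrict.2 ⟨hp, Submodule.mem_top⟩ : p ∈ (T.domRestrict ⊤).graph)
    exact ⟨f, by rwa [hf1, hf2]⟩
  · rintro ⟨f, h⟩
    exact ⟨_, (mem_graph_domRestrict.1 (LinearPMap.mem_graph _ f)).1, h⟩

theorem IsFibred.mem_graph_domRestrict_top {X : Type*} [NormedAddCommGroup X] [NormedSpace ℝ X]
    [MeasureSpace X] [BorelSpace X] [FiniteDimensional ℝ X] [SecondCountableTopology X]
    {Ω : Opens (X × ℝ)} {Ω₁ : Opens ℝ} {ρ ν : Measure ℝ}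
    [SFinite ν] [IsFiniteMeasureOnCompacts ((volume : Measure X).prod ρ)]
    [IsFiniteMeasureOnCompacts ν]
    {U : Lp ℂ 2 ((volume : Measure X).prod ρ) ≃ₗᵢ[ℂ] Lp ℂ 2 ((volume : Measure X).prod ν)}
    {A : Module.End ℂ 𝓓(Ω, ℂ)} {B : X → Module.End ℂ 𝓓(Ω₁, ℂ)} {c : X → ℝ} {σ : ℝ}
    (h : IsFibred U A B c σ) (Ψ χ : Lp ℂ 2 ((volume : Measure X).prod ρ)) :
    (Ψ, χ) ∈ ((maximalOp ((volume : Measure X).prod ρ) A).domRestrict ⊤).graph ↔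
      ∀ᵐ ξ, ∃ f : ((maximalOp ν (B ξ)).domRestrict ⊤).domain, IsFibre (U Ψ) ξ f ∧
        IsFibre (U χ) ξ ((c ξ : ℂ) • (f : Lp ℂ 2 ν) +
          (σ : ℂ) • (maximalOp ν (B ξ)).domRestrict ⊤ f) := by
  rw [mem_graph_domRestrict, and_iff_left (show (Ψ, χ).1 ∈ (⊤ : Submodule ℂ _) from trivial),
    h.mem_graph_maximalOp]
  exact eventually_congr (.of_forall fun ξ => exists_mem_graph_iff
    (P := fun f g => IsFibre (U Ψ) ξ f ∧ IsFibre (U χ) ξ ((c ξ : ℂ) • f + (σ : ℂ) • g)))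

/-- By Fubini, a cylinder in the plane is null exactly when its base is. -/
theorem ae_fst_iff {P : ℝ → Prop} : (∀ᵐ ξ : ℝ × ℝ, P ξ.1) ↔ ∀ᵐ x, P x := by
  refine ⟨fun h => ?_, fun h => Measure.quasiMeasurePreserving_fst.ae h⟩
  filter_upwards [Measure.ae_ae_of_ae_prod h] with x hx
  simpa using hx

theorem ae_snd_iff {P : ℝ → Prop} : (∀ᵐ ξ : ℝ × ℝ, P ξ.2) ↔ ∀ᵐ x, P x := by
  refine ⟨fun h => ?_, fun h => Measure.quasiMeasurePreserving_snd.ae h⟩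
  simpa using Measure.ae_ae_of_ae_prod h

theorem IsMeasurableClosedField.comp_fst {H : Type*} [NormedAddCommGroup H]
    [InnerProductSpace ℂ H] {T : ℝ → H →ₗ.[ℂ] H} (hT : IsMeasurableClosedField T) :
    IsMeasurableClosedField fun ξ : ℝ × ℝ => T ξ.1 := by
  obtain ⟨s, hs, hsT⟩ := hT
  exact ⟨fun n ξ => s n ξ.1, fun n => (hs n).comp_measurable measurable_fst, ae_fst_iff.2 hsT⟩

theorem IsMeasurableClosedField.comp_snd {H : Type*} [NormedAddCommGroup H]
    [InnerProductSpace ℂ H] {T : ℝ → H →ₗ.[ℂ] H} (hT : IsMeasurableClosedField T) :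
    IsMeasurableClosedField fun ξ : ℝ × ℝ => T ξ.2 := by
  obtain ⟨s, hs, hsT⟩ := hT
  exact ⟨fun n ξ => s n ξ.2, fun n => (hs n).comp_measurable measurable_snd, ae_snd_iff.2 hsT⟩

theorem D₁_eq_add_smul (ħ k : ℝ) : D₁ ħ k = (ħ : ℂ) ^ 2 • -(pd posLine 1 * pd posLine 1) +
    (-((ħ : ℂ) ^ 2 * (1 / 4 + (k : ℂ) ^ 2))) • invPow 2 := by
  rw [D₁]
  module

theorem D₂_eq_add_smul (ħ v₀ l : ℝ) :
    D₂ ħ v₀ l = (ħ : ℂ) ^ 2 • -(pd ⊤ 1 * pd ⊤ 1) + (-(l : ℂ)) • expMul v₀ := by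
  rw [D₂]
  module

variable {ħ : ℝ} (hħ : 0 < ħ)

include hħ in
theorem normalisation_prodForm :
    (1 / (2 * Real.pi * √ħ)) ^ 2 * (2 * Real.pi) ^ 2 = 1 * (1 / ħ) := by
  have := Real.pi_pos
  rw [div_pow, mul_pow, Real.sq_sqrt hħ.le]
  field_simp

include hħ in
theorem normalisation_mulForm :
    (1 / √(2 * Real.pi * ħ)) ^ 2 * (2 * Real.pi) = 1 / ħ := by
  have := Real.pi_pos
  rw [div_pow, Real.sq_sqrt (by positivity)]
  field_simp

theorem normalisation_mulForm_one : (1 / √(2 * Real.pi)) ^ 2 * (2 * Real.pi) = 1 := by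
  have := Real.pi_pos
  rw [div_pow, Real.sq_sqrt (by positivity)]
  field_simp

/-- The unitary map which decomposes `Ĉ₁`. -/
noncomputable def unitaryC₁ :
    Lp ℂ 2 kin₁ ≃ₗᵢ[ℂ] Lp ℂ 2 ((volume : Measure (ℝ × ℝ)).prod halfLine) :=
  fourierUnitary (Ω := posPart (ℝ × ℝ)) mem_posPart_iff isRescaling_sqrt
    (isFourierKernel_prodForm one_pos (one_div_pos.2 hħ) (normalisation_prodForm hħ))

/-- The unitary map which decomposes `Ĥ`. -/
noncomputable def unitaryHam :
    Lp ℂ 2 tClock ≃ₗᵢ[ℂ] Lp ℂ 2 ((volume : Measure ℝ).prod halfLine) :=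
  fourierUnitary (Ω := posPart ℝ) mem_posPart_iff isRescaling_sqrt
    (isFourierKernel_mulForm one_pos normalisation_mulForm_one)

/-- The unitary map which decomposes `Ĉ₂`. -/
noncomputable def unitaryC₂ : Lp ℂ 2 kin₂ ≃ₗᵢ[ℂ] Lp ℂ 2 kin₂ :=
  fourierUnitary (Ω := (⊤ : Opens ((ℝ × ℝ) × ℝ))) mem_top_iff_snd isRescaling_one
    (isFourierKernel_prodForm one_pos (one_div_pos.2 hħ) (normalisation_prodForm hħ))

/-- The unitary map which decomposes `Ĝ`. -/
noncomputable def unitaryGop : Lp ℂ 2 phiClock ≃ₗᵢ[ℂ] Lp ℂ 2 phiClock :=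
  fourierUnitary (Ω := (⊤ : Opens (ℝ × ℝ))) mem_top_iff_snd isRescaling_one
    (isFourierKernel_mulForm (one_div_pos.2 hħ) (normalisation_mulForm hħ))

theorem IsRescaledFourier.congr {X : Type*} [NormedAddCommGroup X] [NormedSpace ℝ X]
    [MeasureSpace X] [BorelSpace X] [SecondCountableTopology X] {Ω : Opens (X × ℝ)}
    {ρ ν : Measure ℝ} [IsFiniteMeasureOnCompacts ((volume : Measure X).prod ρ)]
    {w : ℝ → ℝ} {N : ℝ} {θ θ' : X → X → ℝ}
    {U : Lp ℂ 2 ((volume : Measure X).prod ρ) ≃ₗᵢ[ℂ] Lp ℂ 2 ((volume : Measure X).prod ν)}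
    (h : IsRescaledFourier Ω w N θ U) (hθ : ∀ ξ x, θ ξ x = θ' ξ x) :
    IsRescaledFourier Ω w N θ' U := by
  obtain rfl : θ = θ' := funext₂ hθ
  exact h

theorem isRescaledFourier_unitaryC₁ :
    IsRescaledFourier (posPart (ℝ × ℝ)) Real.sqrt (1 / (2 * Real.pi * √ħ))
      (fun ξ x => ξ.1 * x.1 + ξ.2 * x.2 / ħ) (unitaryC₁ hħ) :=
  (isRescaledFourier_fourierUnitary _ _ _).congr fun ξ x => by rw [prodForm_apply]; ring

theorem isRescaledFourier_unitaryHam :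
    IsRescaledFourier (posPart ℝ) Real.sqrt (1 / √(2 * Real.pi)) (fun k x => k * x) unitaryHam :=
  (isRescaledFourier_fourierUnitary _ _ _).congr fun ξ x => by rw [mulForm_apply]; ring

theorem isRescaledFourier_unitaryC₂ :
    IsRescaledFourier ⊤ (fun _ => 1) (1 / (2 * Real.pi * √ħ))
      (fun ξ x => ξ.1 * x.1 + ξ.2 * x.2 / ħ) (unitaryC₂ hħ) :=
  (isRescaledFourier_fourierUnitary _ _ _).congr fun ξ x => by rw [prodForm_apply]; ring

theorem isRescaledFourier_unitaryGop :
    IsRescaledFourier ⊤ (fun _ => 1) (1 / √(2 * Real.pi * ħ)) (fun l x => l * x / ħ)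
      (unitaryGop hħ) :=
  (isRescaledFourier_fourierUnitary _ _ _).congr fun ξ x => by rw [mulForm_apply]; ring

theorem isFibred_C₁ :
    IsFibred (unitaryC₁ hħ) (C₁ ħ) (fun ξ => D₁ ħ ξ.1) (fun ξ => ξ.2) (-1) :=
  isFibred_fourierUnitary _ _ _ (fun ξ => (isSchrodinger_D₁ ħ ξ.1).isFormallySymmetric rfl)
    (by fun_prop) (fun ξ => D₁_eq_add_smul ħ ξ.1) measurable_snd (by norm_num)
    (rescaledFourier_C₁ hħ)

theorem isFibred_Ham : IsFibred unitaryHam (Ham ħ) (D₁ ħ) (fun _ => 0) 1 :=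
  isFibred_fourierUnitary _ _ _ (fun k => (isSchrodinger_D₁ ħ k).isFormallySymmetric rfl)
    (by fun_prop) (D₁_eq_add_smul ħ) measurable_const (by norm_num) (rescaledFourier_Ham ħ)

theorem isFibred_C₂ (v₀ : ℝ) : IsFibred (unitaryC₂ hħ) (C₂ ħ v₀) (fun ξ => D₂ ħ v₀ ξ.2)
    (fun ξ => -(ħ ^ 2 * ξ.1 ^ 2)) 1 :=
  isFibred_fourierUnitary _ _ _
    (fun ξ => (isSchrodinger_D₂ ħ v₀ ξ.2).isFormallySymmetric volume_eq_restrict_top)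
    (by fun_prop) (fun ξ => D₂_eq_add_smul ħ v₀ ξ.2) (by fun_prop) (by norm_num)
    (rescaledFourier_C₂ hħ v₀)

theorem isFibred_Gop (v₀ : ℝ) :
    IsFibred (unitaryGop hħ) (Gop ħ v₀) (D₂ ħ v₀) (fun _ => 0) 1 :=
  isFibred_fourierUnitary _ _ _
    (fun l => (isSchrodinger_D₂ ħ v₀ l).isFormallySymmetric volume_eq_restrict_top)
    (by fun_prop) (D₂_eq_add_smul ħ v₀) measurable_const (by norm_num)
    (rescaledFourier_Gop hħ v₀)

end Operators

end DiracQuantisation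

/-! ### The theorem. -/

open DiracQuantisation in
theorem mainTheorem4 (ħ v₀ : ℝ) (hħ : 0 < ħ) (hv₀ : 0 < v₀) :
    -- multiplying by `v²` and substituting `v = v₀ eᵘ` turns `Ĉ₁` into `Ĉ₂` (up to the sign)
    (∀ (η : TestFunction (posPart (ℝ × ℝ)) ℂ ⊤) (ζ : TestFunction (⊤ : Opens ((ℝ × ℝ) × ℝ)) ℂ ⊤),
      (∀ x u, ζ (x, u) = η (x, v₀ * Real.exp u)) →
      ∀ x u, C₂ ħ v₀ ζ (x, u) =
        -((v₀ * Real.exp u : ℝ) : ℂ) ^ 2 * C₁ ħ η (x, v₀ * Real.exp u)) ∧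
    -- `Ĉ₁`, `Ĥ` and `D̂₁`: rescaling by `v^{1/2}` and Fourier transform
    (∃ (U : Lp ℂ 2 kin₁ ≃ₗᵢ[ℂ] Lp ℂ 2 ((volume : Measure (ℝ × ℝ)).prod halfLine))
       (W : Lp ℂ 2 tClock ≃ₗᵢ[ℂ] Lp ℂ 2 ((volume : Measure ℝ).prod halfLine)),
      IsRescaledFourier (posPart (ℝ × ℝ)) Real.sqrt (1 / (2 * Real.pi * √ħ))
        (fun ξ x => ξ.1 * x.1 + ξ.2 * x.2 / ħ) U ∧
      IsRescaledFourier (posPart ℝ) Real.sqrt (1 / √(2 * Real.pi)) (fun k x => k * x) W ∧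
      (∀ Ψ χ, (Ψ, χ) ∈ (C₁On ħ ⊤).graph ↔ ∀ᵐ ξ : ℝ × ℝ, ∃ f : (D₁On ħ ξ.1 ⊤).domain,
        IsFibre (U Ψ) ξ f ∧ IsFibre (U χ) ξ ((ξ.2 : ℂ) • (f : Lp ℂ 2 halfLine) - D₁On ħ ξ.1 ⊤ f)) ∧
      (∀ Ψ χ, (Ψ, χ) ∈ (HamOn ħ ⊤).graph ↔ ∀ᵐ k : ℝ, ∃ f : (D₁On ħ k ⊤).domain,
        IsFibre (W Ψ) k f ∧ IsFibre (W χ) k (D₁On ħ k ⊤ f)) ∧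
      (∀ S : ℝ × ℝ → Submodule ℂ (Lp ℂ 2 halfLine),
        IsMeasurableClosedField (fun ξ => D₁On ħ ξ.1 (S ξ)) →
        (IsSelfAdjoint (C₁On ħ (pullback U S)) ↔ ∀ᵐ ξ, IsSelfAdjoint (D₁On ħ ξ.1 (S ξ)))) ∧
      (∀ S : ℝ → Submodule ℂ (Lp ℂ 2 halfLine),
        IsMeasurableClosedField (fun k => D₁On ħ k (S k)) →
        (IsSelfAdjoint (HamOn ħ (pullback W S)) ↔ ∀ᵐ k, IsSelfAdjoint (D₁On ħ k (S k))) ∧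
        (IsSelfAdjoint (C₁On ħ (pullback U fun ξ => S ξ.1)) ↔
          IsSelfAdjoint (HamOn ħ (pullback W S))))) ∧
    (IsEssentiallySelfAdjoint (minimalOp kin₁ (C₁ ħ)) ↔
      ∀ᵐ k : ℝ, IsEssentiallySelfAdjoint (minimalOp halfLine (D₁ ħ k))) ∧
    (IsEssentiallySelfAdjoint (minimalOp kin₁ (C₁ ħ)) ↔
      ∀ k : ℝ, IsEssentiallySelfAdjoint (minimalOp halfLine (D₁ ħ k))) ∧
    (IsEssentiallySelfAdjoint (minimalOp kin₁ (C₁ ħ)) ↔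
      IsEssentiallySelfAdjoint (minimalOp tClock (Ham ħ))) ∧
    -- `Ĉ₂`, `Ĝ` and `D̂₂`: Fourier transform
    (∃ (U : Lp ℂ 2 kin₂ ≃ₗᵢ[ℂ] Lp ℂ 2 kin₂) (W : Lp ℂ 2 phiClock ≃ₗᵢ[ℂ] Lp ℂ 2 phiClock),
      IsRescaledFourier ⊤ (fun _ => 1) (1 / (2 * Real.pi * √ħ))
        (fun ξ x => ξ.1 * x.1 + ξ.2 * x.2 / ħ) U ∧
      IsRescaledFourier ⊤ (fun _ => 1) (1 / √(2 * Real.pi * ħ)) (fun l x => l * x / ħ) W ∧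
      (∀ Ψ χ, (Ψ, χ) ∈ (C₂On ħ v₀ ⊤).graph ↔ ∀ᵐ ξ : ℝ × ℝ, ∃ f : (D₂On ħ v₀ ξ.2 ⊤).domain,
        IsFibre (U Ψ) ξ f ∧ IsFibre (U χ) ξ
          (D₂On ħ v₀ ξ.2 ⊤ f - ((ħ : ℂ) ^ 2 * (ξ.1 : ℂ) ^ 2) • (f : Lp ℂ 2 volume))) ∧
      (∀ Ψ χ, (Ψ, χ) ∈ (GopOn ħ v₀ ⊤).graph ↔ ∀ᵐ l : ℝ, ∃ f : (D₂On ħ v₀ l ⊤).domain,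
        IsFibre (W Ψ) l f ∧ IsFibre (W χ) l (D₂On ħ v₀ l ⊤ f)) ∧
      (∀ S : ℝ × ℝ → Submodule ℂ (Lp ℂ 2 (volume : Measure ℝ)),
        IsMeasurableClosedField (fun ξ => D₂On ħ v₀ ξ.2 (S ξ)) →
        (IsSelfAdjoint (C₂On ħ v₀ (pullback U S)) ↔
          ∀ᵐ ξ, IsSelfAdjoint (D₂On ħ v₀ ξ.2 (S ξ)))) ∧
      (∀ S : ℝ → Submodule ℂ (Lp ℂ 2 (volume : Measure ℝ)),
        IsMeasurableClosedField (fun l => D₂On ħ v₀ l (S l)) →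
        (IsSelfAdjoint (GopOn ħ v₀ (pullback W S)) ↔ ∀ᵐ l, IsSelfAdjoint (D₂On ħ v₀ l (S l))) ∧
        (IsSelfAdjoint (C₂On ħ v₀ (pullback U fun ξ => S ξ.2)) ↔
          IsSelfAdjoint (GopOn ħ v₀ (pullback W S))))) ∧
    (IsEssentiallySelfAdjoint (minimalOp kin₂ (C₂ ħ v₀)) ↔
      ∀ᵐ l : ℝ, IsEssentiallySelfAdjoint (minimalOp volume (D₂ ħ v₀ l))) ∧
    (IsEssentiallySelfAdjoint (minimalOp kin₂ (C₂ ħ v₀)) ↔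
      ∀ l : ℝ, IsEssentiallySelfAdjoint (minimalOp volume (D₂ ħ v₀ l))) ∧
    (IsEssentiallySelfAdjoint (minimalOp kin₂ (C₂ ħ v₀)) ↔
      IsEssentiallySelfAdjoint (minimalOp phiClock (Gop ħ v₀))) := by
  have eC₁ : IsEssentiallySelfAdjoint (minimalOp kin₁ (C₁ ħ)) ↔
      ∀ᵐ k : ℝ, IsEssentiallySelfAdjoint (minimalOp halfLine (D₁ ħ k)) :=
    (isFibred_C₁ hħ).isEssentiallySelfAdjoint_iff.trans
      (ae_fst_iff (P := fun k => IsEssentiallySelfAdjoint (minimalOp halfLine (D₁ ħ k))))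
  have eC₂ : IsEssentiallySelfAdjoint (minimalOp kin₂ (C₂ ħ v₀)) ↔
      ∀ᵐ l : ℝ, IsEssentiallySelfAdjoint (minimalOp volume (D₂ ħ v₀ l)) :=
    (isFibred_C₂ hħ v₀).isEssentiallySelfAdjoint_iff.trans
      (ae_snd_iff (P := fun l => IsEssentiallySelfAdjoint (minimalOp volume (D₂ ħ v₀ l))))
  refine ⟨fun η ζ h => C₂_eq_of_comp_exp ħ hv₀ h,
    ⟨unitaryC₁ hħ, unitaryHam, isRescaledFourier_unitaryC₁ hħ, isRescaledFourier_unitaryHam,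
      fun Ψ χ => ?_, fun Ψ χ => ?_, fun S hS => (isFibred_C₁ hħ).isSelfAdjoint_iff hS,
      fun S hS => ⟨isFibred_Ham.isSelfAdjoint_iff hS,
        ((isFibred_C₁ hħ).isSelfAdjoint_iff hS.comp_fst).trans
          (Iff.trans (ae_fst_iff (P := fun k => IsSelfAdjoint (D₁On ħ k (S k))))
            (isFibred_Ham.isSelfAdjoint_iff hS).symm)⟩⟩,
    -- Both conditions are false, since essential self-adjointness fails at every `k > 0`.
    eC₁, eC₁.trans (ae_iff_forall_of_not fun k hk =>
      not_isEssentiallySelfAdjoint_D₁ hħ (ne_of_gt hk)),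
    eC₁.trans isFibred_Ham.isEssentiallySelfAdjoint_iff.symm,
    ⟨unitaryC₂ hħ, unitaryGop hħ, isRescaledFourier_unitaryC₂ hħ, isRescaledFourier_unitaryGop hħ,
      fun Ψ χ => ?_, fun Ψ χ => ?_, fun S hS => (isFibred_C₂ hħ v₀).isSelfAdjoint_iff hS,
      fun S hS => ⟨(isFibred_Gop hħ v₀).isSelfAdjoint_iff hS,
        ((isFibred_C₂ hħ v₀).isSelfAdjoint_iff hS.comp_snd).trans
          (Iff.trans (ae_snd_iff (P := fun l => IsSelfAdjoint (D₂On ħ v₀ l (S l))))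
            ((isFibred_Gop hħ v₀).isSelfAdjoint_iff hS).symm)⟩⟩,
    eC₂, eC₂.trans (ae_iff_forall_of_not fun l hl =>
      not_isEssentiallySelfAdjoint_D₂ hħ hv₀ hl),
    eC₂.trans (isFibred_Gop hħ v₀).isEssentiallySelfAdjoint_iff.symm⟩
  · refine ((isFibred_C₁ hħ).mem_graph_domRestrict_top Ψ χ).trans ?_
    simp only [Complex.ofReal_neg, Complex.ofReal_one, neg_one_smul, ← sub_eq_add_neg]
    rfl
  · refine (isFibred_Ham.mem_graph_domRestrict_top Ψ χ).trans ?_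
    simp only [Complex.ofReal_zero, Complex.ofReal_one, zero_smul, zero_add, one_smul]
    rfl
  · refine ((isFibred_C₂ hħ v₀).mem_graph_domRestrict_top Ψ χ).trans ?_
    simp only [Complex.ofReal_neg, Complex.ofReal_mul, Complex.ofReal_pow, Complex.ofReal_one,
      neg_smul, one_smul, neg_add_eq_sub]
    rfl
  · refine ((isFibred_Gop hħ v₀).mem_graph_domRestrict_top Ψ χ).trans ?_
    simp only [Complex.ofReal_zero, Complex.ofReal_one, zero_smul, zero_add, one_smul]
    rfl
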